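/- **Model.** Let $d\ge 1$ and $0<R_\infty<\infty$. The user is at the origin of $\mathbb R^d$; the base stations $x_i$ form a homogeneous Poisson point process of intensity $\lambda$ on the ball $\{\|x\|<R_\infty\}$ (a Poisson number of points with mean $\lambda$ times the volume of the ball, placed independently and uniformly in it). The multi-slope path loss function is $$l(r)=\sum_{k=0}^{K-1}A_k r^{\beta_k}\mathbf 1(R_k\le r<R_{k+1}),$$ where $K\ge1$, $0=R_0<R_1<\dots<R_K=R_\infty$, $\beta_0\ge 0$, $\beta_k\ge d-1$ for $1\le k\le K-1$, $\beta_k<\beta_{k+1}$ for $0\le k\le K-2$, all $A_k>0$, and $A_kR_{k+1}^{\beta_k}=A_{k+1}R_{k+1}^{\beta_{k+1}}$ for $0\le k\le K-2$. The fading variables $m_i\ge 0$ are i.i.d. with an arbitrary distribution that is not concentrated at $0$, independent of the positions. The received powers are $P_i=m_i/l(\|x_i\|)$, the noise power is $W>0$, and the SINR of the user under strongest cell association is $$Y=Y(\lambda)=\max_i \frac{P_i}{\sum_{j\ne i}P_j+W}\qquad(Y=0\text{ if there is no station}).$$ The coverage is $\mathcal P_y(\lambda)=\mathbb P(Y(\lambda)\ge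 y)$ and the capacity is $\mathcal C(\lambda)=\mathbb E\log(1+Y(\lambda))\in[0,\infty]$. Let $P=m/l(\|x\|)$ be the power received from a random station ($x$ uniform in the ball, $m$ an independent fading variable) and $\bar F_P(t)=\mathbb P(P>t)$. For real $\rho$, $\mathcal R_\rho$ is the class of positive Lebesgue measurable functions $h$ on $(0,\infty)$ with $h(tx)/h(x)\to t^\rho$ as $x\to\infty$ for every $t>0$; $\mathcal R_{-\infty}$ is defined in the same way with the limit $0$ for $t>1$ and $\infty$ for $0<t<1$. **Statement.** Fix $y>0$. 1. If $\bar F_P\in\mathcal R_0$, then $\mathcal P_y(\lambda)\to1$ and $\mathcal C(\lambda)\to\infty$ as $\lambda\to\infty$. 2. If $\bar F_P\in\mathcal R_{-\alpha}$ with $0<\alpha<1$, then for every $u>0$, $\mathcal P_y(u\lambda)/\mathcal P_y(\lambda)\to1$ and $\mathcal C(u\lambda)/\mathcal C(\lambda)\to1$ as $\lambda\to\infty$. 3. If $\bar F_P\in\mathcal R_{-\alpha}$ with $1<\alpha<\infty$, or if $\bar F_P=o(\bar H)$ at $\infty$ for some $\bar H\in\mathcal R_{-\infty}$, then $\mathcal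 P_y(\lambda)\to0$ and $\mathcal C(\lambda)\to0$ as $\lambda\to\infty$; moreover there is a finite density $\lambda_c>0$ with $\mathcal C(\lambda_c)>0=\lim_{\lambda\to\infty}\mathcal C(\lambda)$, and there is a finite density $\lambda_p>0$ with $\mathcal P_y(\lambda_p)>0=\lim_{\lambda\to\infty}\mathcal P_y(\lambda)$, where for the existence of $\lambda_p$ it is assumed in the case $\bar F_P=o(\bar H)$ that the target $y$ is attainable without interference, i.e. $\mathbb P(P\ge yW)>0$ (in the case $\bar F_P\in\mathcal R_{-\alpha}$ this holds automatically). -/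

import Mathlib

open MeasureTheory ProbabilityTheory Filter Topology Set
open scoped NNReal ENNReal

noncomputable section

namespace UDN

/-- The parameters of a multi-slope path loss function in a `d`-dimensional network:
`K ≥ 1` slopes, breakpoints `0 = R 0 < R 1 < ⋯ < R K` (where `R K` is the radius of the network
domain), exponents `β k` and positive scale factors `A k` which make the function continuous.
Only the values `R 0, …, R K` and `β k, A k` with `k < K` are used. -/
structure MultiSlope (d : ℕ) where
  /-- number of slopes -/
  K : ℕ
  /-- breakpoints -/
  R : ℕ → ℝ
  /-- exponents -/
  β : ℕ → ℝ
  /-- scale factors -/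
  A : ℕ → ℝ
  one_le_K : 1 ≤ K
  R_zero : R 0 = 0
  R_lt : ∀ k < K, R k < R (k + 1)
  β_zero_nonneg : 0 ≤ β 0
  β_ge : ∀ k, 1 ≤ k → k < K → (d : ℝ) - 1 ≤ β k
  β_lt : ∀ k, k + 1 < K → β k < β (k + 1)
  A_pos : ∀ k < K, 0 < A k
  A_cont : ∀ k, k + 1 < K → A k * R (k + 1) ^ β k = A (k + 1) * R (k + 1) ^ β (k + 1)

namespace MultiSlope

variable {d : ℕ}

/-- The radius `R_∞` of the network domain. -/
def radius (p : MultiSlope d) : ℝ := p.R p.K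

/-- The path loss function
`l(r) = ∑_{k < K} A_k r ^ β_k 1(R_k ≤ r < R_{k+1})`. -/
def loss (p : MultiSlope d) (r : ℝ) : ℝ :=
  ∑ k ∈ Finset.range p.K, (Ico (p.R k) (p.R (k + 1))).indicator (fun s => p.A k * s ^ p.β k) r

theorem radius_pos (p : MultiSlope d) : 0 < p.radius := by
  have h : ∀ n, n + 1 ≤ p.K → 0 < p.R (n + 1) := by
    intro n
    induction n with
    | zero =>
      intro hn
      have := p.R_lt 0 (by omega)
      rwa [p.R_zero] at this
    | succ n ih =>
      intro hn
      exact (ih (by omega)).trans (p.R_lt (n + 1) (by omega))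
  have hK := p.one_le_K
  have h1 := h (p.K - 1) (by omega)
  rwa [Nat.sub_add_cancel hK] at h1

end MultiSlope

/-- The space of the mark of one node: its position and its fading variable. -/
abbrev Node (d : ℕ) : Type := EuclideanSpace ℝ (Fin d) × ℝ

/-- The network domain: the nodes at distance less than `R_∞` from the user at the origin. -/
def domain {d : ℕ} (p : MultiSlope d) : Set (EuclideanSpace ℝ (Fin d)) :=
  Metric.ball 0 p.radius

/-- The law of a random node: a uniformly distributed position in the network domain and an
independent fading variable with distribution `Fm`. -/
def nodeLaw {d : ℕ} (p : MultiSlope d) (Fm : Measure ℝ) : Measure (Node d) :=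
  (ProbabilityTheory.cond volume (domain p)).prod Fm

instance {d : ℕ} (p : MultiSlope d) (Fm : Measure ℝ) [IsProbabilityMeasure Fm] :
    IsProbabilityMeasure (nodeLaw p Fm) := by
  have : IsProbabilityMeasure
      (ProbabilityTheory.cond (volume : Measure (EuclideanSpace ℝ (Fin d))) (domain p)) :=
    cond_isProbabilityMeasure_of_finite (Metric.measure_ball_pos _ _ p.radius_pos).ne'
      measure_ball_lt_top.ne
  unfold nodeLaw
  infer_instance

/-- A realization of the network: the number `N` of nodes, and a sequence of marked nodes of which
the first `N` are present. -/
abbrev Config (d : ℕ) : Type := ℕ × (ℕ → Node d)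

/-- The law of the network with node density `lam`, that is, of the homogeneous Poisson point
process of intensity `lam` on the (bounded) network domain with independent fading marks: the
number of nodes is Poisson with mean `lam` times the volume of the domain, the positions are
independent and uniform on the domain, the fading variables are independent with law `Fm`, and
all these are independent. -/
def networkLaw {d : ℕ} (p : MultiSlope d) (Fm : Measure ℝ) (lam : ℝ≥0) : Measure (Config d) :=
  (poissonMeasure (lam * (volume (domain p)).toNNReal)).prod
    (Measure.infinitePi fun _ : ℕ => nodeLaw p Fm)

/-- The power `m / l(‖x‖)` received from a node at `x` with fading variable `m`. -/
def power {d : ℕ} (p : MultiSlope d) (z : Node d) : ℝ := z.2 / p.loss ‖z.1‖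

/-- The complementary distribution function `t ↦ ℙ(P > t)` of the power received from a
random node. -/
def powerTail {d : ℕ} (p : MultiSlope d) (Fm : Measure ℝ) (t : ℝ) : ℝ :=
  (nodeLaw p Fm).real {z | t < power p z}

/-- The SINR of the `i`-th node, with noise power `W`. -/
def sinr {d : ℕ} (p : MultiSlope d) (W : ℝ) (ω : Config d) (i : ℕ) : ℝ :=
  power p (ω.2 i) / ((∑ j ∈ (Finset.range ω.1).erase i, power p (ω.2 j)) + W)

/-- The SINR under strongest cell association, `Y = max_i SINR_i` over the nodes that are
present; it is `0` if there is no node (the supremum over the empty family is `0` in `ℝ`). -/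
def bestSinr {d : ℕ} (p : MultiSlope d) (W : ℝ) (ω : Config d) : ℝ :=
  ⨆ i : Fin ω.1, sinr p W ω i

/-- The coverage probability `ℙ(Y ≥ y)` at node density `lam`. -/
def coverage {d : ℕ} (p : MultiSlope d) (Fm : Measure ℝ) (W y : ℝ) (lam : ℝ≥0) : ℝ≥0∞ :=
  networkLaw p Fm lam {ω | y ≤ bestSinr p W ω}

/-- The capacity `𝔼 log (1 + Y)` at node density `lam`, an element of `[0, ∞]`. -/
def capacity {d : ℕ} (p : MultiSlope d) (Fm : Measure ℝ) (W : ℝ) (lam : ℝ≥0) : ℝ≥0∞ :=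
  ∫⁻ ω, ENNReal.ofReal (Real.log (1 + bestSinr p W ω)) ∂(networkLaw p Fm lam)

/-- `h` is regularly varying at `∞` with (finite) index `ρ`: it is a positive Lebesgue measurable
function on `(0, ∞)` with `h (t x) / h x → t ^ ρ` for every `t > 0`. -/
def RegularlyVarying (h : ℝ → ℝ) (ρ : ℝ) : Prop :=
  AEMeasurable h (volume.restrict (Ioi 0)) ∧ (∀ x > 0, 0 < h x) ∧
    ∀ t > 0, Tendsto (fun x => h (t * x) / h x) atTop (𝓝 (t ^ ρ))

/-- `h` is rapidly varying at `∞` with index `-∞`: as above, with the limit `t ^ (-∞)`, which is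
`0` for `t > 1` and `∞` for `0 < t < 1`. -/
def RapidlyVarying (h : ℝ → ℝ) : Prop :=
  AEMeasurable h (volume.restrict (Ioi 0)) ∧ (∀ x > 0, 0 < h x) ∧
    (∀ t > 1, Tendsto (fun x => h (t * x) / h x) atTop (𝓝 0)) ∧
    ∀ t, 0 < t → t < 1 → Tendsto (fun x => h (t * x) / h x) atTop atTop

end UDN

end

open UDN

/-!
The received powers of the nodes are independent with the law `powerLaw p Fm` of a random received
power, and the number of nodes is Poisson with a mean that tends to infinity with the density.
Averaging over such a number of nodes preserves limits (`tendsto_lintegral_poissonMeasure`), so it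
is enough to find the limits of coverage and capacity for exactly `n` nodes as `n → ∞`. The shape of
the path loss is irrelevant: only the law `Q` of the power enters, through its tail.

For `n + 1` nodes, coverage means that a strongest node has SINR at least `y`. Singling out that
node, the coverage lies between `n + 1` times the mean of `Q (Ioi T)` and of `Q (Ici T)`, where `T`
is the threshold `max (y * (total + W)) largest` computed from `n` independent powers
(`le_fixedCoverage_succ`, `fixedCoverage_succ_le`). A recurrent estimate is that the square of the
tail at the largest of `n` powers has mean of order `n⁻²` (`lintegral_Ioi_peak_sq_le`). Regular
variation enters through elementary Potter bounds, which only use its consequence for doubling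
of the argument, and through norming constants (`exists_scale`).

* Tails of index below `-1` and rapidly decreasing tails have a finite mean. The interference is
  then at least of the order of `n`, because a fixed proportion of the nodes is received above a
  fixed level, and the largest power is of smaller order. Hence the mean of the best SINR tends to
  zero (`tendsto_lintegral_best`), and with it the capacity and, by Markov's inequality, the
  coverage. Both are positive at any density because the network may consist of a single node.
* For slowly varying tails, a strongest node of power `t` misses the target only if the sum of the
  other powers, all of which are at most `t`, is of the order of `t`. By Markov's inequality
  (`one_sub_fixedCoverage_le`) this is controlled by the truncated mean, which is negligible with
  respect to the tail by Karamata's theorem (`eventually_truncatedMean_le`). So the coverage tends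
  to one for every target, and the capacity to infinity.
* For an index `-α` with `0 < α < 1`, the total and the largest of `n` powers, in units of the
  norming constant `a n`, have joint Laplace transforms which converge: given a bound on the largest
  power, the transform of the total is an `n`-th power of a one-dimensional transform
  (`exists_tendsto_integral_exp`). By the Weierstrass theorem, means of continuous functions of the
  pair converge as well. Since `(n + 1) * tail (a n * t) → t ^ (-α)` uniformly away from `t = 0`,
  and small thresholds contribute little by the mean square estimate, the coverage has a positive finite
  limit (`exists_tendsto_fixedCoverage`). The capacity is an integral of the coverage over the
  targets; a Potter bound gives a domination that is uniform in `n` (`fixedCoverage_le_rpow`), and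
  so the capacity has a positive finite limit too (`exists_tendsto_fixedCapacity`). Ratios at the
  densities `u * lam` and `lam` then tend to one.
-/

namespace UDN

/-! ### Reduction to a fixed number of nodes -/

/-- The law of the power received from a random node. -/
noncomputable def powerLaw {d : ℕ} (p : MultiSlope d) (Fm : Measure ℝ) : Measure ℝ :=
  (nodeLaw p Fm).map (power p)

/-- The best SINR in a network of `n` nodes with received powers `x` and noise power `W`;
it is `0` if `n = 0`. -/
noncomputable def best (W : ℝ) {n : ℕ} (x : Fin n → ℝ) : ℝ :=
  ⨆ i, x i / ((∑ j ∈ Finset.univ.erase i, x j) + W)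

/-- The coverage probability of a network of exactly `n` nodes whose received powers are
independent with law `Q`. -/
noncomputable def fixedCoverage (Q : Measure ℝ) (W y : ℝ) (n : ℕ) : ℝ≥0∞ :=
  Measure.pi (fun _ : Fin n => Q) {x | y ≤ best W x}

/-- The capacity of a network of exactly `n` nodes whose received powers are independent with
law `Q`. -/
noncomputable def fixedCapacity (Q : Measure ℝ) (W : ℝ) (n : ℕ) : ℝ≥0∞ :=
  ∫⁻ x, ENNReal.ofReal (Real.log (1 + best W x)) ∂(Measure.pi fun _ : Fin n => Q)

namespace MultiSlope

variable {d : ℕ} (p : MultiSlope d)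

theorem R_nonneg {k : ℕ} (hk : k ≤ p.K) : 0 ≤ p.R k := by
  induction k with
  | zero => exact p.R_zero.ge
  | succ k ih => exact (ih (by omega)).trans (p.R_lt k (by omega)).le

theorem loss_term_nonneg {k : ℕ} (hk : k < p.K) (r : ℝ) :
    0 ≤ (Ico (p.R k) (p.R (k + 1))).indicator (fun s => p.A k * s ^ p.β k) r :=
  indicator_apply_nonneg fun hs =>
    mul_nonneg (p.A_pos k hk).le (Real.rpow_nonneg ((p.R_nonneg hk.le).trans hs.1) _)

theorem loss_nonneg (r : ℝ) : 0 ≤ p.loss r :=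
  Finset.sum_nonneg fun _ hk => p.loss_term_nonneg (Finset.mem_range.1 hk) r

theorem measurable_loss : Measurable p.loss := by
  refine Finset.measurable_sum _ fun k _ => Measurable.indicator ?_ measurableSet_Ico
  exact measurable_const.mul (measurable_id.pow_const _)

theorem exists_mem_Ico {r : ℝ} (hr : 0 ≤ r) {n : ℕ} (h : r < p.R n) :
    ∃ k < n, r ∈ Ico (p.R k) (p.R (k + 1)) := by
  induction n with
  | zero => rw [p.R_zero] at h; exact absurd h hr.not_gt
  | succ n ih =>
    by_cases h' : r < p.R n
    · obtain ⟨k, hk, hk'⟩ := ih h'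
      exact ⟨k, by omega, hk'⟩
    · exact ⟨n, by omega, not_lt.1 h', h⟩

theorem loss_pos {r : ℝ} (hr : 0 < r) (h : r < p.radius) : 0 < p.loss r := by
  obtain ⟨k, hk, hk'⟩ := p.exists_mem_Ico hr.le h
  refine Finset.sum_pos' (fun j hj => p.loss_term_nonneg (Finset.mem_range.1 hj) r)
    ⟨k, Finset.mem_range.2 hk, ?_⟩
  rw [indicator_of_mem hk']
  exact mul_pos (p.A_pos k hk) (Real.rpow_pos_of_pos hr _)

end MultiSlope

section PowerLaw

variable {d : ℕ} (p : MultiSlope d) (Fm : Measure ℝ)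

theorem measurable_power : Measurable (power p) :=
  measurable_snd.div (p.measurable_loss.comp measurable_fst.norm)

instance [IsProbabilityMeasure Fm] : IsProbabilityMeasure (powerLaw p Fm) :=
  Measure.isProbabilityMeasure_map (measurable_power p).aemeasurable

theorem powerTail_eq (t : ℝ) : powerTail p Fm t = (powerLaw p Fm).real (Ioi t) := by
  rw [powerLaw, map_measureReal_apply (measurable_power p) measurableSet_Ioi]
  rfl

theorem powerLaw_Ici (t : ℝ) : powerLaw p Fm (Ici t) = nodeLaw p Fm {z | t ≤ power p z} := by
  rw [powerLaw, Measure.map_apply (measurable_power p) measurableSet_Ici]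
  rfl

theorem powerLaw_Iio_zero [IsProbabilityMeasure Fm] (hFm : Fm (Iio 0) = 0) :
    powerLaw p Fm (Iio 0) = 0 := by
  rw [powerLaw, Measure.map_apply (measurable_power p) measurableSet_Iio]
  refine measure_mono_null (t := univ ×ˢ Iio 0) ?_ ?_
  · rintro ⟨x, m⟩ h
    simp only [mem_preimage, mem_Iio, power] at h
    simp only [mem_prod, mem_univ, true_and, mem_Iio]
    by_contra hm
    exact absurd h (div_nonneg (not_lt.1 hm) (p.loss_nonneg ‖x‖)).not_gt
  · rw [nodeLaw, Measure.prod_prod, hFm, mul_zero]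

/-- The condition `1 ≤ d` excludes the case that all nodes are at the origin, where the loss may
vanish and the quotient defining the power is then `0`. -/
theorem powerLaw_Ioi_zero (hd : 1 ≤ d) [IsProbabilityMeasure Fm] (hFm : 0 < Fm (Ioi 0)) :
    0 < powerLaw p Fm (Ioi 0) := by
  have : NeZero d := ⟨by omega⟩
  rw [powerLaw, Measure.map_apply (measurable_power p) measurableSet_Ioi]
  have hsub : (domain p \ {0}) ×ˢ Ioi (0 : ℝ) ⊆ power p ⁻¹' Ioi 0 := by
    rintro ⟨x, m⟩ ⟨⟨hx, hx0⟩, hm⟩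
    refine div_pos hm (p.loss_pos (norm_pos_iff.2 hx0) ?_)
    simpa [domain] using hx
  refine lt_of_lt_of_le ?_ (measure_mono hsub)
  rw [nodeLaw, Measure.prod_prod]
  refine ENNReal.mul_pos ?_ hFm.ne'
  have hball : volume (domain p) ≠ 0 := (Metric.measure_ball_pos _ _ p.radius_pos).ne'
  rw [cond_apply (show MeasurableSet (domain p) from measurableSet_ball)]
  refine mul_ne_zero (ENNReal.inv_ne_zero.2 measure_ball_lt_top.ne) ?_
  rw [inter_eq_self_of_subset_right sdiff_subset, measure_sdiff_null (by simp)]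
  exact hball

end PowerLaw

theorem measurable_best (W : ℝ) (n : ℕ) : Measurable (best W : (Fin n → ℝ) → ℝ) := by
  refine Measurable.iSup fun _ => (measurable_pi_apply _).div ?_
  exact (Finset.measurable_sum _ fun j _ => measurable_pi_apply j).add_const W

section Network

variable {d : ℕ} (p : MultiSlope d) (Fm : Measure ℝ)

/-- The received powers of the first `n` nodes. -/
noncomputable def firstPowers (n : ℕ) (ω : ℕ → Node d) : Fin n → ℝ := fun i => power p (ω (i : ℕ))

theorem measurable_firstPowers (n : ℕ) : Measurable (firstPowers p n) :=
  measurable_pi_lambda _ fun _ => (measurable_power p).comp (measurable_pi_apply _)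

theorem map_firstPowers [IsProbabilityMeasure Fm] (n : ℕ) :
    (Measure.infinitePi fun _ : ℕ => nodeLaw p Fm).map (firstPowers p n) =
      Measure.pi fun _ : Fin n => powerLaw p Fm := by
  refine (Measure.pi_eq fun s hs => ?_).symm
  rw [Measure.map_apply (measurable_firstPowers p n) (MeasurableSet.univ_pi hs)]
  set t : ℕ → Set (Node d) := fun k => if h : k < n then power p ⁻¹' s ⟨k, h⟩ else univ with ht
  have h1 : firstPowers p n ⁻¹' univ.pi s = ((Finset.range n : Finset ℕ) : Set ℕ).pi t := by
    ext ω
    simp only [mem_preimage, Set.mem_pi, mem_univ, true_imp_iff, Finset.coe_range, mem_Iio, ht]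
    constructor
    · intro h k hk
      simpa [hk, firstPowers] using h ⟨k, hk⟩
    · intro h k
      simpa [firstPowers] using h k k.2
  rw [h1, Measure.infinitePi_pi]
  · rw [Finset.prod_range]
    refine Finset.prod_congr rfl fun i _ => ?_
    rw [powerLaw, Measure.map_apply (measurable_power p) (hs i)]
    simp [ht]
  · intro k hk
    simp only [ht, Finset.mem_range.1 hk, dite_true]
    exact measurable_power p (hs _)

theorem bestSinr_eq (W : ℝ) (n : ℕ) (ω : ℕ → Node d) :
    bestSinr p W (n, ω) = best W (firstPowers p n ω) := by
  unfold bestSinr best sinr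
  congr 1
  ext i
  have : ∑ j ∈ (Finset.range n).erase i, power p (ω j) =
      ∑ j ∈ (Finset.univ : Finset (Fin n)).erase i, power p (ω j) := by
    rw [Finset.sum_erase_eq_sub (Finset.mem_range.2 i.2),
      Finset.sum_erase_eq_sub (Finset.mem_univ i), Finset.sum_range]
  simp only [firstPowers, this]

theorem measurable_bestSinr (W : ℝ) : Measurable (bestSinr p W) := by
  refine measurable_from_prod_countable_right fun n => ?_
  simp_rw [bestSinr_eq]
  exact (measurable_best W n).comp (measurable_firstPowers p n)

theorem coverage_eq [IsProbabilityMeasure Fm] (W y : ℝ) (lam : ℝ≥0) :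
    coverage p Fm W y lam = ∫⁻ n, fixedCoverage (powerLaw p Fm) W y n
      ∂(poissonMeasure (lam * (volume (domain p)).toNNReal)) := by
  have hm : MeasurableSet {ω | y ≤ bestSinr p W ω} :=
    measurableSet_le measurable_const (measurable_bestSinr p W)
  rw [coverage, networkLaw, Measure.prod_apply hm]
  refine lintegral_congr fun n => ?_
  rw [fixedCoverage, ← map_firstPowers, Measure.map_apply (measurable_firstPowers p n)
    (measurableSet_le measurable_const (measurable_best W n))]
  simp only [preimage, mem_ofPred_eq, bestSinr_eq]

theorem capacity_eq [IsProbabilityMeasure Fm] (W : ℝ) (lam : ℝ≥0) :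
    capacity p Fm W lam = ∫⁻ n, fixedCapacity (powerLaw p Fm) W n
      ∂(poissonMeasure (lam * (volume (domain p)).toNNReal)) := by
  have hm : ∀ {α : Type} [MeasurableSpace α] {f : α → ℝ}, Measurable f →
      Measurable fun x => ENNReal.ofReal (Real.log (1 + f x)) := fun hf =>
    (Real.measurable_log.comp (hf.const_add 1)).ennreal_ofReal
  rw [capacity, networkLaw, lintegral_prod _ (hm (measurable_bestSinr p W)).aemeasurable]
  refine lintegral_congr fun n => ?_
  rw [fixedCapacity, ← map_firstPowers, lintegral_map (hm (measurable_best W n))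
    (measurable_firstPowers p n)]
  simp only [bestSinr_eq]

end Network

/-! ### Averaging over the number of nodes -/

section Poisson

theorem tendsto_poissonMeasure_singleton (n : ℕ) :
    Tendsto (fun r : ℝ≥0 => poissonMeasure r {n}) atTop (𝓝 0) := by
  simp_rw [poissonMeasure_singleton]
  have h : Tendsto (fun r : ℝ => Real.exp (-r) * r ^ n / (n.factorial : ℝ)) atTop (𝓝 0) := by
    have := (Real.tendsto_pow_mul_exp_neg_atTop_nhds_zero n).div_const (n.factorial : ℝ)
    simpa [mul_comm] using this
  have := ENNReal.tendsto_ofReal (h.comp (NNReal.tendsto_coe_atTop.2 tendsto_id))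
  simpa using this

/-- Averaging over a Poisson number of nodes preserves limits as the mean tends to infinity. For a
finite limit no term may be infinite, as every number of nodes has positive probability. -/
theorem tendsto_lintegral_poissonMeasure {a : ℕ → ℝ≥0∞} {L : ℝ≥0∞}
    (ha : Tendsto a atTop (𝓝 L)) (hfin : L ≠ ∞ → ∀ n, a n ≠ ∞) :
    Tendsto (fun r : ℝ≥0 => ∫⁻ n, a n ∂(poissonMeasure r)) atTop (𝓝 L) := by
  have hsum : ∀ N, Tendsto (fun r : ℝ≥0 => poissonMeasure r (Iio N)) atTop (𝓝 0) := by
    intro N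
    have h : ∀ r : ℝ≥0, poissonMeasure r (Iio N) = ∑ n ∈ Finset.range N, poissonMeasure r {n} := by
      intro r
      rw [← Finset.coe_range, sum_measure_singleton]
    simp_rw [h]
    simpa using tendsto_finsetSum (Finset.range N)
      fun n _ => tendsto_poissonMeasure_singleton n
  refine tendsto_order.2 ⟨fun c hc => ?_, fun c hc => ?_⟩
  · obtain ⟨c', hcc', hc'⟩ := exists_between hc
    obtain ⟨N, hN⟩ := eventually_atTop.1 (ha.eventually_const_lt hc')
    have hlow : ∀ r : ℝ≥0, c' * (1 - poissonMeasure r (Iio N)) ≤ ∫⁻ n, a n ∂(poissonMeasure r) := by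
      intro r
      rw [← prob_compl_eq_one_sub measurableSet_Iio, ← setLIntegral_const]
      refine (setLIntegral_mono' measurableSet_Iio.compl fun n hn => ?_).trans
        (setLIntegral_le_lintegral _ _)
      exact (hN n (by simpa using hn)).le
    have hlim : Tendsto (fun r : ℝ≥0 => c' * (1 - poissonMeasure r (Iio N))) atTop (𝓝 c') := by
      have h1 : Tendsto (fun r : ℝ≥0 => 1 - poissonMeasure r (Iio N)) atTop (𝓝 (1 - 0)) :=
        ENNReal.Tendsto.sub tendsto_const_nhds (hsum N) (Or.inl (by simp))
      have := ENNReal.Tendsto.const_mul (a := c') h1 (Or.inl (by simp))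
      simpa using this
    filter_upwards [hlim.eventually_const_lt hcc'] with r hr using hr.trans_le (hlow r)
  · obtain ⟨c', hc', hcc'⟩ := exists_between hc
    obtain ⟨N, hN⟩ := eventually_atTop.1 (ha.eventually_lt_const hc')
    have hup : ∀ r : ℝ≥0, ∫⁻ n, a n ∂(poissonMeasure r) ≤
        (∑ n ∈ Finset.range N, a n * poissonMeasure r {n}) + c' := by
      intro r
      rw [← lintegral_add_compl a (measurableSet_Iio (a := N))]
      refine add_le_add ?_ ?_
      · rw [← Finset.coe_range, lintegral_finset]
      · calc ∫⁻ n in (Iio N)ᶜ, a n ∂(poissonMeasure r)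
            ≤ ∫⁻ n in (Iio N)ᶜ, c' ∂(poissonMeasure r) :=
              setLIntegral_mono' measurableSet_Iio.compl fun n hn => (hN n (by simpa using hn)).le
          _ = c' * poissonMeasure r (Iio N)ᶜ := setLIntegral_const _ _
          _ ≤ c' := mul_le_of_le_one_right' prob_le_one
    have hlim : Tendsto (fun r : ℝ≥0 => (∑ n ∈ Finset.range N, a n * poissonMeasure r {n}) + c')
        atTop (𝓝 c') := by
      have : Tendsto (fun r : ℝ≥0 => ∑ n ∈ Finset.range N, a n * poissonMeasure r {n})
          atTop (𝓝 (∑ n ∈ Finset.range N, 0)) := by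
        refine tendsto_finsetSum _ fun n _ => ?_
        have := ENNReal.Tendsto.const_mul (a := a n) (tendsto_poissonMeasure_singleton n)
          (Or.inr (hfin hc.ne_top n))
        simpa using this
      simpa using this.add_const c'
    filter_upwards [hlim.eventually_lt_const hcc'] with r hr using (hup r).trans_lt hr

end Poisson

/-! ### Leaving one node out -/

/-- The largest of the powers `z`; it is `0` for the empty family. -/
noncomputable def peak {n : ℕ} (z : Fin n → ℝ) : ℝ := ⨆ j, z j

/-- A node whose power exceeds `threshold W y z` has SINR at least `y` against the interferers `z`
and is stronger than each of them. -/
noncomputable def threshold (W y : ℝ) {n : ℕ} (z : Fin n → ℝ) : ℝ :=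
  max (y * ((∑ j, z j) + W)) (peak z)

theorem measurable_sum_pi (n : ℕ) : Measurable fun z : Fin n → ℝ => ∑ j, z j :=
  Finset.measurable_sum _ fun _ _ => measurable_pi_apply _

theorem measurable_peak (n : ℕ) : Measurable (peak : (Fin n → ℝ) → ℝ) :=
  Measurable.iSup fun _ => measurable_pi_apply _

theorem measurable_threshold (W y : ℝ) (n : ℕ) :
    Measurable (threshold W y : (Fin n → ℝ) → ℝ) :=
  (((measurable_sum_pi n).add_const W).const_mul y).max (measurable_peak n)

theorem le_peak {n : ℕ} (z : Fin n → ℝ) (j : Fin n) : z j ≤ peak z :=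
  le_ciSup (Set.finite_range z).bddAbove j

theorem peak_nonneg {n : ℕ} {z : Fin n → ℝ} (hz : ∀ j, 0 ≤ z j) : 0 ≤ peak z :=
  Real.iSup_nonneg hz

theorem peak_le {n : ℕ} {z : Fin n → ℝ} {t : ℝ} (ht : 0 ≤ t) (h : ∀ j, z j ≤ t) : peak z ≤ t :=
  Real.iSup_le h ht

theorem peak_le_sum {n : ℕ} {z : Fin n → ℝ} (hz : ∀ j, 0 ≤ z j) : peak z ≤ ∑ j, z j :=
  peak_le (Finset.sum_nonneg fun j _ => hz j) fun j =>
    Finset.single_le_sum (fun i _ => hz i) (Finset.mem_univ j)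

theorem peak_lt_iff {n : ℕ} {z : Fin (n + 1) → ℝ} {t : ℝ} : peak z < t ↔ ∀ j, z j < t := by
  refine ⟨fun h j => (le_peak z j).trans_lt h, fun h => ?_⟩
  obtain ⟨i, hi⟩ := exists_eq_ciSup_of_finite (f := z)
  rw [peak, ← hi]
  exact h i

section LeaveOneOut

variable (Q : Measure ℝ)

theorem ae_nonneg (hQ : Q (Iio 0) = 0) : ∀ᵐ t ∂Q, 0 ≤ t := by
  rw [ae_iff]
  simp only [not_le]
  exact hQ

theorem measurable_measure_Iio : Measurable fun t => Q (Iio t) :=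
  (monotone_iff_forall_lt.2 fun _ _ h => measure_mono (Iio_subset_Iio h.le)).measurable

variable [IsProbabilityMeasure Q]

/-- The splitting of a family of powers into the `i`-th one and the others. -/
def splitAt {n : ℕ} (i : Fin (n + 1)) (x : Fin (n + 1) → ℝ) : ℝ × (Fin n → ℝ) :=
  (x i, fun j => x (i.succAbove j))

theorem measurePreserving_splitAt {n : ℕ} (i : Fin (n + 1)) :
    MeasurePreserving (splitAt i) (Measure.pi fun _ : Fin (n + 1) => Q)
      (Q.prod (Measure.pi fun _ : Fin n => Q)) :=
  measurePreserving_piFinSuccAbove (fun _ => Q) i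

theorem ae_pi_nonneg (hQ : Q (Iio 0) = 0) (n : ℕ) :
    ∀ᵐ z ∂(Measure.pi fun _ : Fin n => Q), ∀ j, 0 ≤ z j :=
  ae_all_iff.2 fun j => (Measure.tendsto_eval_ae_ae (μ := fun _ : Fin n => Q) (i := j)).eventually
    (ae_nonneg Q hQ)

/-- The events that the `i`-th node is the strictly strongest one are disjoint, so their
probabilities, which are all equal, add up. -/
theorem pi_iUnion_splitAt {n : ℕ} {B : Set (ℝ × (Fin n → ℝ))} (hB : MeasurableSet B)
    (hlt : ∀ t z, (t, z) ∈ B → ∀ j, z j < t) :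
    Measure.pi (fun _ : Fin (n + 1) => Q) (⋃ i, splitAt i ⁻¹' B) =
      (n + 1) * Q.prod (Measure.pi fun _ : Fin n => Q) B := by
  rw [measure_iUnion]
  · simp_rw [fun i => (measurePreserving_splitAt Q i).measure_preimage hB.nullMeasurableSet]
    simp [tsum_fintype]
  · intro i k hik
    refine Set.disjoint_left.2 fun x hi hk => ?_
    obtain ⟨j, hj⟩ := Fin.exists_succAbove_eq hik.symm
    obtain ⟨l, hl⟩ := Fin.exists_succAbove_eq hik
    have h1 := hlt _ _ hi j
    have h2 := hlt _ _ hk l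
    simp only [hj, hl] at h1 h2
    exact lt_asymm h1 h2
  · exact fun i => (measurePreserving_splitAt Q i).measurable hB

theorem succ_mul_prod_le_one {n : ℕ} {B : Set (ℝ × (Fin n → ℝ))} (hB : MeasurableSet B)
    (hlt : ∀ t z, (t, z) ∈ B → ∀ j, z j < t) :
    (n + 1) * Q.prod (Measure.pi fun _ : Fin n => Q) B ≤ 1 := by
  rw [← pi_iUnion_splitAt Q hB hlt]
  exact prob_le_one

variable {Q} in
theorem prod_lt_eq {n : ℕ} {g : (Fin n → ℝ) → ℝ} (hg : Measurable g) :
    Q.prod (Measure.pi fun _ : Fin n => Q) {w | g w.2 < w.1} =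
      ∫⁻ z, Q (Ioi (g z)) ∂(Measure.pi fun _ : Fin n => Q) := by
  have hB : MeasurableSet {w : ℝ × (Fin n → ℝ) | g w.2 < w.1} :=
    measurableSet_lt (hg.comp measurable_snd) measurable_fst
  rw [Measure.prod_apply_symm hB]
  rfl

variable {Q} in
theorem prod_le_eq {n : ℕ} {g : (Fin n → ℝ) → ℝ} (hg : Measurable g) :
    Q.prod (Measure.pi fun _ : Fin n => Q) {w | g w.2 ≤ w.1} =
      ∫⁻ z, Q (Ici (g z)) ∂(Measure.pi fun _ : Fin n => Q) := by
  have hB : MeasurableSet {w : ℝ × (Fin n → ℝ) | g w.2 ≤ w.1} :=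
    measurableSet_le (hg.comp measurable_snd) measurable_fst
  rw [Measure.prod_apply_symm hB]
  rfl

theorem best_eq (W : ℝ) {n : ℕ} (x : Fin (n + 1) → ℝ) :
    best W x = ⨆ i, x i / ((∑ j, x (i.succAbove j)) + W) := by
  unfold best
  congr 1
  ext i
  rw [Finset.sum_erase_eq_sub (Finset.mem_univ i), Fin.sum_univ_succAbove _ i, add_sub_cancel_left]

theorem best_nonneg {W : ℝ} (hW : 0 < W) {n : ℕ} {x : Fin n → ℝ} (hx : ∀ i, 0 ≤ x i) :
    0 ≤ best W x :=
  Real.iSup_nonneg fun i => div_nonneg (hx i)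
    (add_nonneg (Finset.sum_nonneg fun j _ => hx j) hW.le)

theorem le_best_iff {W y : ℝ} (hW : 0 < W) {n : ℕ} {x : Fin (n + 1) → ℝ} (hx : ∀ i, 0 ≤ x i) :
    y ≤ best W x ↔ ∃ i, y * ((∑ j, x (i.succAbove j)) + W) ≤ x i := by
  have hpos : ∀ i : Fin (n + 1), 0 < (∑ j, x (i.succAbove j)) + W := fun i =>
    add_pos_of_nonneg_of_pos (Finset.sum_nonneg fun j _ => hx _) hW
  simp_rw [← le_div_iff₀ (hpos _)]
  rw [best_eq]
  constructor
  · intro h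
    obtain ⟨i, hi⟩ := exists_eq_ciSup_of_finite (f := fun i => x i / ((∑ j, x (i.succAbove j)) + W))
    exact ⟨i, h.trans hi.ge⟩
  · rintro ⟨i, hi⟩
    exact hi.trans (le_ciSup (f := fun i => x i / ((∑ j, x (i.succAbove j)) + W))
      (Set.finite_range _).bddAbove i)

/-- A node which beats its threshold is covered and strictly the strongest one, which can happen to
at most one node at a time. -/
theorem le_fixedCoverage_succ (hQ : Q (Iio 0) = 0) {W : ℝ} (hW : 0 < W) (y : ℝ) (n : ℕ) :
    (n + 1) * ∫⁻ z, Q (Ioi (threshold W y z)) ∂(Measure.pi fun _ : Fin n => Q) ≤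
      fixedCoverage Q W y (n + 1) := by
  rw [← prod_lt_eq (measurable_threshold W y n), ← pi_iUnion_splitAt]
  · refine measure_mono_ae ?_
    filter_upwards [ae_pi_nonneg Q hQ (n + 1)] with x hx hxB
    obtain ⟨i, hi⟩ := mem_iUnion.1 hxB
    exact (le_best_iff hW hx).2 ⟨i, (le_max_left _ _).trans (le_of_lt hi)⟩
  · exact measurableSet_lt ((measurable_threshold W y n).comp measurable_snd) measurable_fst
  · exact fun t z h j => (le_peak z j).trans_lt ((le_max_right _ _).trans_lt h)

/-- If the SINR of some node is at least `y`, then so is that of a strongest node. -/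
theorem fixedCoverage_succ_le (hQ : Q (Iio 0) = 0) {W y : ℝ} (hW : 0 < W) (hy : 0 < y) (n : ℕ) :
    fixedCoverage Q W y (n + 1) ≤
      (n + 1) * ∫⁻ z, Q (Ici (threshold W y z)) ∂(Measure.pi fun _ : Fin n => Q) := by
  have hB : MeasurableSet {w : ℝ × (Fin n → ℝ) | threshold W y w.2 ≤ w.1} :=
    measurableSet_le ((measurable_threshold W y n).comp measurable_snd) measurable_fst
  rw [← prod_le_eq (measurable_threshold W y n)]
  calc fixedCoverage Q W y (n + 1)
      ≤ Measure.pi (fun _ : Fin (n + 1) => Q)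
          (⋃ i, splitAt i ⁻¹' {w : ℝ × (Fin n → ℝ) | threshold W y w.2 ≤ w.1}) := by
        refine measure_mono_ae ?_
        filter_upwards [ae_pi_nonneg Q hQ (n + 1)] with x hx hxB
        obtain ⟨i, hi⟩ := (le_best_iff hW hx).1 hxB
        obtain ⟨k, hk⟩ := Finite.exists_max x
        refine mem_iUnion.2 ⟨k, max_le ?_ (peak_le (hx k) fun j => hk _)⟩
        have h1 := Fin.sum_univ_succAbove x i
        have h2 := Fin.sum_univ_succAbove x k
        have h3 := hk i
        have h4 : y * ((∑ j, x (k.succAbove j)) + W) ≤ y * ((∑ j, x (i.succAbove j)) + W) := by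
          exact mul_le_mul_of_nonneg_left (by linarith) hy.le
        exact h4.trans (hi.trans h3)
    _ ≤ ∑ i, Measure.pi (fun _ : Fin (n + 1) => Q)
          (splitAt i ⁻¹' {w : ℝ × (Fin n → ℝ) | threshold W y w.2 ≤ w.1}) :=
        measure_iUnion_fintype_le _ _
    _ = _ := by
        simp_rw [fun i => (measurePreserving_splitAt Q i).measure_preimage hB.nullMeasurableSet]
        simp

theorem measurableSet_forall_le (n : ℕ) :
    MeasurableSet {w : ℝ × (Fin n → ℝ) | ∀ j, w.2 j ≤ w.1} := by
  have : {w : ℝ × (Fin n → ℝ) | ∀ j, w.2 j ≤ w.1} = ⋂ j, {w | w.2 j ≤ w.1} := by ext; simp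
  rw [this]
  exact MeasurableSet.iInter fun j => measurableSet_le
    ((measurable_pi_apply j).comp measurable_snd) measurable_fst

/-- Failure of coverage means in particular that a strongest node misses the target. -/
theorem one_sub_fixedCoverage_succ_le (hQ : Q (Iio 0) = 0) {W y : ℝ} (hW : 0 < W) (n : ℕ) :
    1 - fixedCoverage Q W y (n + 1) ≤
      (n + 1) * Q.prod (Measure.pi fun _ : Fin n => Q)
        {w | (∀ j, w.2 j ≤ w.1) ∧ w.1 < y * ((∑ j, w.2 j) + W)} := by
  set B : Set (ℝ × (Fin n → ℝ)) := {w | (∀ j, w.2 j ≤ w.1) ∧ w.1 < y * ((∑ j, w.2 j) + W)} with hBdef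
  have hB : MeasurableSet B := (measurableSet_forall_le n).inter (measurableSet_lt measurable_fst
    ((((measurable_sum_pi n).comp measurable_snd).add_const W).const_mul y))
  have hm : MeasurableSet {x : Fin (n + 1) → ℝ | y ≤ best W x} :=
    measurableSet_le measurable_const (measurable_best W _)
  rw [fixedCoverage, ← prob_compl_eq_one_sub hm]
  calc Measure.pi (fun _ : Fin (n + 1) => Q) {x | y ≤ best W x}ᶜ
      ≤ Measure.pi (fun _ : Fin (n + 1) => Q) (⋃ i, splitAt i ⁻¹' B) := by
        refine measure_mono_ae ?_
        filter_upwards [ae_pi_nonneg Q hQ (n + 1)] with x hx hxB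
        obtain ⟨k, hk⟩ := Finite.exists_max x
        refine mem_iUnion.2 ⟨k, fun j => hk _, ?_⟩
        by_contra h
        exact hxB ((le_best_iff hW hx).2 ⟨k, not_lt.1 h⟩)
    _ ≤ ∑ i, Measure.pi (fun _ : Fin (n + 1) => Q) (splitAt i ⁻¹' B) :=
        measure_iUnion_fintype_le _ _
    _ = _ := by
        simp_rw [fun i => (measurePreserving_splitAt Q i).measure_preimage hB.nullMeasurableSet]
        simp

theorem measurableSet_forall_lt (n : ℕ) :
    MeasurableSet {w : ℝ × (Fin n → ℝ) | ∀ j, w.2 j < w.1} := by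
  have : {w : ℝ × (Fin n → ℝ) | ∀ j, w.2 j < w.1} = ⋂ j, {w | w.2 j < w.1} := by ext; simp
  rw [this]
  exact MeasurableSet.iInter fun j => measurableSet_lt
    ((measurable_pi_apply j).comp measurable_snd) measurable_fst

/-- The probability that a given one of `k + 1` nodes is strictly the strongest is at most
`1 / (k + 1)`. -/
theorem succ_mul_lintegral_pow_le_one (k : ℕ) :
    (k + 1) * ∫⁻ t, Q (Iio t) ^ k ∂Q ≤ 1 := by
  refine le_trans (le_of_eq ?_) (succ_mul_prod_le_one Q (measurableSet_forall_lt k)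
    fun t z h => h)
  congr 1
  rw [Measure.prod_apply (measurableSet_forall_lt k)]
  refine lintegral_congr fun t => ?_
  have : (Prod.mk t ⁻¹' {w : ℝ × (Fin k → ℝ) | ∀ j, w.2 j < w.1}) = univ.pi fun _ => Iio t := by
    ext z; simp
  rw [this, Measure.pi_pi]
  simp

theorem succ_mul_lintegral_Ioi_peak_le_one (n : ℕ) :
    (n + 1) * ∫⁻ z, Q (Ioi (peak z)) ∂(Measure.pi fun _ : Fin n => Q) ≤ 1 := by
  rw [← prod_lt_eq (measurable_peak n)]
  exact succ_mul_prod_le_one Q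
    (measurableSet_lt ((measurable_peak n).comp measurable_snd) measurable_fst)
    fun t z h j => (le_peak z j).trans_lt h

/-- The square of the tail at the largest of `n` powers is of order `n⁻²` on average: the
event that two further nodes are both stronger than all `n` implies that one is stronger than the
first half and the other one is stronger than the second half. -/
theorem lintegral_Ioi_peak_sq_le (n : ℕ) :
    ∫⁻ z, Q (Ioi (peak z)) ^ 2 ∂(Measure.pi fun _ : Fin n => Q) ≤
      ENNReal.ofReal (4 / (n + 1) ^ 2) := by
  obtain _ | n := n
  · calc ∫⁻ z, Q (Ioi (peak z)) ^ 2 ∂(Measure.pi fun _ : Fin 0 => Q)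
        ≤ ∫⁻ z, 1 ∂(Measure.pi fun _ : Fin 0 => Q) :=
          lintegral_mono fun z => pow_le_one₀ (zero_le) prob_le_one
      _ = 1 := by simp
      _ ≤ _ := by norm_num
  have hB : MeasurableSet {w : (ℝ × ℝ) × (Fin (n + 1) → ℝ) | peak w.2 < w.1.1 ∧ peak w.2 < w.1.2} :=
    (measurableSet_lt ((measurable_peak _).comp measurable_snd)
      (measurable_fst.comp measurable_fst)).inter
    (measurableSet_lt ((measurable_peak _).comp measurable_snd)
      (measurable_snd.comp measurable_fst))
  set k := (n + 1) / 2 with hk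
  set l := n + 1 - k with hl
  have hJ : ∀ m : ℕ, ∫⁻ t, Q (Iio t) ^ m ∂Q ≤ ENNReal.ofReal (1 / (m + 1)) := by
    intro m
    have h := succ_mul_lintegral_pow_le_one Q m
    rw [one_div, ENNReal.ofReal_inv_of_pos (by positivity),
      ENNReal.ofReal_add (by positivity) zero_le_one, ENNReal.ofReal_natCast, ENNReal.ofReal_one]
    rwa [ENNReal.le_inv_iff_mul_le, mul_comm]
  calc ∫⁻ z, Q (Ioi (peak z)) ^ 2 ∂(Measure.pi fun _ : Fin (n + 1) => Q)
      = (Q.prod Q).prod (Measure.pi fun _ : Fin (n + 1) => Q)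
          {w | peak w.2 < w.1.1 ∧ peak w.2 < w.1.2} := by
        rw [Measure.prod_apply_symm hB]
        refine lintegral_congr fun z => ?_
        rw [sq, ← Measure.prod_prod]
        rfl
    _ = ∫⁻ w, Q (Iio (min w.1 w.2)) ^ (n + 1) ∂(Q.prod Q) := by
        rw [Measure.prod_apply hB]
        refine lintegral_congr fun w => ?_
        have : (Prod.mk w ⁻¹' {w : (ℝ × ℝ) × (Fin (n + 1) → ℝ) |
            peak w.2 < w.1.1 ∧ peak w.2 < w.1.2}) = univ.pi fun _ => Iio (min w.1 w.2) := by
          ext z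
          simp only [mem_preimage, mem_ofPred_eq, peak_lt_iff, Set.mem_pi, mem_univ,
            true_imp_iff, mem_Iio, lt_min_iff, forall_and]
        rw [this, Measure.pi_pi]
        simp
    _ ≤ ∫⁻ w, Q (Iio w.1) ^ k * Q (Iio w.2) ^ l ∂(Q.prod Q) := by
        refine lintegral_mono fun w => ?_
        have : n + 1 = k + l := by omega
        rw [this, pow_add]
        gcongr
        · exact min_le_left _ _
        · exact min_le_right _ _
    _ = (∫⁻ t, Q (Iio t) ^ k ∂Q) * ∫⁻ t, Q (Iio t) ^ l ∂Q :=
        lintegral_prod_mul ((measurable_measure_Iio Q).pow_const k).aemeasurable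
          ((measurable_measure_Iio Q).pow_const l).aemeasurable
    _ ≤ ENNReal.ofReal (1 / (k + 1)) * ENNReal.ofReal (1 / (l + 1)) := mul_le_mul' (hJ k) (hJ l)
    _ ≤ ENNReal.ofReal (4 / ((n + 1 : ℕ) + 1) ^ 2) := by
        rw [← ENNReal.ofReal_mul (by positivity)]
        refine ENNReal.ofReal_le_ofReal ?_
        have h1 : ((n + 1 : ℕ) + 1 : ℝ) / 2 ≤ k + 1 := by
          have : n + 1 + 1 ≤ 2 * (k + 1) := by omega
          have : ((n + 1 + 1 : ℕ) : ℝ) ≤ ((2 * (k + 1) : ℕ) : ℝ) := by exact_mod_cast this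
          push_cast at this ⊢
          linarith
        have h2 : ((n + 1 : ℕ) + 1 : ℝ) / 2 ≤ l + 1 := by
          have : n + 1 + 1 ≤ 2 * (l + 1) := by omega
          have : ((n + 1 + 1 : ℕ) : ℝ) ≤ ((2 * (l + 1) : ℕ) : ℝ) := by exact_mod_cast this
          push_cast at this ⊢
          linarith
        calc 1 / ((k : ℝ) + 1) * (1 / (l + 1))
            ≤ 1 / (((n + 1 : ℕ) + 1 : ℝ) / 2) * (1 / (((n + 1 : ℕ) + 1 : ℝ) / 2)) := by gcongr
          _ = _ := by field_simp; norm_num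

end LeaveOneOut

/-! ### Tails of regular variation -/

/-- The tail function `t ↦ ℙ(P > t)` of the law `Q` of `P`. -/
noncomputable def tail (Q : Measure ℝ) (t : ℝ) : ℝ := Q.real (Ioi t)

/-- The left-continuous version `t ↦ ℙ(P ≥ t)` of the tail function. -/
noncomputable def leftTail (Q : Measure ℝ) (t : ℝ) : ℝ := Q.real (Ici t)

section Tail

variable (Q : Measure ℝ)

theorem tail_nonneg (t : ℝ) : 0 ≤ tail Q t := measureReal_nonneg

theorem leftTail_nonneg (t : ℝ) : 0 ≤ leftTail Q t := measureReal_nonneg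

variable [IsProbabilityMeasure Q]

theorem tail_antitone : Antitone (tail Q) := fun _ _ h => measureReal_mono (Ioi_subset_Ioi h)

theorem leftTail_antitone : Antitone (leftTail Q) :=
  fun _ _ h => measureReal_mono (Ici_subset_Ici.2 h)

theorem tail_le_one (t : ℝ) : tail Q t ≤ 1 := measureReal_le_one

theorem leftTail_le_one (t : ℝ) : leftTail Q t ≤ 1 := measureReal_le_one

theorem tail_le_leftTail (t : ℝ) : tail Q t ≤ leftTail Q t :=
  measureReal_mono Ioi_subset_Ici_self

theorem leftTail_le_tail {s t : ℝ} (h : s < t) : leftTail Q t ≤ tail Q s :=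
  measureReal_mono fun _ hx => h.trans_le hx

theorem ofReal_tail (t : ℝ) : ENNReal.ofReal (tail Q t) = Q (Ioi t) := by
  rw [tail, ofReal_measureReal]

theorem ofReal_leftTail (t : ℝ) : ENNReal.ofReal (leftTail Q t) = Q (Ici t) := by
  rw [leftTail, ofReal_measureReal]

theorem tendsto_tail : Tendsto (tail Q) atTop (𝓝 0) := by
  have h : Tendsto (fun t : ℝ => Q (Ioi t)) atTop (𝓝 (Q (⋂ t : ℝ, Ioi t))) :=
    tendsto_measure_iInter_atTop (fun t => measurableSet_Ioi.nullMeasurableSet)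
      (fun _ _ h => Ioi_subset_Ioi h) ⟨0, measure_ne_top _ _⟩
  have h0 : (⋂ t : ℝ, Ioi t) = ∅ := by
    ext x
    simp only [mem_iInter, mem_Ioi, mem_empty_iff_false, iff_false, not_forall, not_lt]
    exact ⟨x, le_rfl⟩
  rw [h0, measure_empty] at h
  exact (ENNReal.tendsto_toReal ENNReal.zero_ne_top).comp h

end Tail

section Potter

variable {f : ℝ → ℝ}

/-- A Potter bound: if `f` eventually decreases at most by the factor `2 ^ (-b)` under doubling of
the argument, then `s ^ b * f s` is quasi-increasing. -/
theorem exists_rpow_mul_le_of_le_two_mul (hf : Antitone f) (hpos : ∀ x, 0 < f x)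
    (hle : ∀ x, f x ≤ 1) {b : ℝ} (hb : 0 ≤ b) (h : ∀ᶠ x in atTop, f x ≤ 2 ^ b * f (2 * x)) :
    ∃ C > 0, ∃ x₀ > 0, ∀ s x, 0 < s → s ≤ x → x₀ ≤ x → s ^ b * f s ≤ C * (x ^ b * f x) := by
  obtain ⟨x₁, hx₁⟩ := eventually_atTop.1 h
  set x₀ := max x₁ 1 with hx₀
  have hx₀pos : 0 < x₀ := lt_max_of_lt_right one_pos
  have key : ∀ k : ℕ, ∀ s x, x₀ ≤ s → s ≤ x → x ≤ 2 ^ k * s →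
      s ^ b * f s ≤ 2 ^ b * (x ^ b * f x) := by
    intro k
    induction k with
    | zero =>
      intro s x hs hsx hxs
      have hs0 : 0 < s := hx₀pos.trans_le hs
      rw [show x = s by simp at hxs; linarith]
      refine le_mul_of_one_le_left (mul_nonneg (Real.rpow_nonneg hs0.le _) (hpos s).le) ?_
      exact Real.one_le_rpow one_le_two hb
    | succ k ih =>
      intro s x hs hsx hxs
      have hs0 : 0 < s := hx₀pos.trans_le hs
      have hx0 : 0 < x := hs0.trans_le hsx
      have hd := hx₁ s ((le_max_left _ _).trans hs)
      by_cases hx2 : x ≤ 2 * s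
      · calc s ^ b * f s ≤ x ^ b * (2 ^ b * f (2 * s)) := by
              have := (hpos s).le
              gcongr
          _ ≤ x ^ b * (2 ^ b * f x) := by
              have := hf hx2
              gcongr
          _ = _ := by ring
      · calc s ^ b * f s ≤ s ^ b * (2 ^ b * f (2 * s)) := by gcongr
          _ = (2 * s) ^ b * f (2 * s) := by
              rw [Real.mul_rpow zero_le_two hs0.le]; ring
          _ ≤ _ := ih (2 * s) x (by linarith) (by linarith) (by rw [pow_succ] at hxs; linarith)
  have key' : ∀ s x, x₀ ≤ s → s ≤ x → s ^ b * f s ≤ 2 ^ b * (x ^ b * f x) := by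
    intro s x hs hsx
    have hs0 : 0 < s := hx₀pos.trans_le hs
    obtain ⟨k, hk⟩ := pow_unbounded_of_one_lt (x / s) one_lt_two
    exact key k s x hs hsx ((div_lt_iff₀ hs0).1 hk).le
  refine ⟨2 ^ b / f x₀, div_pos (by positivity) (hpos _), x₀, hx₀pos, fun s x hs hsx hx => ?_⟩
  have hx0 : 0 < x := hx₀pos.trans_le hx
  rw [div_mul_eq_mul_div, le_div_iff₀ (hpos _)]
  by_cases hs' : x₀ ≤ s
  · exact (mul_le_of_le_one_right (mul_nonneg (Real.rpow_nonneg hs.le _) (hpos s).le)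
      (hle _)).trans (key' s x hs' hsx)
  · refine le_trans ?_ (key' x₀ x le_rfl hx)
    calc s ^ b * f s * f x₀ ≤ x₀ ^ b * 1 * f x₀ := by
          have := hle s
          have := (hpos x₀).le
          have := (hpos s).le
          gcongr
          exact (not_le.1 hs').le
      _ = _ := by ring

/-- A Potter bound: if `f` eventually decreases at least by the factor `2 ^ (-γ)` under doubling of
the argument, then `s ^ γ * f s` is quasi-decreasing away from `0`. -/
theorem exists_rpow_mul_le_of_two_mul_le (hf : Antitone f) (hpos : ∀ x, 0 < f x)
    (hle : ∀ x, f x ≤ 1) {γ : ℝ} (hγ : 0 ≤ γ) (h : ∀ᶠ x in atTop, 2 ^ γ * f (2 * x) ≤ f x)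
    {w : ℝ} (hw : 0 < w) :
    ∃ C > 0, ∀ s x, w ≤ s → s ≤ x → x ^ γ * f x ≤ C * (s ^ γ * f s) := by
  obtain ⟨x₁, hx₁⟩ := eventually_atTop.1 h
  set x₀ := max x₁ w with hx₀
  have hx₀pos : 0 < x₀ := lt_max_of_lt_right hw
  have key : ∀ k : ℕ, ∀ s x, x₀ ≤ s → s ≤ x → x ≤ 2 ^ k * s →
      x ^ γ * f x ≤ 2 ^ γ * (s ^ γ * f s) := by
    intro k
    induction k with
    | zero =>
      intro s x hs hsx hxs
      have hs0 : 0 < s := hx₀pos.trans_le hs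
      rw [show x = s by simp at hxs; linarith]
      refine le_mul_of_one_le_left (mul_nonneg (Real.rpow_nonneg hs0.le _) (hpos s).le) ?_
      exact Real.one_le_rpow one_le_two hγ
    | succ k ih =>
      intro s x hs hsx hxs
      have hs0 : 0 < s := hx₀pos.trans_le hs
      have hx0 : 0 < x := hs0.trans_le hsx
      have hd := hx₁ s ((le_max_left _ _).trans hs)
      by_cases hx2 : x ≤ 2 * s
      · calc x ^ γ * f x ≤ (2 * s) ^ γ * f s := by
              have := (hpos x).le
              gcongr
              exact hf hsx
          _ = _ := by rw [Real.mul_rpow zero_le_two hs0.le]; ring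
      · calc x ^ γ * f x ≤ 2 ^ γ * ((2 * s) ^ γ * f (2 * s)) :=
              ih (2 * s) x (by linarith) (by linarith) (by rw [pow_succ] at hxs; linarith)
          _ = 2 ^ γ * (s ^ γ * (2 ^ γ * f (2 * s))) := by
              rw [Real.mul_rpow zero_le_two hs0.le]; ring
          _ ≤ _ := by gcongr
  have key' : ∀ s x, x₀ ≤ s → s ≤ x → x ^ γ * f x ≤ 2 ^ γ * (s ^ γ * f s) := by
    intro s x hs hsx
    have hs0 : 0 < s := hx₀pos.trans_le hs
    obtain ⟨k, hk⟩ := pow_unbounded_of_one_lt (x / s) one_lt_two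
    exact key k s x hs hsx ((div_lt_iff₀ hs0).1 hk).le
  have h2 : (1 : ℝ) ≤ 2 ^ γ := Real.one_le_rpow one_le_two hγ
  have hwx : w ^ γ ≤ x₀ ^ γ := Real.rpow_le_rpow hw.le (le_max_right _ _) hγ
  have hwpos : 0 < w ^ γ := Real.rpow_pos_of_pos hw _
  refine ⟨2 ^ γ * x₀ ^ γ / (w ^ γ * f x₀),
    div_pos (mul_pos (by positivity) (by positivity)) (mul_pos hwpos (hpos _)), fun s x hs hsx => ?_⟩
  have hs0 : 0 < s := hw.trans_le hs
  have hx0 : 0 < x := hs0.trans_le hsx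
  have hsγ : w ^ γ ≤ s ^ γ := Real.rpow_le_rpow hw.le hs hγ
  have hfx₀ := hpos x₀
  have hfs := hpos s
  have hfx := hpos x
  rw [div_mul_eq_mul_div, le_div_iff₀ (mul_pos hwpos hfx₀)]
  by_cases hs' : x₀ ≤ s
  · calc x ^ γ * f x * (w ^ γ * f x₀) ≤ 2 ^ γ * (s ^ γ * f s) * (x₀ ^ γ * 1) :=
          mul_le_mul (key' s x hs' hsx) (mul_le_mul hwx (hle _) hfx₀.le (by positivity))
            (by positivity) (by positivity)
      _ = _ := by ring
  · have hsx₀ : f x₀ ≤ f s := hf (not_le.1 hs').le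
    by_cases hx' : x₀ ≤ x
    · calc x ^ γ * f x * (w ^ γ * f x₀) ≤ 2 ^ γ * (x₀ ^ γ * 1) * (s ^ γ * f s) := by
            refine mul_le_mul ((key' x₀ x le_rfl hx').trans ?_) ?_ (by positivity) (by positivity)
            · have := hle x₀
              gcongr
            · gcongr
        _ = _ := by ring
    · calc x ^ γ * f x * (w ^ γ * f x₀) ≤ (1 * (x₀ ^ γ * 1)) * (s ^ γ * f s) := by
            rw [one_mul]
            gcongr
            · exact (not_le.1 hx').le
            · exact hle _
        _ ≤ (2 ^ γ * (x₀ ^ γ * 1)) * (s ^ γ * f s) := by gcongr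
        _ = _ := by ring

end Potter

section Scale

/-- Norming constants for a tail of regular variation: `a n` is the `1 / (n + 1)` quantile (not
smaller than `1`), the order of magnitude of the largest of `n` powers. -/
theorem exists_scale {f : ℝ → ℝ} (hf : Antitone f) (hpos : ∀ x, 0 < f x)
    (hlim : Tendsto f atTop (𝓝 0)) {α : ℝ}
    (hreg : ∀ t > 0, Tendsto (fun x => f (t * x) / f x) atTop (𝓝 (t ^ (-α)))) :
    ∃ a : ℕ → ℝ, (∀ n, 0 < a n) ∧ Tendsto a atTop atTop ∧
      ∀ t > 0, Tendsto (fun n : ℕ => (n + 1) * f (a n * t)) atTop (𝓝 (t ^ (-α))) := by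
  set s : ℕ → Set ℝ := fun n => {t | 1 ≤ t ∧ f t ≤ 1 / ((n : ℝ) + 1)} with hs
  have hne : ∀ n, (s n).Nonempty := by
    intro n
    obtain ⟨t, h1, h2⟩ := ((eventually_ge_atTop (1 : ℝ)).and
      (hlim.eventually_le_const (show (0 : ℝ) < 1 / ((n : ℝ) + 1) by positivity))).exists
    exact ⟨t, h1, h2⟩
  have hbdd : ∀ n, BddBelow (s n) := fun n => ⟨1, fun t ht => ht.1⟩
  set a : ℕ → ℝ := fun n => sInf (s n) with ha
  have ha1 : ∀ n, 1 ≤ a n := fun n => le_csInf (hne n) fun t ht => ht.1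
  have hapos : ∀ n, 0 < a n := fun n => one_pos.trans_le (ha1 n)
  have hatop : Tendsto a atTop atTop := by
    refine tendsto_atTop.2 fun B => ?_
    have := tendsto_one_div_add_atTop_nhds_zero_nat (𝕜 := ℝ)
    filter_upwards [this.eventually_lt_const (hpos B)] with n hn
    refine le_csInf (hne n) fun t ht => ?_
    by_contra hB
    exact absurd (hf (not_le.1 hB).le) (not_le.2 (ht.2.trans_lt hn))
  have hup : ∀ c > 1, ∀ n : ℕ, (n + 1) * f (c * a n) ≤ 1 := by
    intro c hc n
    obtain ⟨t, ht, htc⟩ := exists_lt_of_csInf_lt (hne n) (lt_mul_of_one_lt_left (hapos n) hc)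
    have := (hf htc.le).trans ht.2
    rwa [le_div_iff₀ (by positivity), mul_comm] at this
  have hlow : ∀ c < 1, 0 < c → ∀ᶠ n : ℕ in atTop, 1 ≤ (n + 1) * f (c * a n) := by
    intro c hc hc0
    filter_upwards [(hatop.const_mul_atTop hc0).eventually_ge_atTop 1] with n hn
    have h : c * a n ∉ s n := fun h =>
      absurd (csInf_le (hbdd n) h) (not_le.2 (mul_lt_of_lt_one_left (hapos n) hc))
    have : 1 / ((n : ℝ) + 1) < f (c * a n) := by
      by_contra h'
      exact h ⟨hn, not_lt.1 h'⟩
    rw [div_lt_iff₀ (by positivity), mul_comm] at this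
    exact this.le
  have hratio : ∀ t > 0, ∀ c > 0,
      Tendsto (fun n => f (a n * t) / f (c * a n)) atTop (𝓝 ((t / c) ^ (-α))) := by
    intro t ht c hc
    refine ((hreg (t / c) (div_pos ht hc)).comp (hatop.const_mul_atTop hc)).congr fun n => ?_
    simp only [Function.comp]
    congr 2
    field_simp
  have hcont : ∀ t > 0, Tendsto (fun c : ℝ => (t / c) ^ (-α)) (𝓝 1) (𝓝 (t ^ (-α))) := by
    intro t ht
    have : ContinuousAt (fun c : ℝ => (t / c) ^ (-α)) 1 := by
      refine ContinuousAt.rpow_const (continuousAt_const.div continuousAt_id one_ne_zero) ?_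
      left
      simpa using ht.ne'
    simpa using this.tendsto
  refine ⟨a, hapos, hatop, fun t ht => tendsto_order.2 ⟨fun v hv => ?_, fun v hv => ?_⟩⟩
  · have h1 : ∀ᶠ c in 𝓝[<] (1 : ℝ), v < (t / c) ^ (-α) :=
      ((hcont t ht).mono_left nhdsWithin_le_nhds).eventually_const_lt hv
    obtain ⟨c, ⟨hc, hc1⟩, hc0⟩ := ((h1.and eventually_mem_nhdsWithin).and
      (eventually_nhdsWithin_of_eventually_nhds (lt_mem_nhds one_pos))).exists
    filter_upwards [(hratio t ht c hc0).eventually_const_lt hc, hlow c hc1 hc0] with n hn hn'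
    refine hn.trans_le ?_
    rw [div_le_iff₀ (hpos _)]
    calc f (a n * t) = f (a n * t) * 1 := (mul_one _).symm
      _ ≤ f (a n * t) * ((n + 1) * f (c * a n)) :=
          mul_le_mul_of_nonneg_left hn' (hpos _).le
      _ = _ := by ring
  · have h1 : ∀ᶠ c in 𝓝[>] (1 : ℝ), (t / c) ^ (-α) < v :=
      ((hcont t ht).mono_left nhdsWithin_le_nhds).eventually_lt_const hv
    obtain ⟨c, hc, hc1⟩ := (h1.and eventually_mem_nhdsWithin).exists
    have hc0 : (0 : ℝ) < c := one_pos.trans hc1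
    filter_upwards [(hratio t ht c hc0).eventually_lt_const hc] with n hn
    refine lt_of_le_of_lt ?_ hn
    rw [le_div_iff₀ (hpos _)]
    calc (n + 1) * f (a n * t) * f (c * a n) = f (a n * t) * ((n + 1) * f (c * a n)) := by ring
      _ ≤ f (a n * t) * 1 := mul_le_mul_of_nonneg_left (hup c hc1 n) (hpos _).le
      _ = _ := mul_one _

/-- The norming constants of a tail function also serve for its left-continuous version. -/
theorem tendsto_scale_of_squeeze {f g : ℝ → ℝ} (hfg : ∀ x, f x ≤ g x)
    (hgf : ∀ x c, 0 < x → c < 1 → g x ≤ f (x * c)) {α : ℝ} {a : ℕ → ℝ} (ha : ∀ n, 0 < a n)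
    (h : ∀ t > 0, Tendsto (fun n : ℕ => (n + 1) * f (a n * t)) atTop (𝓝 (t ^ (-α))))
    {t : ℝ} (ht : 0 < t) :
    Tendsto (fun n : ℕ => (n + 1) * g (a n * t)) atTop (𝓝 (t ^ (-α))) := by
  refine tendsto_order.2 ⟨fun v hv => ?_, fun v hv => ?_⟩
  · filter_upwards [(h t ht).eventually_const_lt hv] with n hn
    exact hn.trans_le (mul_le_mul_of_nonneg_left (hfg _) (by positivity))
  · have hcont : Tendsto (fun c : ℝ => (t * c) ^ (-α)) (𝓝[<] 1) (𝓝 (t ^ (-α))) := by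
      have : ContinuousAt (fun c : ℝ => (t * c) ^ (-α)) 1 := by
        refine ContinuousAt.rpow_const (continuousAt_const.mul continuousAt_id) ?_
        left
        simpa using ht.ne'
      have := this.tendsto
      rw [mul_one] at this
      exact this.mono_left nhdsWithin_le_nhds
    obtain ⟨c, ⟨hc, hc1⟩, hc0⟩ := (((hcont.eventually_lt_const hv).and
      eventually_mem_nhdsWithin).and
      (eventually_nhdsWithin_of_eventually_nhds (lt_mem_nhds one_pos))).exists
    filter_upwards [(h (t * c) (mul_pos ht hc0)).eventually_lt_const hc] with n hn
    refine lt_of_le_of_lt (mul_le_mul_of_nonneg_left ?_ (by positivity)) hn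
    rw [← mul_assoc]
    exact hgf _ _ (mul_pos (ha n) ht) hc1

/-- Pólya's theorem for the limit `t ^ (-α)`: pointwise convergence of antitone functions to it is
uniform on `[ε, ∞)`. -/
theorem eventually_forall_abs_sub_rpow_le {g : ℕ → ℝ → ℝ}
    (hanti : ∀ n, AntitoneOn (g n) (Ioi 0)) (hnonneg : ∀ n t, 0 ≤ g n t) {α : ℝ} (hα : 0 < α)
    (h : ∀ t > 0, Tendsto (fun n => g n t) atTop (𝓝 (t ^ (-α)))) {ε η : ℝ} (hε : 0 < ε)
    (hη : 0 < η) : ∀ᶠ n in atTop, ∀ t ≥ ε, |g n t - t ^ (-α)| ≤ η := by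
  set b : ℝ := ε ^ (-α) with hb
  have hb0 : 0 < b := Real.rpow_pos_of_pos hε _
  obtain ⟨N, hN⟩ := exists_nat_gt (b / (η / 2))
  have hN0 : (0 : ℝ) < N := lt_of_le_of_lt (by positivity) hN
  have hbN : b / N ≤ η / 2 := by
    rw [div_lt_iff₀ (by positivity)] at hN
    rw [div_le_iff₀ hN0]
    linarith
  -- The grid of points at which the limit takes the values `i * b / N`, where `b` is its maximum.
  set τ : ℕ → ℝ := fun i => (i * b / N) ^ (-α⁻¹) with hτ
  have hτpos : ∀ i : ℕ, 1 ≤ i → 0 < τ i := fun i hi => by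
    have : (0 : ℝ) < i := by exact_mod_cast hi
    exact Real.rpow_pos_of_pos (by positivity) _
  have hτrpow : ∀ i : ℕ, τ i ^ (-α) = i * b / N := fun i => by
    rw [hτ, ← Real.rpow_mul (by positivity)]
    simp [hα.ne']
  have hev : ∀ᶠ n in atTop, ∀ i ∈ Finset.Icc 1 N, |g n (τ i) - i * b / N| ≤ η / 2 := by
    rw [Filter.eventually_all_finset]
    intro i hi
    have h1 := h (τ i) (hτpos i (Finset.mem_Icc.1 hi).1)
    rw [hτrpow] at h1
    have := (tendsto_iff_norm_sub_tendsto_zero.1 h1).eventually_le_const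
      (show (0 : ℝ) < η / 2 by positivity)
    simpa [Real.norm_eq_abs] using this
  filter_upwards [hev] with n hn t ht
  have ht0 : 0 < t := lt_of_lt_of_le hε ht
  set u := t ^ (-α) with hu
  have hu0 : 0 < u := Real.rpow_pos_of_pos ht0 _
  have hub : u ≤ b := Real.rpow_le_rpow_of_nonpos hε ht (by linarith)
  have htu : t = u ^ (-α⁻¹) := by
    rw [hu, ← Real.rpow_mul ht0.le]
    simp [hα.ne']
  set i := ⌈u * N / b⌉₊ with hi
  have hi1 : 1 ≤ i := Nat.one_le_ceil_iff.2 (by positivity)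
  have hiN : i ≤ N := by
    refine Nat.ceil_le.2 ?_
    rw [div_le_iff₀ hb0]
    nlinarith
  have hle : u ≤ i * b / N := by
    have := Nat.le_ceil (u * N / b)
    rw [div_le_iff₀ hb0] at this
    rwa [le_div_iff₀ hN0]
  have hlt : i * b / N < u + b / N := by
    have := Nat.ceil_lt_add_one (show 0 ≤ u * N / b by positivity)
    rw [← hi] at this
    have h2 : (i : ℝ) * b < (u * N / b + 1) * b := by gcongr
    rw [div_lt_iff₀ hN0]
    calc (i : ℝ) * b < (u * N / b + 1) * b := h2
      _ = _ := by field_simp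
  rw [abs_le]
  constructor
  · rcases hi1.lt_or_eq with hi2 | hi2
    · have hmem : i - 1 ∈ Finset.Icc 1 N := Finset.mem_Icc.2 ⟨by omega, by omega⟩
      have h1 := (abs_le.1 (hn (i - 1) hmem)).1
      have hcast : ((i - 1 : ℕ) : ℝ) = i - 1 := by
        rw [Nat.cast_sub hi1, Nat.cast_one]
      have hpos1 : (0 : ℝ) < ((i - 1 : ℕ) : ℝ) := by
        have : 0 < i - 1 := by omega
        exact_mod_cast this
      have hval : ((i - 1 : ℕ) : ℝ) * b / N = i * b / N - b / N := by
        rw [hcast]; ring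
      have htt : t ≤ τ (i - 1) := by
        rw [htu, hτ]
        refine Real.rpow_le_rpow_of_nonpos (by positivity) ?_ (by simp [hα.le])
        rw [hval]
        linarith
      have h2 := hanti n (mem_Ioi.2 ht0) (mem_Ioi.2 (ht0.trans_le htt)) htt
      linarith
    · have := hnonneg n t
      rw [← hi2] at hle
      simp only [Nat.cast_one, one_mul] at hle
      linarith
  · have hmem : i ∈ Finset.Icc 1 N := Finset.mem_Icc.2 ⟨hi1, hiN⟩
    have h1 := (abs_le.1 (hn i hmem)).2
    have htt : τ i ≤ t := by
      rw [htu, hτ]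
      exact Real.rpow_le_rpow_of_nonpos hu0 hle (by simp [hα.le])
    have h2 := hanti n (mem_Ioi.2 (hτpos i hi1)) (mem_Ioi.2 ht0) htt
    linarith

end Scale

/-! ### Integrable received powers -/

/-- The number of powers in `z` that exceed the level `δ`. -/
noncomputable def strongCount (δ : ℝ) {n : ℕ} (z : Fin n → ℝ) : ℕ :=
  ∑ j, if δ < z j then 1 else 0

theorem measurable_strongCount (δ : ℝ) (n : ℕ) :
    Measurable (strongCount δ : (Fin n → ℝ) → ℕ) :=
  Finset.measurable_sum _ fun j _ =>
    Measurable.ite (measurableSet_lt measurable_const (measurable_pi_apply j))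
      measurable_const measurable_const

theorem strongCount_succ (δ : ℝ) {n : ℕ} (x : Fin (n + 1) → ℝ) (i : Fin (n + 1)) :
    strongCount δ x = (if δ < x i then 1 else 0) + strongCount δ (splitAt i x).2 :=
  Fin.sum_univ_succAbove _ i

theorem min_mul_strongCount_le {δ W : ℝ} {n : ℕ} {z : Fin n → ℝ}
    (hz : ∀ j, 0 ≤ z j) : min δ W * (strongCount δ z + 1) ≤ (∑ j, z j) + W := by
  have h : min δ W * (strongCount δ z : ℝ) ≤ ∑ j, z j := by
    rw [strongCount, Nat.cast_sum, Finset.mul_sum]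
    refine Finset.sum_le_sum fun j _ => ?_
    split_ifs with h
    · simpa using (min_le_left δ W).trans h.le
    · simpa using hz j
  have := min_le_right δ W
  linarith

/-- The interference of the other nodes is at least of the order of the number of strong ones among
them. A term of the sum accounts for the event that the best node has a power above `r`, the last
term for the event that it has not, where the count may include the best node itself. -/
theorem best_le_add {δ W : ℝ} (hδ : 0 < δ) (hW : 0 < W) {r : ℝ} (hr : 0 ≤ r) {n : ℕ}
    {x : Fin (n + 1) → ℝ} (hx : ∀ i, 0 ≤ x i) :
    best W x ≤ (∑ i, (Ioi r).indicator id (x i) *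
        ((min δ W)⁻¹ * (1 / (strongCount δ (splitAt i x).2 + 1)))) +
      2 * r * ((min δ W)⁻¹ * (1 / (strongCount δ x + 1))) := by
  have hc : 0 < min δ W := lt_min hδ hW
  have hterm : ∀ i, 0 ≤ (Ioi r).indicator id (x i) *
        ((min δ W)⁻¹ * (1 / ((strongCount δ (splitAt i x).2 : ℝ) + 1))) := fun i =>
    mul_nonneg (indicator_nonneg (fun t ht => hr.trans (le_of_lt ht)) _) (by positivity)
  rw [best_eq]
  refine ciSup_le fun i => ?_
  have hle : x i / ((∑ j, x (i.succAbove j)) + W) ≤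
      x i * ((min δ W)⁻¹ * (1 / (strongCount δ (splitAt i x).2 + 1))) := by
    rw [div_eq_mul_inv, one_div, ← mul_inv]
    refine mul_le_mul_of_nonneg_left ?_ (hx i)
    exact inv_anti₀ (by positivity) (min_mul_strongCount_le fun j => hx _)
  refine hle.trans ?_
  by_cases hi : r < x i
  · have h1 := Finset.single_le_sum (fun i _ => hterm i) (Finset.mem_univ i)
    rw [indicator_of_mem (show x i ∈ Ioi r from hi)] at h1
    exact h1.trans (le_add_of_nonneg_right (by positivity))
  · refine le_trans ?_ (le_add_of_nonneg_left (Finset.sum_nonneg fun i _ => hterm i))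
    have h2 : (strongCount δ x : ℝ) ≤ 1 + strongCount δ (splitAt i x).2 := by
      rw [strongCount_succ δ x i]
      push_cast
      gcongr
      split_ifs <;> simp
    have h3 : 1 / ((strongCount δ (splitAt i x).2 : ℝ) + 1) ≤ 2 * (1 / (strongCount δ x + 1)) := by
      rw [mul_one_div, div_le_div_iff₀ (by positivity) (by positivity)]
      have : (0 : ℝ) ≤ strongCount δ (splitAt i x).2 := Nat.cast_nonneg _
      linarith
    calc x i * ((min δ W)⁻¹ * (1 / ((strongCount δ (splitAt i x).2 : ℝ) + 1)))
        ≤ r * ((min δ W)⁻¹ * (2 * (1 / (strongCount δ x + 1)))) := by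
          gcongr
          exact not_lt.1 hi
      _ = _ := by ring

section

variable (Q : Measure ℝ)

theorem exists_measure_Ioi_pos (h : 0 < Q (Ioi 0)) : ∃ δ > 0, Q (Ioi δ) ≠ 0 := by
  by_contra! hcon
  refine h.ne' ?_
  have : Ioi (0 : ℝ) = ⋃ n : ℕ, Ioi (1 / ((n : ℝ) + 1)) := by
    ext x
    simp only [mem_Ioi, mem_iUnion]
    exact ⟨fun hx => exists_nat_one_div_lt hx, fun ⟨n, hn⟩ => lt_trans (by positivity) hn⟩
  rw [this, measure_iUnion_null_iff]
  exact fun n => hcon _ (by positivity)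

variable [IsProbabilityMeasure Q]

theorem measurable_one_div_strongCount (δ : ℝ) (n : ℕ) :
    Measurable fun z : Fin n → ℝ => ENNReal.ofReal (1 / ((strongCount δ z : ℝ) + 1)) :=
  ((measurable_of_countable fun k : ℕ => ENNReal.ofReal (1 / ((k : ℝ) + 1))).comp
    (measurable_strongCount δ n))

/-- The mean of `1 / (B + 1)` for the binomial number `B` of powers above `δ` is at most
`1 / ((n + 1) q)`: each of the strong nodes of a network of `n + 1` nodes is given the same share
of a unit mass. -/
theorem succ_mul_lintegral_one_div_strongCount_le (δ : ℝ) (n : ℕ) :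
    (n + 1) * (Q (Ioi δ) * ∫⁻ z, ENNReal.ofReal (1 / ((strongCount δ z : ℝ) + 1))
      ∂(Measure.pi fun _ : Fin n => Q)) ≤ 1 := by
  set F : ℝ × (Fin n → ℝ) → ℝ≥0∞ := fun w => (Ioi δ).indicator 1 w.1 *
    ENNReal.ofReal (1 / ((strongCount δ w.2 : ℝ) + 1)) with hF
  have hm1 : Measurable ((Ioi δ).indicator (1 : ℝ → ℝ≥0∞)) :=
    measurable_const.indicator measurableSet_Ioi
  have hFm : Measurable F := (hm1.comp measurable_fst).mul
    ((measurable_one_div_strongCount δ n).comp measurable_snd)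
  have h1 : ∀ i : Fin (n + 1), ∫⁻ x, F (splitAt i x) ∂(Measure.pi fun _ : Fin (n + 1) => Q) =
      Q (Ioi δ) * ∫⁻ z, ENNReal.ofReal (1 / ((strongCount δ z : ℝ) + 1))
        ∂(Measure.pi fun _ : Fin n => Q) := by
    intro i
    rw [(measurePreserving_splitAt Q i).lintegral_comp hFm,
      lintegral_prod_mul hm1.aemeasurable (measurable_one_div_strongCount δ n).aemeasurable,
      lintegral_indicator_one measurableSet_Ioi]
  calc (n + 1) * (Q (Ioi δ) * ∫⁻ z, ENNReal.ofReal (1 / ((strongCount δ z : ℝ) + 1))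
        ∂(Measure.pi fun _ : Fin n => Q))
      = ∑ i, ∫⁻ x, F (splitAt i x) ∂(Measure.pi fun _ : Fin (n + 1) => Q) := by
        simp_rw [h1]
        simp
    _ = ∫⁻ x, ∑ i, F (splitAt i x) ∂(Measure.pi fun _ : Fin (n + 1) => Q) :=
        (lintegral_finsetSum _ fun i _ =>
          hFm.comp (measurePreserving_splitAt Q i).measurable).symm
    _ ≤ ∫⁻ x, 1 ∂(Measure.pi fun _ : Fin (n + 1) => Q) := by
        refine lintegral_mono fun x => ?_
        have h2 : ∀ i, F (splitAt i x) =
            ENNReal.ofReal (((if δ < x i then 1 else 0 : ℕ) : ℝ) / strongCount δ x) := by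
          intro i
          rw [strongCount_succ δ x i]
          by_cases hi : δ < x i
          · simp [hF, splitAt, hi, add_comm]
          · simp [hF, splitAt, hi]
        simp_rw [h2]
        rw [← ENNReal.ofReal_sum_of_nonneg fun i _ => by positivity, ← Finset.sum_div,
          ← Nat.cast_sum]
        exact ENNReal.ofReal_le_one.2 (div_self_le_one _)
    _ = 1 := by simp

/-- The level which separates large powers from the others is `√(n + 2)`: any level that tends to
infinity and is of smaller order than the number of nodes serves the purpose. -/
theorem lintegral_best_succ_le (hQ : Q (Iio 0) = 0) {δ W : ℝ} (hδ : 0 < δ) (hW : 0 < W)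
    (n : ℕ) :
    ∫⁻ x, ENNReal.ofReal (best W x) ∂(Measure.pi fun _ : Fin (n + 1) => Q) ≤
      ENNReal.ofReal (min δ W)⁻¹ * (Q (Ioi δ))⁻¹ *
        ((∫⁻ t in Ioi (√(n + 2)), ENNReal.ofReal t ∂Q) + ENNReal.ofReal (2 / √(n + 2))) := by
  set r := √(n + 2 : ℝ) with hrdef
  have hr : 0 < r := Real.sqrt_pos.2 (by positivity)
  have hrr : r * r = n + 2 := Real.mul_self_sqrt (by positivity)
  have hc : 0 < min δ W := lt_min hδ hW
  set κ := ENNReal.ofReal (min δ W)⁻¹ with hκ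
  set J : ℕ → ℝ≥0∞ := fun m => ∫⁻ z, ENNReal.ofReal (1 / ((strongCount δ z : ℝ) + 1))
        ∂(Measure.pi fun _ : Fin m => Q) with hJ
  have hJle : ∀ m : ℕ, (m + 1) * J m ≤ (Q (Ioi δ))⁻¹ := by
    intro m
    rw [ENNReal.le_inv_iff_mul_le]
    refine le_of_eq_of_le ?_ (succ_mul_lintegral_one_div_strongCount_le Q δ m)
    rw [mul_assoc, mul_comm (J m)]
  have hmind : Measurable fun t : ℝ => ENNReal.ofReal ((Ioi r).indicator id t) :=
    (measurable_id.indicator measurableSet_Ioi).ennreal_ofReal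
  set F : ℝ × (Fin n → ℝ) → ℝ≥0∞ := fun w => ENNReal.ofReal ((Ioi r).indicator id w.1) *
    (κ * ENNReal.ofReal (1 / ((strongCount δ w.2 : ℝ) + 1))) with hF
  have hFm : Measurable F := (hmind.comp measurable_fst).mul
    (((measurable_one_div_strongCount δ n).comp measurable_snd).const_mul _)
  have hFint : ∀ i : Fin (n + 1), ∫⁻ x, F (splitAt i x) ∂(Measure.pi fun _ : Fin (n + 1) => Q) =
      (∫⁻ t in Ioi r, ENNReal.ofReal t ∂Q) * (κ * J n) := by
    intro i
    rw [(measurePreserving_splitAt Q i).lintegral_comp hFm,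
      lintegral_prod_mul hmind.aemeasurable
        ((measurable_one_div_strongCount δ n).const_mul _).aemeasurable,
      lintegral_const_mul _ (measurable_one_div_strongCount δ n),
      ← lintegral_indicator measurableSet_Ioi]
    congr 1
    refine lintegral_congr fun t => ?_
    by_cases ht : t ∈ Ioi r <;> simp [ht]
  have hpt : ∀ᵐ x ∂(Measure.pi fun _ : Fin (n + 1) => Q), ENNReal.ofReal (best W x) ≤
      (∑ i, F (splitAt i x)) + ENNReal.ofReal (2 * r) *
        (κ * ENNReal.ofReal (1 / ((strongCount δ x : ℝ) + 1))) := by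
    filter_upwards [ae_pi_nonneg Q hQ (n + 1)] with x hx
    have hind : ∀ t, 0 ≤ (Ioi r).indicator id t := fun t =>
      indicator_nonneg (fun t ht => hr.le.trans (le_of_lt ht)) _
    refine (ENNReal.ofReal_le_ofReal (best_le_add hδ hW hr.le hx)).trans (le_of_eq ?_)
    rw [ENNReal.ofReal_add (Finset.sum_nonneg fun i _ => mul_nonneg (hind _) (by positivity))
      (by positivity), ENNReal.ofReal_sum_of_nonneg
        (fun i _ => mul_nonneg (hind _) (by positivity)),
      ENNReal.ofReal_mul (by positivity), ENNReal.ofReal_mul (inv_nonneg.2 hc.le)]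
    congr 1
    refine Finset.sum_congr rfl fun i _ => ?_
    rw [ENNReal.ofReal_mul (hind _), ENNReal.ofReal_mul (inv_nonneg.2 hc.le)]
    rfl
  have hJ2 : ENNReal.ofReal (2 * r) * J (n + 1) ≤ (Q (Ioi δ))⁻¹ * ENNReal.ofReal (2 / r) := by
    have h := mul_le_mul_left (hJle (n + 1)) (ENNReal.ofReal (2 / r))
    refine le_trans (le_of_eq ?_) h
    have h2 : ((n + 1 : ℕ) : ℝ≥0∞) + 1 = ENNReal.ofReal (r * r) := by
      rw [hrr, ENNReal.ofReal_add (by positivity) (by positivity), ENNReal.ofReal_natCast]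
      push_cast
      rw [add_assoc, one_add_one_eq_two]
      simp
    rw [h2, mul_right_comm, ← ENNReal.ofReal_mul (by positivity)]
    congr 2
    field_simp
  calc ∫⁻ x, ENNReal.ofReal (best W x) ∂(Measure.pi fun _ : Fin (n + 1) => Q)
      ≤ ∫⁻ x, ((∑ i, F (splitAt i x)) + ENNReal.ofReal (2 * r) *
        (κ * ENNReal.ofReal (1 / ((strongCount δ x : ℝ) + 1))))
          ∂(Measure.pi fun _ : Fin (n + 1) => Q) := lintegral_mono_ae hpt
    _ = (n + 1) * ((∫⁻ t in Ioi r, ENNReal.ofReal t ∂Q) * (κ * J n)) +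
          ENNReal.ofReal (2 * r) * (κ * J (n + 1)) := by
        rw [lintegral_add_right _
          (((measurable_one_div_strongCount δ (n + 1)).const_mul _).const_mul _),
          show ∫⁻ x, ∑ i, F (splitAt i x) ∂(Measure.pi fun _ : Fin (n + 1) => Q) =
              ∑ i, ∫⁻ x, F (splitAt i x) ∂(Measure.pi fun _ : Fin (n + 1) => Q) from
            lintegral_finsetSum _ fun i _ => hFm.comp (measurePreserving_splitAt Q i).measurable,
          lintegral_const_mul _ ((measurable_one_div_strongCount δ (n + 1)).const_mul _),
          lintegral_const_mul _ (measurable_one_div_strongCount δ (n + 1))]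
        simp_rw [hFint]
        rw [Finset.sum_const, Finset.card_univ, Fintype.card_fin, nsmul_eq_mul, Nat.cast_succ]
    _ = κ * ((∫⁻ t in Ioi r, ENNReal.ofReal t ∂Q) * ((n + 1) * J n)) +
          κ * (ENNReal.ofReal (2 * r) * J (n + 1)) := by ring
    _ ≤ κ * ((∫⁻ t in Ioi r, ENNReal.ofReal t ∂Q) * (Q (Ioi δ))⁻¹) +
          κ * ((Q (Ioi δ))⁻¹ * ENNReal.ofReal (2 / r)) := by
        gcongr
        exact hJle n
    _ = _ := by ring

theorem ae_best_nonneg (hQ : Q (Iio 0) = 0) {W : ℝ} (hW : 0 < W) (n : ℕ) :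
    ∀ᵐ x ∂(Measure.pi fun _ : Fin n => Q), 0 ≤ best W x := by
  filter_upwards [ae_pi_nonneg Q hQ n] with x hx using best_nonneg hW hx

theorem fixedCapacity_le_lintegral_best (hQ : Q (Iio 0) = 0) {W : ℝ} (hW : 0 < W) (n : ℕ) :
    fixedCapacity Q W n ≤
      ∫⁻ x, ENNReal.ofReal (best W x) ∂(Measure.pi fun _ : Fin n => Q) := by
  refine lintegral_mono_ae ?_
  filter_upwards [ae_best_nonneg Q hQ hW n] with x hx
  refine ENNReal.ofReal_le_ofReal ?_
  have := Real.log_le_sub_one_of_pos (show 0 < 1 + best W x by positivity)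
  linarith

/-- If the received power is integrable, then the mean of the best SINR vanishes as the number of
nodes grows: the interference is of the order of the number of nodes, and the largest power is of
smaller order. -/
theorem tendsto_lintegral_best (hQ : Q (Iio 0) = 0) (hpos : 0 < Q (Ioi 0))
    (hint : ∫⁻ t, ENNReal.ofReal t ∂Q ≠ ∞) {W : ℝ} (hW : 0 < W) :
    Tendsto (fun n => ∫⁻ x, ENNReal.ofReal (best W x) ∂(Measure.pi fun _ : Fin n => Q)) atTop
      (𝓝 0) ∧
    ∀ n, ∫⁻ x, ENNReal.ofReal (best W x) ∂(Measure.pi fun _ : Fin n => Q) ≠ ∞ := by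
  obtain ⟨δ, hδ, hq⟩ := exists_measure_Ioi_pos Q hpos
  have hbound := lintegral_best_succ_le Q hQ hδ hW
  have hK : ENNReal.ofReal (min δ W)⁻¹ * (Q (Ioi δ))⁻¹ ≠ ∞ :=
    ENNReal.mul_ne_top ENNReal.ofReal_ne_top (ENNReal.inv_ne_top.2 hq)
  constructor
  · rw [← tendsto_add_atTop_iff_nat 1]
    refine tendsto_of_tendsto_of_tendsto_of_le_of_le tendsto_const_nhds ?_
      (fun _ => zero_le) hbound
    have hsqrt : Tendsto (fun n : ℕ => √((n : ℝ) + 2)) atTop atTop :=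
      Real.tendsto_sqrt_atTop.comp
        (tendsto_atTop_add_const_right _ _ tendsto_natCast_atTop_atTop)
    have h1 : Tendsto (fun n : ℕ => ∫⁻ t in Ioi (√((n : ℝ) + 2)), ENNReal.ofReal t ∂Q) atTop
        (𝓝 0) := by
      refine tendsto_setLIntegral_zero hint ?_
      have := (ENNReal.tendsto_ofReal (tendsto_tail Q)).comp hsqrt
      simp only [ENNReal.ofReal_zero] at this
      exact this.congr fun n => ofReal_tail Q _
    have h2 : Tendsto (fun n : ℕ => ENNReal.ofReal (2 / √((n : ℝ) + 2))) atTop (𝓝 0) := by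
      have := ENNReal.tendsto_ofReal (hsqrt.const_div_atTop 2)
      simpa using this
    have := ENNReal.Tendsto.const_mul (h1.add h2) (Or.inr hK)
    simpa using this
  · intro n
    obtain _ | n := n
    · simp [best]
    · refine ne_top_of_le_ne_top ?_ (hbound n)
      refine ENNReal.mul_ne_top hK (ENNReal.add_ne_top.2 ⟨?_, ENNReal.ofReal_ne_top⟩)
      exact ne_top_of_le_ne_top hint (setLIntegral_le_lintegral _ _)

theorem tendsto_fixedCapacity_zero (hQ : Q (Iio 0) = 0) (hpos : 0 < Q (Ioi 0))
    (hint : ∫⁻ t, ENNReal.ofReal t ∂Q ≠ ∞) {W : ℝ} (hW : 0 < W) :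
    Tendsto (fixedCapacity Q W) atTop (𝓝 0) ∧ ∀ n, fixedCapacity Q W n ≠ ∞ := by
  obtain ⟨h1, h2⟩ := tendsto_lintegral_best Q hQ hpos hint hW
  exact ⟨tendsto_of_tendsto_of_tendsto_of_le_of_le tendsto_const_nhds h1 (fun _ => zero_le)
    (fixedCapacity_le_lintegral_best Q hQ hW),
    fun n => ne_top_of_le_ne_top (h2 n) (fixedCapacity_le_lintegral_best Q hQ hW n)⟩

theorem tendsto_fixedCoverage_zero (hQ : Q (Iio 0) = 0) (hpos : 0 < Q (Ioi 0))
    (hint : ∫⁻ t, ENNReal.ofReal t ∂Q ≠ ∞) {W y : ℝ} (hW : 0 < W) (hy : 0 < y) :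
    Tendsto (fixedCoverage Q W y) atTop (𝓝 0) := by
  obtain ⟨h1, -⟩ := tendsto_lintegral_best Q hQ hpos hint hW
  have hy' : ENNReal.ofReal y ≠ 0 := (ENNReal.ofReal_pos.2 hy).ne'
  have h2 := ENNReal.Tendsto.div_const (b := ENNReal.ofReal y) h1 (Or.inr hy')
  rw [ENNReal.zero_div] at h2
  refine tendsto_of_tendsto_of_tendsto_of_le_of_le tendsto_const_nhds h2 (fun _ => zero_le)
    fun n => ?_
  refine le_trans (measure_mono fun x hx => ?_) (meas_ge_le_lintegral_div
    (measurable_best W n).ennreal_ofReal.aemeasurable hy' ENNReal.ofReal_ne_top)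
  exact ENNReal.ofReal_le_ofReal hx

/-- A law with a tail below `H` is integrable if `H` decreases at least by the factor `2 ^ (-γ)`
under doubling, where `γ > 1`. Neither monotonicity nor measurability of `H` is needed, because its
values at the points `2 ^ k * x₀` dominate the (monotone) tail everywhere. -/
theorem lintegral_ofReal_ne_top {H : ℝ → ℝ} {γ : ℝ} (hγ : 1 < γ)
    (hH : ∀ᶠ x in atTop, 2 ^ γ * H (2 * x) ≤ H x) (hle : ∀ᶠ x in atTop, tail Q x ≤ H x)
    (hQ : Q (Iio 0) = 0) : ∫⁻ t, ENNReal.ofReal t ∂Q ≠ ∞ := by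
  obtain ⟨x₁, hx₁⟩ := eventually_atTop.1 (hH.and hle)
  set x₀ := max x₁ 1 with hx₀
  have hx₀1 : 1 ≤ x₀ := le_max_right _ _
  have hx₀pos : 0 < x₀ := one_pos.trans_le hx₀1
  have hmem : ∀ k : ℕ, x₁ ≤ 2 ^ k * x₀ := fun k =>
    (le_max_left _ _).trans (le_mul_of_one_le_left hx₀pos.le (one_le_pow₀ one_le_two))
  have hgeom : ∀ k : ℕ, ((2 : ℝ) ^ k) ^ γ * H (2 ^ k * x₀) ≤ H x₀ := by
    intro k
    induction k with
    | zero => simp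
    | succ k ih =>
      refine le_trans ?_ ih
      rw [pow_succ, Real.mul_rpow (by positivity) zero_le_two, mul_assoc]
      refine mul_le_mul_of_nonneg_left ?_ (by positivity)
      rw [mul_right_comm, mul_comm _ (2 : ℝ)]
      exact (hx₁ _ (hmem k)).1
  set C := (2 * x₀) ^ γ * H x₀ with hC
  have hHx₀ : 0 ≤ H x₀ := (tail_nonneg Q _).trans (hx₁ x₀ (le_max_left _ _)).2
  have hC0 : 0 ≤ C := mul_nonneg (by positivity) hHx₀
  have hbound : ∀ x ≥ x₀, tail Q x ≤ C * x ^ (-γ) := by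
    intro x hx
    have hx0 : 0 < x := hx₀pos.trans_le hx
    obtain ⟨k, hk1, hk2⟩ := exists_nat_pow_near ((one_le_div hx₀pos).2 hx) one_lt_two
    rw [le_div_iff₀ hx₀pos] at hk1
    rw [div_lt_iff₀ hx₀pos] at hk2
    have h1 : tail Q x ≤ H (2 ^ k * x₀) := (tail_antitone Q hk1).trans (hx₁ _ (hmem k)).2
    rw [Real.rpow_neg hx0.le, ← div_eq_mul_inv, le_div_iff₀ (Real.rpow_pos_of_pos hx0 _)]
    calc tail Q x * x ^ γ ≤ H (2 ^ k * x₀) * (2 ^ (k + 1) * x₀) ^ γ := by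
          have := tail_nonneg Q x
          gcongr
          exact (tail_nonneg Q x).trans h1
      _ = (2 * x₀) ^ γ * (((2 : ℝ) ^ k) ^ γ * H (2 ^ k * x₀)) := by
          rw [pow_succ, mul_assoc, Real.mul_rpow (by positivity) (by positivity)]
          ring
      _ ≤ C := mul_le_mul_of_nonneg_left (hgeom k) (by positivity)
  rw [lintegral_eq_lintegral_meas_lt Q (ae_nonneg Q hQ) aemeasurable_id]
  have hcover : Ioi (0 : ℝ) ⊆ Ioc 0 x₀ ∪ Ioi x₀ := fun x hx => by
    rcases le_or_gt x x₀ with h | h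
    · exact Or.inl ⟨hx, h⟩
    · exact Or.inr h
  refine ne_top_of_le_ne_top ?_ ((lintegral_mono_set hcover).trans (lintegral_union_le _ _ _))
  refine ENNReal.add_ne_top.2 ⟨?_, ?_⟩
  · refine ne_top_of_le_ne_top ?_ (lintegral_mono (g := fun _ => 1) fun t => prob_le_one)
    simp
  · have hi : IntegrableOn (fun x : ℝ => C * x ^ (-γ)) (Ioi x₀) :=
      (integrableOn_Ioi_rpow_of_lt (by linarith) hx₀pos).const_mul C
    refine ne_top_of_le_ne_top hi.lintegral_lt_top.ne
      (setLIntegral_mono' measurableSet_Ioi fun x hx => ?_)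
    rw [show {a : ℝ | x < a} = Ioi x from rfl, ← ofReal_tail]
    exact ENNReal.ofReal_le_ofReal (hbound x (le_of_lt hx))

end

/-! ### Slowly varying tails -/

section

variable (Q : Measure ℝ)

theorem log_mul_fixedCoverage_le (W : ℝ) {y : ℝ} (hy : 0 < y) (n : ℕ) :
    ENNReal.ofReal (Real.log (1 + y)) * fixedCoverage Q W y n ≤ fixedCapacity Q W n := by
  have hm : Measurable fun x : Fin n → ℝ => ENNReal.ofReal (Real.log (1 + best W x)) :=
    (Real.measurable_log.comp ((measurable_best W n).const_add 1)).ennreal_ofReal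
  refine le_trans (mul_le_mul_right (measure_mono fun x hx => ?_) _)
    (mul_meas_ge_le_lintegral hm _)
  refine ENNReal.ofReal_le_ofReal (Real.log_le_log (by positivity) ?_)
  have : y ≤ best W x := hx
  linarith

theorem tendsto_fixedCapacity_top {W : ℝ}
    (h : ∀ y > 0, Tendsto (fixedCoverage Q W y) atTop (𝓝 1)) :
    Tendsto (fixedCapacity Q W) atTop (𝓝 ∞) := by
  refine ENNReal.tendsto_nhds_top fun N => ?_
  have hy : 0 < Real.exp (N + 1) - 1 := by
    have := Real.add_one_le_exp ((N : ℝ) + 1)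
    have : (0 : ℝ) ≤ N := Nat.cast_nonneg N
    linarith
  have h1 := ENNReal.Tendsto.const_mul (a := ENNReal.ofReal (N + 1)) (h _ hy) (Or.inl one_ne_zero)
  rw [mul_one] at h1
  have h2 : (N : ℝ≥0∞) < ENNReal.ofReal (N + 1) := by
    rw [← ENNReal.ofReal_natCast]
    exact (ENNReal.ofReal_lt_ofReal_iff (by positivity)).2 (lt_add_one _)
  filter_upwards [h1.eventually_const_lt h2] with n hn
  refine hn.trans_le ?_
  have := log_mul_fixedCoverage_le Q W hy n
  rwa [add_sub_cancel, Real.log_exp] at this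

variable [IsProbabilityMeasure Q]

/-- The atoms of a law with a tail that does not decrease fast are at most of the order of the
tail. -/
theorem exists_leftTail_le_mul_tail (hpos : ∀ x, 0 < tail Q x) {b : ℝ}
    (h : ∀ᶠ x in atTop, tail Q x ≤ 2 ^ b * tail Q (2 * x)) :
    ∃ C > 0, ∀ t, leftTail Q t ≤ C * tail Q t := by
  obtain ⟨x₁, hx₁⟩ := eventually_atTop.1 h
  set x₀ := max x₁ 1 with hx₀
  refine ⟨max (2 ^ b) (1 / tail Q (2 * x₀)), lt_max_of_lt_left (by positivity), fun t => ?_⟩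
  rcases le_or_gt (2 * x₀) t with ht | ht
  · have h1 : x₀ ≤ t / 2 := by linarith
    have h2 := hx₁ (t / 2) ((le_max_left _ _).trans h1)
    rw [mul_div_cancel₀ _ two_ne_zero] at h2
    have h3 : 0 < x₀ := lt_max_of_lt_right one_pos
    calc leftTail Q t ≤ tail Q (t / 2) := leftTail_le_tail Q (by linarith)
      _ ≤ 2 ^ b * tail Q t := h2
      _ ≤ _ := mul_le_mul_of_nonneg_right (le_max_left _ _) (tail_nonneg Q t)
  · calc leftTail Q t ≤ 1 := leftTail_le_one Q t
      _ = 1 / tail Q (2 * x₀) * tail Q (2 * x₀) := (one_div_mul_cancel (hpos _).ne').symm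
      _ ≤ 1 / tail Q (2 * x₀) * tail Q t := by
          have := hpos (2 * x₀)
          have := tail_antitone Q ht.le
          gcongr
      _ ≤ _ := mul_le_mul_of_nonneg_right (le_max_right _ _) (tail_nonneg Q t)

/-- The mean of the powers up to `t`, in units of `t`. -/
noncomputable def truncatedMean (t : ℝ) : ℝ≥0∞ := ∫⁻ u in Iic t, ENNReal.ofReal (u / t) ∂Q

theorem truncatedMean_le_one {t : ℝ} (ht : 0 < t) : truncatedMean Q t ≤ 1 := by
  calc truncatedMean Q t ≤ ∫⁻ _ in Iic t, 1 ∂Q :=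
        setLIntegral_mono' measurableSet_Iic fun u hu =>
          ENNReal.ofReal_le_one.2 ((div_le_one ht).2 hu)
    _ ≤ 1 := by
        rw [setLIntegral_one]
        exact prob_le_one

/-- Integration by parts: the truncated mean is the integral of the tail over `(0, t)` less the
boundary term `t * tail Q t`, in units of `t`. -/
theorem truncatedMean_le (hQ : Q (Iio 0) = 0) {t : ℝ} (ht : 0 < t) (hpos : 0 < tail Q t) :
    truncatedMean Q t ≤
      (∫⁻ s in Ioo 0 1, ENNReal.ofReal (tail Q (t * s) / tail Q t - 1)) *
        ENNReal.ofReal (tail Q t) := by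
  have hg0 : ∀ᵐ u ∂Q, 0 ≤ (Iic t).indicator (fun u => u / t) u := by
    filter_upwards [ae_nonneg Q hQ] with u hu
    exact indicator_apply_nonneg fun _ => div_nonneg hu ht.le
  have h1 : truncatedMean Q t =
      ∫⁻ u, ENNReal.ofReal ((Iic t).indicator (fun u => u / t) u) ∂Q := by
    rw [truncatedMean, ← lintegral_indicator measurableSet_Iic]
    refine lintegral_congr fun u => ?_
    by_cases hu : u ∈ Iic t <;> simp [hu]
  rw [h1, lintegral_eq_lintegral_meas_lt Q hg0
    ((measurable_id.div_const t).indicator measurableSet_Iic).aemeasurable,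
    ← lintegral_mul_const' _ _ ENNReal.ofReal_ne_top,
    ← lintegral_indicator measurableSet_Ioi, ← lintegral_indicator measurableSet_Ioo]
  refine lintegral_mono fun s => ?_
  by_cases hs : 0 < s
  swap
  · rw [indicator_of_notMem (by simpa using hs)]
    exact zero_le
  rw [indicator_of_mem (show s ∈ Ioi (0 : ℝ) from hs)]
  by_cases hs1 : s < 1
  · rw [indicator_of_mem (show s ∈ Ioo (0 : ℝ) 1 from ⟨hs, hs1⟩),
      ← ENNReal.ofReal_mul' hpos.le, sub_mul, div_mul_cancel₀ _ hpos.ne', one_mul]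
    have hsub : {u | s < (Iic t).indicator (fun u => u / t) u} ⊆ Ioi (t * s) \ Ioi t := by
      intro u hu
      simp only [mem_ofPred_eq] at hu
      by_cases hut : u ≤ t
      · rw [indicator_of_mem (show u ∈ Iic t from hut), lt_div_iff₀ ht, mul_comm] at hu
        exact ⟨hu, not_lt.2 hut⟩
      · rw [indicator_of_notMem (by simpa using hut)] at hu
        exact absurd hu hs.not_gt
    refine (measure_mono hsub).trans (le_of_eq ?_)
    have hst : Ioi t ⊆ Ioi (t * s) := Ioi_subset_Ioi (mul_le_of_le_one_right ht.le hs1.le)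
    rw [← ofReal_measureReal, measureReal_sdiff hst measurableSet_Ioi]
    rfl
  · rw [indicator_of_notMem (fun h => hs1 h.2)]
    have hempty : {u | s < (Iic t).indicator (fun u => u / t) u} = ∅ := by
      ext u
      simp only [mem_ofPred_eq, mem_empty_iff_false, iff_false, not_lt]
      refine le_trans ?_ (not_lt.1 hs1)
      refine indicator_apply_le' (fun hu => (div_le_one ht).2 hu) fun _ => zero_le_one
    rw [hempty, measure_empty]

/-- Karamata's theorem for slowly varying tails: the truncated mean is negligible with respect to
the tail. -/
theorem eventually_truncatedMean_le (hQ : Q (Iio 0) = 0) (hpos : ∀ x, 0 < tail Q x)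
    (hreg : ∀ t > 0, Tendsto (fun x => tail Q (t * x) / tail Q x) atTop (𝓝 1))
    {C x₀ : ℝ} (hx₀ : 0 < x₀)
    (hpot : ∀ s x, 0 < s → s ≤ x → x₀ ≤ x →
      s ^ (1 / 2 : ℝ) * tail Q s ≤ C * (x ^ (1 / 2 : ℝ) * tail Q x))
    {ε : ℝ} (hε : 0 < ε) :
    ∀ᶠ t in atTop, truncatedMean Q t ≤ ENNReal.ofReal ε * Q (Ioi t) := by
  have hlim : Tendsto (fun t => ∫⁻ s in Ioo (0 : ℝ) 1,
      ENNReal.ofReal (tail Q (t * s) / tail Q t - 1)) atTop (𝓝 (∫⁻ s in Ioo (0 : ℝ) 1, 0)) := by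
    refine tendsto_lintegral_filter_of_dominated_convergence
      (fun s => ENNReal.ofReal (C * s ^ (-(1 / 2) : ℝ))) ?_ ?_ ?_ ?_
    · refine Eventually.of_forall fun t => Measurable.ennreal_ofReal ?_
      exact (((tail_antitone Q).measurable.comp (measurable_id.const_mul t)).div_const _).sub_const 1
    · filter_upwards [eventually_ge_atTop x₀] with t ht
      refine (ae_restrict_iff' measurableSet_Ioo).2 (Eventually.of_forall fun s hs => ?_)
      refine ENNReal.ofReal_le_ofReal ((sub_le_self _ zero_le_one).trans ?_)
      have ht0 : 0 < t := hx₀.trans_le ht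
      have h := hpot (t * s) t (mul_pos ht0 hs.1) (mul_le_of_le_one_right ht0.le hs.2.le) ht
      rw [div_le_iff₀ (hpos t), Real.rpow_neg hs.1.le, ← div_eq_mul_inv, div_mul_eq_mul_div,
        le_div_iff₀ (Real.rpow_pos_of_pos hs.1 _)]
      rw [Real.mul_rpow ht0.le hs.1.le] at h
      have htp : 0 < t ^ (1 / 2 : ℝ) := Real.rpow_pos_of_pos ht0 _
      refine le_of_mul_le_mul_left ?_ htp
      linarith
    · have hi : IntegrableOn (fun s : ℝ => C * s ^ (-(1 / 2) : ℝ)) (Ioo 0 1) := by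
        refine Integrable.const_mul ?_ C
        rw [← IntegrableOn, intervalIntegral.integrableOn_Ioo_rpow_iff one_pos]
        norm_num
      exact hi.lintegral_lt_top.ne
    · refine (ae_restrict_iff' measurableSet_Ioo).2 (Eventually.of_forall fun s hs => ?_)
      have h := (hreg s hs.1).sub_const 1
      rw [sub_self] at h
      have := ENNReal.tendsto_ofReal h
      rw [ENNReal.ofReal_zero] at this
      simpa only [mul_comm] using this
  rw [lintegral_zero] at hlim
  filter_upwards [hlim.eventually_lt_const (ENNReal.ofReal_pos.2 hε), eventually_gt_atTop 0]
    with t ht ht0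
  rw [← ofReal_tail]
  exact (truncatedMean_le Q hQ ht0 (hpos t)).trans (by gcongr)

theorem pi_forall_le (t : ℝ) (n : ℕ) :
    Measure.pi (fun _ : Fin n => Q) (univ.pi fun _ => Iic t) = Q (Iic t) ^ n := by
  rw [Measure.pi_pi]
  simp

/-- Failure of coverage of a strongest node, of power `t` say, means that the interference is at
least of the order of `t` (or that all powers are small); Markov's inequality for the
interference, given that no node is stronger than `t`, bounds its probability. -/
theorem one_sub_fixedCoverage_le (hQ : Q (Iio 0) = 0) {W y : ℝ} (hW : 0 < W) (hy : 0 < y)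
    (m : ℕ) :
    1 - fixedCoverage Q W y (m + 2) ≤ (m + 2) * (Q (Iio (2 * y * W)) ^ (m + 1) +
      (m + 1) * (ENNReal.ofReal (2 * y) *
        ∫⁻ t in Ici (2 * y * W), truncatedMean Q t * Q (Iic t) ^ m ∂Q)) := by
  set v := 2 * y * W with hv
  have hv0 : 0 < v := by positivity
  set k : ℝ → ℝ → ℝ≥0∞ := fun t u => if u ≤ t then ENNReal.ofReal (u / t) else 0 with hk
  set F : Fin (m + 1) → ℝ × (Fin (m + 1) → ℝ) → ℝ≥0∞ := fun j w =>
    (Ici v).indicator 1 w.1 * (k w.1 (w.2 j) *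
      {w : ℝ × (Fin m → ℝ) | ∀ i, w.2 i ≤ w.1}.indicator 1 (w.1, (splitAt j w.2).2)) with hF
  have hkm : Measurable (Function.uncurry k) :=
    Measurable.ite (measurableSet_le measurable_snd measurable_fst)
      (measurable_snd.div measurable_fst).ennreal_ofReal measurable_const
  have hind : Measurable ({w : ℝ × (Fin m → ℝ) | ∀ i, w.2 i ≤ w.1}.indicator
      (1 : ℝ × (Fin m → ℝ) → ℝ≥0∞)) :=
    measurable_const.indicator (measurableSet_forall_le m)
  have hsplit : ∀ j : Fin (m + 1), Measurable (splitAt j) := fun j =>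
    (measurePreserving_splitAt Q j).measurable
  have hFm : ∀ j, Measurable (F j) := fun j =>
    ((measurable_const.indicator measurableSet_Ici).comp measurable_fst).mul
      ((hkm.comp (measurable_fst.prodMk ((measurable_pi_apply j).comp measurable_snd))).mul
        (hind.comp (measurable_fst.prodMk
          (measurable_snd.comp ((hsplit j).comp measurable_snd)))))
  have hFint : ∀ j, ∫⁻ w, F j w ∂(Q.prod (Measure.pi fun _ : Fin (m + 1) => Q)) =
      ∫⁻ t in Ici v, truncatedMean Q t * Q (Iic t) ^ m ∂Q := by
    intro j
    rw [lintegral_prod _ (hFm j).aemeasurable, ← lintegral_indicator measurableSet_Ici]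
    refine lintegral_congr fun t => ?_
    by_cases ht : t ∈ Ici v
    swap
    · simp [hF, ht]
    have hkt : Measurable (k t) := hkm.comp (measurable_const.prodMk measurable_id)
    have hset : MeasurableSet ((univ : Set (Fin m)).pi fun _ => Iic t) :=
      MeasurableSet.univ_pi fun _ => measurableSet_Iic
    have hit : Measurable (((univ : Set (Fin m)).pi fun _ => Iic t).indicator
        (1 : (Fin m → ℝ) → ℝ≥0∞)) :=
      measurable_const.indicator hset
    calc ∫⁻ z, F j (t, z) ∂(Measure.pi fun _ : Fin (m + 1) => Q)
        = ∫⁻ z, (fun w : ℝ × (Fin m → ℝ) => k t w.1 *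
            ((univ : Set (Fin m)).pi fun _ => Iic t).indicator 1 w.2) (splitAt j z)
            ∂(Measure.pi fun _ : Fin (m + 1) => Q) := by
          refine lintegral_congr fun z => ?_
          simp only [hF]
          rw [indicator_of_mem ht, Pi.one_apply, one_mul]
          congr 1
          by_cases hz : ∀ i, (splitAt j z).2 i ≤ t
          · rw [indicator_of_mem (show (splitAt j z).2 ∈ univ.pi fun _ => Iic t from
                fun i _ => hz i),
              indicator_of_mem (show (t, (splitAt j z).2) ∈
                {w : ℝ × (Fin m → ℝ) | ∀ i, w.2 i ≤ w.1} from hz)]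
            rfl
          · rw [indicator_of_notMem (show (splitAt j z).2 ∉ univ.pi fun _ => Iic t from
                fun h => hz fun i => h i (mem_univ i)),
              indicator_of_notMem (show (t, (splitAt j z).2) ∉
                {w : ℝ × (Fin m → ℝ) | ∀ i, w.2 i ≤ w.1} from hz)]
      _ = ∫⁻ w : ℝ × (Fin m → ℝ), k t w.1 *
            ((univ : Set (Fin m)).pi fun _ => Iic t).indicator 1 w.2
            ∂(Q.prod (Measure.pi fun _ : Fin m => Q)) :=
          (measurePreserving_splitAt Q j).lintegral_comp
            ((hkt.comp measurable_fst).mul (hit.comp measurable_snd))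
      _ = (∫⁻ u, k t u ∂Q) * Q (Iic t) ^ m := by
          rw [lintegral_prod_mul hkt.aemeasurable hit.aemeasurable,
            lintegral_indicator_one hset, pi_forall_le]
      _ = _ := by
          rw [indicator_of_mem ht, truncatedMean, ← lintegral_indicator measurableSet_Iic]
          rfl
  have hsub : Q.prod (Measure.pi fun _ : Fin (m + 1) => Q)
      {w | (∀ j, w.2 j ≤ w.1) ∧ w.1 < y * ((∑ j, w.2 j) + W)} ≤
      Q.prod (Measure.pi fun _ : Fin (m + 1) => Q) (univ ×ˢ univ.pi fun _ => Iio v) +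
      Q.prod (Measure.pi fun _ : Fin (m + 1) => Q)
        {w | (∀ j, 0 ≤ w.2 j) ∧ (∀ j, w.2 j ≤ w.1) ∧ v ≤ w.1 ∧ w.1 < 2 * y * ∑ j, w.2 j} := by
    refine le_trans (measure_mono_ae ?_) (measure_union_le _ _)
    have hae : ∀ᵐ w ∂(Q.prod (Measure.pi fun _ : Fin (m + 1) => Q)), ∀ j, 0 ≤ w.2 j :=
      Measure.quasiMeasurePreserving_snd.ae (ae_pi_nonneg Q hQ (m + 1))
    filter_upwards [hae] with w hw hB
    obtain ⟨h1, h2⟩ := hB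
    rcases lt_or_ge w.1 v with hlt | hge
    · exact Or.inl ⟨mem_univ _, fun j _ => (h1 j).trans_lt hlt⟩
    · refine Or.inr ⟨hw, h1, hge, ?_⟩
      have : w.1 < y * (∑ j, w.2 j) + y * W := by rwa [← mul_add]
      have : v = 2 * (y * W) := by rw [hv]; ring
      linarith
  have hB' : Q.prod (Measure.pi fun _ : Fin (m + 1) => Q)
        {w | (∀ j, 0 ≤ w.2 j) ∧ (∀ j, w.2 j ≤ w.1) ∧ v ≤ w.1 ∧ w.1 < 2 * y * ∑ j, w.2 j} ≤
      (m + 1) * (ENNReal.ofReal (2 * y) *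
        ∫⁻ t in Ici v, truncatedMean Q t * Q (Iic t) ^ m ∂Q) := by
    calc _ ≤ ∫⁻ w, ENNReal.ofReal (2 * y) * ∑ j, F j w
            ∂(Q.prod (Measure.pi fun _ : Fin (m + 1) => Q)) := by
          refine meas_le_lintegral₀
            ((Finset.measurable_sum _ fun j _ => hFm j).const_mul _).aemeasurable ?_
          rintro ⟨t, z⟩ ⟨h0, h1, h2, h3⟩
          have ht : 0 < t := hv0.trans_le h2
          have hFj : ∀ j, F j (t, z) = ENNReal.ofReal (z j / t) := by
            intro j
            have h4 : ∀ i, z (j.succAbove i) ≤ t := fun i => h1 _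
            have h5 : z j ≤ t := h1 j
            have h6 : v ≤ t := h2
            simp [hF, hk, splitAt, h4, h5, h6]
          simp_rw [hFj]
          rw [← ENNReal.ofReal_sum_of_nonneg fun j _ => div_nonneg (h0 j) ht.le,
            ← ENNReal.ofReal_mul (by positivity), ← ENNReal.ofReal_one, ← Finset.sum_div]
          refine ENNReal.ofReal_le_ofReal ?_
          rw [← mul_div_assoc, one_le_div ht]
          exact h3.le
      _ = _ := by
          rw [lintegral_const_mul _ (Finset.measurable_sum _ fun j _ => hFm j),
            lintegral_finsetSum _ fun j _ => hFm j]
          simp_rw [hFint]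
          rw [Finset.sum_const, Finset.card_univ, Fintype.card_fin, nsmul_eq_mul, Nat.cast_succ]
          ring
  refine (one_sub_fixedCoverage_succ_le Q hQ hW (m + 1)).trans ?_
  have hcast : ((m + 1 : ℕ) : ℝ≥0∞) + 1 = m + 2 := by
    push_cast
    rw [add_assoc, one_add_one_eq_two]
  rw [hcast]
  refine mul_le_mul_right (hsub.trans (add_le_add (le_of_eq ?_) hB')) _
  rw [Measure.prod_prod, measure_univ, one_mul, Measure.pi_pi]
  simp

/-- Replacing the indicator of `Iic t` by that of `peak z ≤ t` and exchanging the integrals bounds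
the left-hand side by the mean of the squared left-continuous tail at the largest of `m` powers. -/
theorem lintegral_Ioi_mul_Iic_pow_le {C : ℝ} (hC : 0 < C)
    (hle : ∀ t, leftTail Q t ≤ C * tail Q t) {v : ℝ} (hv : 0 < v) (m : ℕ) :
    ∫⁻ t in Ici v, Q (Ioi t) * Q (Iic t) ^ m ∂Q ≤ ENNReal.ofReal (C ^ 2 * (4 / (m + 1) ^ 2)) := by
  have hle' : ∀ t, Q (Ici t) ≤ ENNReal.ofReal C * Q (Ioi t) := by
    intro t
    rw [← ofReal_leftTail, ← ofReal_tail, ← ENNReal.ofReal_mul hC.le]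
    exact ENNReal.ofReal_le_ofReal (hle t)
  have hm : MeasurableSet {w : ℝ × (Fin m → ℝ) | peak w.2 ≤ w.1} :=
    measurableSet_le ((measurable_peak m).comp measurable_snd) measurable_fst
  have hQm : Measurable fun t => Q (Ici t) :=
    (antitone_iff_forall_lt.2 fun _ _ h => measure_mono (Ici_subset_Ici.2 h.le)).measurable
  set G : ℝ × (Fin m → ℝ) → ℝ≥0∞ := fun w =>
    {w : ℝ × (Fin m → ℝ) | peak w.2 ≤ w.1}.indicator 1 w * Q (Ici (peak w.2)) with hG
  have hGm : Measurable G := (measurable_const.indicator hm).mul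
    (hQm.comp ((measurable_peak m).comp measurable_snd))
  calc ∫⁻ t in Ici v, Q (Ioi t) * Q (Iic t) ^ m ∂Q
      ≤ ∫⁻ t in Ici v, ∫⁻ z, G (t, z) ∂(Measure.pi fun _ : Fin m => Q) ∂Q := by
        refine setLIntegral_mono' measurableSet_Ici fun t ht => ?_
        rw [← pi_forall_le Q t m, ← lintegral_indicator_const
          (MeasurableSet.univ_pi fun _ => measurableSet_Iic)]
        refine lintegral_mono fun z => ?_
        refine indicator_apply_le' (fun hz => ?_) fun _ => zero_le
        have hp : peak z ≤ t := peak_le (hv.le.trans ht) fun j => hz j (mem_univ j)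
        simp only [hG]
        rw [indicator_of_mem (show (t, z) ∈ {w : ℝ × (Fin m → ℝ) | peak w.2 ≤ w.1} from hp),
          Pi.one_apply, one_mul]
        exact measure_mono fun x hx => hp.trans (le_of_lt hx)
    _ ≤ ∫⁻ t, ∫⁻ z, G (t, z) ∂(Measure.pi fun _ : Fin m => Q) ∂Q :=
        setLIntegral_le_lintegral _ _
    _ = ∫⁻ z, ∫⁻ t, G (t, z) ∂Q ∂(Measure.pi fun _ : Fin m => Q) :=
        lintegral_lintegral_swap hGm.aemeasurable
    _ = ∫⁻ z, Q (Ici (peak z)) ^ 2 ∂(Measure.pi fun _ : Fin m => Q) := by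
        refine lintegral_congr fun z => ?_
        simp only [hG]
        rw [lintegral_mul_const' _ _ (measure_ne_top _ _), sq]
        congr 1
        rw [← lintegral_indicator_one measurableSet_Ici]
        rfl
    _ ≤ ∫⁻ z, ENNReal.ofReal C ^ 2 * Q (Ioi (peak z)) ^ 2 ∂(Measure.pi fun _ : Fin m => Q) := by
        refine lintegral_mono fun z => ?_
        rw [← mul_pow]
        gcongr
        exact hle' _
    _ = ENNReal.ofReal C ^ 2 * ∫⁻ z, Q (Ioi (peak z)) ^ 2 ∂(Measure.pi fun _ : Fin m => Q) :=
        lintegral_const_mul' _ _ (by finiteness)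
    _ ≤ ENNReal.ofReal C ^ 2 * ENNReal.ofReal (4 / (m + 1) ^ 2) := by
        gcongr
        exact lintegral_Ioi_peak_sq_le Q m
    _ = _ := by
        rw [← ENNReal.ofReal_pow hC.le, ← ENNReal.ofReal_mul (by positivity)]

/-- For a slowly varying tail the largest power dominates the sum of all others. -/
theorem tendsto_fixedCoverage_one (hQ : Q (Iio 0) = 0) (hpos : ∀ x, 0 < tail Q x)
    (hreg : ∀ t > 0, Tendsto (fun x => tail Q (t * x) / tail Q x) atTop (𝓝 1))
    {W y : ℝ} (hW : 0 < W) (hy : 0 < y) : Tendsto (fixedCoverage Q W y) atTop (𝓝 1) := by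
  have hdbl : ∀ᶠ x in atTop, tail Q x ≤ 2 ^ (1 / 2 : ℝ) * tail Q (2 * x) := by
    have h1 : (2 : ℝ) ^ (-(1 / 2) : ℝ) < 1 :=
      Real.rpow_lt_one_of_one_lt_of_neg one_lt_two (by norm_num)
    filter_upwards [(hreg 2 two_pos).eventually_const_lt h1] with x hx
    rw [lt_div_iff₀ (hpos x), Real.rpow_neg zero_le_two, inv_mul_lt_iff₀ (by positivity)] at hx
    exact hx.le
  obtain ⟨C₁, hC₁, x₁, hx₁, hpot⟩ := exists_rpow_mul_le_of_le_two_mul (tail_antitone Q) hpos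
    (tail_le_one Q) (by norm_num) hdbl
  obtain ⟨C, hC, hleft⟩ := exists_leftTail_le_mul_tail Q hpos hdbl
  set v := 2 * y * W with hv
  have hv0 : 0 < v := by positivity
  have hlt : ∀ t, Q (Iic t) < 1 := by
    intro t
    have h1 : Q (Iic t) = 1 - Q (Ioi t) := by
      rw [← compl_Ioi, prob_compl_eq_one_sub measurableSet_Ioi]
    rw [h1]
    refine ENNReal.sub_lt_self ENNReal.one_ne_top one_ne_zero ?_
    rw [← ofReal_tail]
    exact (ENNReal.ofReal_pos.2 (hpos t)).ne'
  -- Polynomial factors are negligible with respect to the probability that all powers are small.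
  have hgeom : ∀ q : ℝ≥0∞, q < 1 →
      Tendsto (fun m : ℕ => ((m : ℝ≥0∞) + 2) * ((m + 1) * q ^ m)) atTop (𝓝 0) := by
    intro q hq
    have hq1 : q.toReal < 1 := by
      rw [← ENNReal.toReal_one]
      exact (ENNReal.toReal_lt_toReal hq.ne_top ENNReal.one_ne_top).2 hq
    have hq0 : 0 ≤ q.toReal := ENNReal.toReal_nonneg
    have h2 := tendsto_pow_const_mul_const_pow_of_lt_one 2 hq0 hq1
    have h1 := tendsto_pow_const_mul_const_pow_of_lt_one 1 hq0 hq1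
    have h0 := tendsto_pow_const_mul_const_pow_of_lt_one 0 hq0 hq1
    have hr : Tendsto (fun m : ℕ => ((m : ℝ) + 2) * ((m + 1) * q.toReal ^ m)) atTop (𝓝 0) := by
      have := (h2.add (h1.const_mul 3)).add (h0.const_mul 2)
      simp only [mul_zero, add_zero] at this
      refine this.congr fun m => ?_
      ring
    have := ENNReal.tendsto_ofReal hr
    rw [ENNReal.ofReal_zero] at this
    refine this.congr fun m => ?_
    rw [ENNReal.ofReal_mul (by positivity), ENNReal.ofReal_mul (by positivity),
      ENNReal.ofReal_pow hq0, ENNReal.ofReal_toReal hq.ne_top,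
      ENNReal.ofReal_add (by positivity) (by positivity),
      ENNReal.ofReal_add (by positivity) (by positivity)]
    simp
  have hmain : ∀ ε > 0, ∀ᶠ m in atTop, 1 - fixedCoverage Q W y (m + 2) ≤
      ENNReal.ofReal (2 * y * (8 * C ^ 2) * ε + ε) := by
    intro ε hε
    obtain ⟨x₀, hx₀⟩ := eventually_atTop.1
      (eventually_truncatedMean_le Q hQ hpos hreg hx₁ hpot hε)
    set q := max (Q (Iio v)) (Q (Iic x₀)) with hq
    have hq1 : q < 1 := max_lt ((measure_mono Iio_subset_Iic_self).trans_lt (hlt v)) (hlt x₀)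
    have hK : (1 + ENNReal.ofReal (2 * y)) ≠ ∞ := by finiteness
    have hlim := ENNReal.Tendsto.const_mul (hgeom q hq1) (Or.inr hK)
    rw [mul_zero] at hlim
    filter_upwards [hlim.eventually_lt_const (ENNReal.ofReal_pos.2 hε)] with m hm
    have hint : ∫⁻ t in Ici v, truncatedMean Q t * Q (Iic t) ^ m ∂Q ≤
        ENNReal.ofReal ε * ENNReal.ofReal (C ^ 2 * (4 / (m + 1) ^ 2)) + q ^ m := by
      calc ∫⁻ t in Ici v, truncatedMean Q t * Q (Iic t) ^ m ∂Q
          ≤ ∫⁻ t in Ici v, (ENNReal.ofReal ε * (Q (Ioi t) * Q (Iic t) ^ m) + q ^ m) ∂Q := by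
            refine setLIntegral_mono' measurableSet_Ici fun t ht => ?_
            rcases le_or_gt x₀ t with h | h
            · refine le_add_right ?_
              rw [← mul_assoc]
              gcongr
              exact hx₀ t h
            · refine le_add_left ?_
              calc truncatedMean Q t * Q (Iic t) ^ m ≤ 1 * q ^ m := by
                    gcongr
                    · exact truncatedMean_le_one Q (hv0.trans_le ht)
                    · exact (measure_mono (Iic_subset_Iic.2 h.le)).trans (le_max_right _ _)
                _ = q ^ m := one_mul _
        _ = ENNReal.ofReal ε * (∫⁻ t in Ici v, Q (Ioi t) * Q (Iic t) ^ m ∂Q) +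
              ∫⁻ t in Ici v, q ^ m ∂Q := by
            rw [lintegral_add_right _ measurable_const,
              lintegral_const_mul' _ _ ENNReal.ofReal_ne_top]
        _ ≤ _ := by
            gcongr
            · exact lintegral_Ioi_mul_Iic_pow_le Q hC hleft hv0 m
            · rw [setLIntegral_const]
              exact mul_le_of_le_one_right' prob_le_one
    -- The factor `(m + 2) * (m + 1)` of the number of pairs of nodes is compensated by the decay of
    -- order `m⁻²` of the mean squared tail.
    calc 1 - fixedCoverage Q W y (m + 2)
        ≤ (m + 2) * (Q (Iio v) ^ (m + 1) + (m + 1) * (ENNReal.ofReal (2 * y) *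
            ∫⁻ t in Ici v, truncatedMean Q t * Q (Iic t) ^ m ∂Q)) :=
          one_sub_fixedCoverage_le Q hQ hW hy m
      _ ≤ (m + 2) * ((m + 1) * q ^ m + (m + 1) * (ENNReal.ofReal (2 * y) *
            (ENNReal.ofReal ε * ENNReal.ofReal (C ^ 2 * (4 / (m + 1) ^ 2)) + q ^ m))) := by
          gcongr
          calc Q (Iio v) ^ (m + 1) ≤ Q (Iio v) ^ m :=
                pow_le_pow_right_of_le_one' prob_le_one (Nat.le_succ m)
            _ ≤ q ^ m := by gcongr; exact le_max_left _ _
            _ ≤ (m + 1) * q ^ m := le_mul_of_one_le_left' (le_add_left le_rfl)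
      _ = (m + 2) * ((m + 1) * (ENNReal.ofReal (2 * y) *
            (ENNReal.ofReal ε * ENNReal.ofReal (C ^ 2 * (4 / (m + 1) ^ 2))))) +
          (1 + ENNReal.ofReal (2 * y)) * ((m + 2) * ((m + 1) * q ^ m)) := by ring
      _ ≤ ENNReal.ofReal (2 * y * (8 * C ^ 2) * ε) + ENNReal.ofReal ε := by
          refine add_le_add ?_ hm.le
          have hc1 : (m : ℝ≥0∞) + 2 = ENNReal.ofReal (m + 2) := by
            rw [ENNReal.ofReal_add (by positivity) (by positivity)]; simp
          have hc2 : (m : ℝ≥0∞) + 1 = ENNReal.ofReal (m + 1) := by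
            rw [ENNReal.ofReal_add (by positivity) (by positivity)]; simp
          rw [hc1, hc2, ← ENNReal.ofReal_mul hε.le, ← ENNReal.ofReal_mul (by positivity),
            ← ENNReal.ofReal_mul (by positivity), ← ENNReal.ofReal_mul (by positivity)]
          refine ENNReal.ofReal_le_ofReal ?_
          have h4 : ((m : ℝ) + 2) * (4 / (m + 1)) ≤ 8 := by
            rw [← mul_div_assoc, div_le_iff₀ (by positivity)]
            have : (0 : ℝ) ≤ m := Nat.cast_nonneg m
            linarith
          calc ((m : ℝ) + 2) * ((m + 1) * (2 * y * (ε * (C ^ 2 * (4 / (m + 1) ^ 2)))))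
              = 2 * y * C ^ 2 * ε * (((m : ℝ) + 2) * (4 / (m + 1))) := by field_simp
            _ ≤ 2 * y * C ^ 2 * ε * 8 := by gcongr
            _ = _ := by ring
      _ = _ := (ENNReal.ofReal_add (by positivity) hε.le).symm
  have hzero : Tendsto (fun m => 1 - fixedCoverage Q W y (m + 2)) atTop (𝓝 0) := by
    refine ENNReal.tendsto_nhds_zero.2 fun η hη => ?_
    have hc : Tendsto (fun ε : ℝ => ENNReal.ofReal (2 * y * (8 * C ^ 2) * ε + ε)) (𝓝[>] 0)
        (𝓝 0) := by
      have : ContinuousAt (fun ε : ℝ => ENNReal.ofReal (2 * y * (8 * C ^ 2) * ε + ε)) 0 :=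
        (ENNReal.continuous_ofReal.comp (by fun_prop)).continuousAt
      have h := this.tendsto
      simp only [mul_zero, add_zero, ENNReal.ofReal_zero] at h
      exact h.mono_left nhdsWithin_le_nhds
    obtain ⟨ε, hε, hε0⟩ := ((hc.eventually_lt_const hη).and eventually_mem_nhdsWithin).exists
    filter_upwards [hmain ε hε0] with m hm using hm.trans hε.le
  rw [← tendsto_add_atTop_iff_nat 2]
  have h := ENNReal.Tendsto.sub (tendsto_const_nhds (x := (1 : ℝ≥0∞))) hzero
    (Or.inl ENNReal.one_ne_top)
  rw [tsub_zero] at h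
  refine h.congr fun m => ?_
  exact ENNReal.sub_sub_cancel ENNReal.one_ne_top prob_le_one

end

/-! ### Joint Laplace transforms of the total and the largest power -/

theorem exists_tendsto_of_approx {u : ℕ → ℝ}
    (h : ∀ δ > 0, ∃ c, ∀ᶠ n in atTop, |u n - c| ≤ δ) : ∃ L, Tendsto u atTop (𝓝 L) := by
  refine cauchySeq_tendsto_of_complete (Metric.cauchySeq_iff.2 fun δ hδ => ?_)
  obtain ⟨c, hc⟩ := h (δ / 3) (by positivity)
  obtain ⟨N, hN⟩ := eventually_atTop.1 hc
  refine ⟨N, fun m hm n hn => ?_⟩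
  rw [Real.dist_eq]
  have h1 := abs_le.1 (hN m hm)
  have h2 := abs_le.1 (hN n hn)
  rw [abs_lt]
  constructor <;> linarith

section

variable (Q : Measure ℝ) [IsProbabilityMeasure Q]

/-- The Laplace transform at `θ` of the received power in units of `a`, restricted to powers of at
most `a * x`. -/
noncomputable def truncatedLaplace (θ a x : ℝ) : ℝ :=
  ∫ p, (Iic (a * x)).indicator (fun p => Real.exp (-(θ * (p / a)))) p ∂Q

theorem integral_exp_mul_eq (θ y : ℝ) :
    ∫ t in (0 : ℝ)..y, θ * Real.exp (-(θ * t)) = 1 - Real.exp (-(θ * y)) := by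
  have hd : ∀ t ∈ uIcc 0 y, HasDerivAt (fun t => -Real.exp (-(θ * t)))
      (θ * Real.exp (-(θ * t))) t := by
    intro t _
    have := (((hasDerivAt_id t).const_mul θ).neg.exp).neg
    refine this.congr_deriv ?_
    simp [mul_comm]
  rw [intervalIntegral.integral_eq_sub_of_hasDerivAt hd
    (Continuous.intervalIntegrable (by fun_prop) _ _)]
  simp
  ring

/-- Integration by parts expresses the transform by the tail function. -/
theorem one_sub_truncatedLaplace (hQ : Q (Iio 0) = 0) {θ a x : ℝ} (hθ : 0 ≤ θ) (ha : 0 < a)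
    (hx : 0 < x) :
    1 - truncatedLaplace Q θ a x =
      (∫⁻ t in Ioo 0 x, ENNReal.ofReal (tail Q (a * t) * (θ * Real.exp (-(θ * t))))).toReal +
        Real.exp (-(θ * x)) * tail Q (a * x) := by
  set f : ℝ → ℝ := fun p => min (p / a) x with hf
  have hfm : Measurable f := (measurable_id.div_const a).min measurable_const
  have hf0 : 0 ≤ᵐ[Q] f := by
    filter_upwards [ae_nonneg Q hQ] with p hp using le_min (div_nonneg hp ha.le) hx.le
  have hexp : ∀ t : ℝ, 0 ≤ t → Real.exp (-(θ * t)) ≤ 1 := fun t ht =>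
    Real.exp_le_one_iff.2 (neg_nonpos.2 (mul_nonneg hθ ht))
  have hfi : Integrable (fun p => Real.exp (-(θ * f p))) Q := by
    refine Integrable.of_bound (by fun_prop) 1 ?_
    filter_upwards [hf0] with p hp
    rw [Real.norm_of_nonneg (Real.exp_nonneg _)]
    exact hexp _ hp
  have hLi : Integrable ((Iic (a * x)).indicator fun p => Real.exp (-(θ * (p / a)))) Q := by
    refine Integrable.of_bound (C := 1)
      (Measurable.indicator (by fun_prop) measurableSet_Iic).aestronglyMeasurable ?_
    filter_upwards [ae_nonneg Q hQ] with p hp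
    rw [Real.norm_of_nonneg (indicator_nonneg (fun _ _ => Real.exp_nonneg _) _)]
    exact indicator_apply_le' (fun _ => hexp _ (div_nonneg hp ha.le)) fun _ => zero_le_one
  have hdecomp : ∀ p, Real.exp (-(θ * f p)) =
      (Iic (a * x)).indicator (fun p => Real.exp (-(θ * (p / a)))) p +
        (Ioi (a * x)).indicator (fun _ => Real.exp (-(θ * x))) p := by
    intro p
    rcases le_or_gt p (a * x) with h | h
    · have h1 : p / a ≤ x := by rwa [div_le_iff₀ ha, mul_comm]
      rw [indicator_of_mem (show p ∈ Iic (a * x) from h), indicator_of_notMem (by simpa using h),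
        add_zero, hf]
      simp only [min_eq_left h1]
    · have h1 : x ≤ p / a := by rw [le_div_iff₀ ha, mul_comm]; exact h.le
      rw [indicator_of_notMem (by simpa using h), indicator_of_mem (show p ∈ Ioi (a * x) from h),
        zero_add, hf]
      simp only [min_eq_right h1]
  have h1 : ∫ p, (1 - Real.exp (-(θ * f p))) ∂Q =
      (∫⁻ t in Ioo 0 x, ENNReal.ofReal (tail Q (a * t) * (θ * Real.exp (-(θ * t))))).toReal := by
    rw [integral_eq_lintegral_of_nonneg_ae
      (by filter_upwards [hf0] with p hp using sub_nonneg.2 (hexp _ hp))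
      (by fun_prop)]
    congr 1
    have := lintegral_comp_eq_lintegral_meas_lt_mul Q (g := fun t => θ * Real.exp (-(θ * t)))
      hf0 hfm.aemeasurable (fun t _ => Continuous.intervalIntegrable (by fun_prop) _ _)
      (Eventually.of_forall fun t => mul_nonneg hθ (Real.exp_nonneg _))
    simp_rw [integral_exp_mul_eq] at this
    rw [this, ← lintegral_indicator measurableSet_Ioi, ← lintegral_indicator measurableSet_Ioo]
    refine lintegral_congr fun t => ?_
    by_cases ht : 0 < t
    swap
    · rw [indicator_of_notMem (by simpa using ht), indicator_of_notMem fun h => ht h.1]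
    rw [indicator_of_mem (show t ∈ Ioi (0 : ℝ) from ht)]
    by_cases htx : t < x
    · have hset : {p | t < f p} = Ioi (a * t) := by
        ext p
        simp only [mem_ofPred_eq, hf, lt_min_iff, htx, and_true, mem_Ioi, lt_div_iff₀ ha]
        rw [mul_comm]
      rw [indicator_of_mem (show t ∈ Ioo (0 : ℝ) x from ⟨ht, htx⟩), hset,
        ENNReal.ofReal_mul (tail_nonneg Q _), ofReal_tail]
    · have hset : {p | t < f p} = ∅ := by
        ext p
        simp [hf, htx]
      rw [indicator_of_notMem fun h => htx h.2, hset, measure_empty, zero_mul]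
  have h2 : ∫ p, Real.exp (-(θ * f p)) ∂Q =
      truncatedLaplace Q θ a x + Real.exp (-(θ * x)) * tail Q (a * x) := by
    simp_rw [hdecomp]
    rw [integral_add hLi ((integrable_const _).indicator measurableSet_Ioi),
      integral_indicator_const _ measurableSet_Ioi, smul_eq_mul, mul_comm (Q.real _)]
    rfl
  rw [← h1, integral_sub (integrable_const _) hfi, h2]
  simp only [integral_const, probReal_univ, one_smul]
  ring

/-- The total power and the largest one have a joint transform of product form. -/
theorem integral_indicator_exp_sum (θ a x : ℝ) (n : ℕ) :
    ∫ z, ((univ : Set (Fin n)).pi fun _ => Iic (a * x)).indicator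
        (fun z => Real.exp (-(θ * ((∑ j, z j) / a)))) z ∂(Measure.pi fun _ : Fin n => Q) =
      truncatedLaplace Q θ a x ^ n := by
  have h := integral_fintype_prod_eq_prod (𝕜 := ℝ) (μ := fun _ : Fin n => Q)
    (fun _ : Fin n => (Iic (a * x)).indicator fun p => Real.exp (-(θ * (p / a))))
  rw [Finset.prod_const, Finset.card_univ, Fintype.card_fin] at h
  rw [truncatedLaplace, ← h]
  refine integral_congr_ae (Eventually.of_forall fun z => ?_)
  by_cases hz : z ∈ (univ : Set (Fin n)).pi fun _ => Iic (a * x)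
  · simp only [indicator_of_mem hz]
    rw [Finset.prod_congr rfl fun i _ => indicator_of_mem (hz i (mem_univ i)) _,
      ← Real.exp_sum]
    congr 1
    rw [Finset.sum_neg_distrib, Finset.sum_div, Finset.mul_sum]
  · simp only [indicator_of_notMem hz]
    have : ∃ i, z i ∉ Iic (a * x) := by
      by_contra! hcon
      exact hz fun i _ => hcon i
    obtain ⟨i, hi⟩ := this
    exact (Finset.prod_eq_zero (Finset.mem_univ i) (indicator_of_notMem hi _)).symm

variable {Q} {α b : ℝ} {a : ℕ → ℝ}

/-- The Potter bound for the normalized tail; it is integrable at `0` for `b < 1`. -/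
theorem eventually_scaled_tail_le (ha : ∀ n, 0 < a n)
    (hatop : Tendsto a atTop atTop)
    (hscale : ∀ t > 0, Tendsto (fun n : ℕ => (n + 1) * tail Q (a n * t)) atTop (𝓝 (t ^ (-α))))
    {C x₀ : ℝ} (hC : 0 < C)
    (hpot : ∀ s x, 0 < s → s ≤ x → x₀ ≤ x → s ^ b * tail Q s ≤ C * (x ^ b * tail Q x)) :
    ∀ᶠ n : ℕ in atTop, ∀ t > 0,
      (n + 1) * tail Q (a n * t) ≤ 2 * (C * t ^ (-b) + 1) := by
  have h1 := hscale 1 one_pos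
  rw [Real.one_rpow] at h1
  filter_upwards [h1.eventually_le_const one_lt_two, hatop.eventually_ge_atTop x₀] with n hn hx t ht
  rw [mul_one] at hn
  have hCt : 0 ≤ C * t ^ (-b) := by positivity
  rcases le_or_gt t 1 with h | h
  · have h2 := hpot (a n * t) (a n) (mul_pos (ha n) ht) (mul_le_of_le_one_right (ha n).le h) hx
    have hap : 0 < a n ^ b := Real.rpow_pos_of_pos (ha n) _
    have htp : 0 < t ^ b := Real.rpow_pos_of_pos ht _
    have h3 : tail Q (a n * t) ≤ C * t ^ (-b) * tail Q (a n) := by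
      rw [Real.rpow_neg ht.le, ← div_eq_mul_inv, div_mul_eq_mul_div, le_div_iff₀ htp]
      rw [Real.mul_rpow (ha n).le ht.le] at h2
      refine le_of_mul_le_mul_left ?_ hap
      linarith
    calc (n + 1) * tail Q (a n * t) ≤ (n + 1) * (C * t ^ (-b) * tail Q (a n)) := by gcongr
      _ = C * t ^ (-b) * ((n + 1) * tail Q (a n)) := by ring
      _ ≤ C * t ^ (-b) * 2 := by gcongr
      _ ≤ _ := by linarith
  · calc (n + 1) * tail Q (a n * t) ≤ (n + 1) * tail Q (a n) := by
          have := tail_antitone Q (le_mul_of_one_le_right (ha n).le h.le)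
          gcongr
      _ ≤ 2 := hn
      _ ≤ _ := by linarith

/-- The `n`-th powers converge because the transform differs from `1` by a term of order `1 / n`;
the integral of the normalized tail converges by dominated convergence, which is where an index above
`-1` is needed. -/
theorem exists_tendsto_truncatedLaplace_pow (hQ : Q (Iio 0) = 0) (hb : b < 1)
    (ha : ∀ n, 0 < a n)
    (hscale : ∀ t > 0, Tendsto (fun n : ℕ => (n + 1) * tail Q (a n * t)) atTop (𝓝 (t ^ (-α))))
    {C : ℝ} (hdom : ∀ᶠ n : ℕ in atTop, ∀ t > 0,
      (n + 1) * tail Q (a n * t) ≤ 2 * (C * t ^ (-b) + 1))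
    {θ x : ℝ} (hθ : 0 ≤ θ) (hx : 0 < x) :
    ∃ κ, Tendsto (fun n => truncatedLaplace Q θ (a n) x ^ n) atTop (𝓝 (Real.exp κ)) := by
  set I : ℕ → ℝ≥0∞ := fun n =>
    ∫⁻ t in Ioo 0 x, ENNReal.ofReal (tail Q (a n * t) * (θ * Real.exp (-(θ * t)))) with hI
  have hmul : ∀ n : ℕ, ENNReal.ofReal (n + 1) * I n = ∫⁻ t in Ioo 0 x,
      ENNReal.ofReal ((n + 1) * tail Q (a n * t) * (θ * Real.exp (-(θ * t)))) := by
    intro n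
    rw [hI, ← lintegral_const_mul' _ _ ENNReal.ofReal_ne_top]
    refine lintegral_congr fun t => ?_
    rw [← ENNReal.ofReal_mul (by positivity), mul_assoc]
  have hbound : IntegrableOn (fun t : ℝ => 2 * (C * t ^ (-b) + 1) * θ) (Ioo 0 x) := by
    refine Integrable.mul_const (Integrable.const_mul (Integrable.add (Integrable.const_mul ?_ C)
      ?_) 2) θ
    · rw [← IntegrableOn, intervalIntegral.integrableOn_Ioo_rpow_iff hx]
      linarith
    · exact integrable_const _
  have hlim : Tendsto (fun n : ℕ => ENNReal.ofReal (n + 1) * I n) atTop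
      (𝓝 (∫⁻ t in Ioo 0 x, ENNReal.ofReal (t ^ (-α) * (θ * Real.exp (-(θ * t)))))) := by
    simp_rw [hmul]
    refine tendsto_lintegral_filter_of_dominated_convergence
      (fun t => ENNReal.ofReal (2 * (C * t ^ (-b) + 1) * θ)) ?_ ?_ hbound.lintegral_lt_top.ne ?_
    · refine Eventually.of_forall fun n => Measurable.ennreal_ofReal ?_
      exact ((((tail_antitone Q).measurable.comp (measurable_id.const_mul _)).const_mul _).mul
        (by fun_prop))
    · filter_upwards [hdom] with n hn
      refine (ae_restrict_iff' measurableSet_Ioo).2 (Eventually.of_forall fun t ht => ?_)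
      refine ENNReal.ofReal_le_ofReal ?_
      have h1 : θ * Real.exp (-(θ * t)) ≤ θ := mul_le_of_le_one_right hθ
        (Real.exp_le_one_iff.2 (neg_nonpos.2 (mul_nonneg hθ ht.1.le)))
      have h2 := hn t ht.1
      have h3 : 0 ≤ ((n : ℝ) + 1) * tail Q (a n * t) := mul_nonneg (by positivity) (tail_nonneg Q _)
      exact mul_le_mul h2 h1 (by positivity) (h3.trans h2)
    · refine (ae_restrict_iff' measurableSet_Ioo).2 (Eventually.of_forall fun t ht => ?_)
      exact ENNReal.tendsto_ofReal ((hscale t ht.1).mul_const _)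
  have hfin : ∫⁻ t in Ioo 0 x, ENNReal.ofReal (t ^ (-α) * (θ * Real.exp (-(θ * t)))) ≠ ∞ := by
    refine ne_top_of_le_ne_top hbound.lintegral_lt_top.ne
      (setLIntegral_mono' measurableSet_Ioo fun t ht => ENNReal.ofReal_le_ofReal ?_)
    have h1 : θ * Real.exp (-(θ * t)) ≤ θ := mul_le_of_le_one_right hθ
      (Real.exp_le_one_iff.2 (neg_nonpos.2 (mul_nonneg hθ ht.1.le)))
    have h2 : t ^ (-α) ≤ 2 * (C * t ^ (-b) + 1) :=
      le_of_tendsto (hscale t ht.1) (hdom.mono fun n hn => hn t ht.1)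
    have h3 : 0 ≤ t ^ (-α) := Real.rpow_nonneg ht.1.le _
    exact mul_le_mul h2 h1 (by positivity) (h3.trans h2)
  have hlim' := ((ENNReal.tendsto_toReal hfin).comp hlim).add
    ((hscale x hx).mul_const (Real.exp (-(θ * x))))
  set κ := (∫⁻ t in Ioo 0 x, ENNReal.ofReal (t ^ (-α) * (θ * Real.exp (-(θ * t))))).toReal +
    x ^ (-α) * Real.exp (-(θ * x)) with hκ
  have h1 : Tendsto (fun n : ℕ => ((n : ℝ) + 1) * (1 - truncatedLaplace Q θ (a n) x)) atTop
      (𝓝 κ) := by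
    refine hlim'.congr fun n => ?_
    rw [one_sub_truncatedLaplace Q hQ hθ (ha n) hx, mul_add]
    simp only [Function.comp, ENNReal.toReal_mul]
    rw [ENNReal.toReal_ofReal (by positivity)]
    ring
  have h2 : Tendsto (fun n : ℕ => (n : ℝ) * (truncatedLaplace Q θ (a n) x - 1)) atTop
      (𝓝 (-κ)) := by
    have := (tendsto_natCast_div_add_atTop (1 : ℝ)).mul h1.neg
    rw [one_mul] at this
    refine this.congr fun n => ?_
    field_simp
    ring
  refine ⟨-κ, ?_⟩
  simpa using Real.tendsto_one_add_pow_exp_of_tendsto h2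

/-- The joint Laplace transform of the total power (with the noise) and the largest power, in
units of the norming constants, converges to a positive limit. -/
theorem exists_tendsto_integral_exp (hQ : Q (Iio 0) = 0) (hb : b < 1) (ha : ∀ n, 0 < a n)
    (hatop : Tendsto a atTop atTop)
    (hscale : ∀ t > 0, Tendsto (fun n : ℕ => (n + 1) * tail Q (a n * t)) atTop (𝓝 (t ^ (-α))))
    {C : ℝ} (hdom : ∀ᶠ n : ℕ in atTop, ∀ t > 0,
      (n + 1) * tail Q (a n * t) ≤ 2 * (C * t ^ (-b) + 1))
    (W : ℝ) {θ η : ℝ} (hθ : 0 ≤ θ) (hη : 0 < η) :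
    ∃ L > 0, Tendsto (fun n => ∫ z, Real.exp (-(θ * (((∑ j, z j) + W) / a n) +
      η * (peak z / a n))) ∂(Measure.pi fun _ : Fin n => Q)) atTop (𝓝 L) := by
  choose! κ hκ using fun (x : ℝ) (hx : 0 < x) =>
    exists_tendsto_truncatedLaplace_pow hQ hb ha hscale hdom hθ hx
  have hwint : IntegrableOn (fun x : ℝ => η * Real.exp (-(η * x))) (Ioi 0) := by
    have := (exp_neg_integrableOn_Ioi 0 hη).const_mul η
    simp only [neg_mul] at this
    exact this
  have hφ0 : ∀ n x, 0 ≤ truncatedLaplace Q θ (a n) x := fun n x =>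
    integral_nonneg fun p => indicator_nonneg (fun _ _ => Real.exp_nonneg _) _
  have hexp1 : ∀ n p, 0 ≤ p → Real.exp (-(θ * (p / a n))) ≤ 1 := fun n p hp =>
    Real.exp_le_one_iff.2 (neg_nonpos.2 (mul_nonneg hθ (div_nonneg hp (ha n).le)))
  have hφint : ∀ n x, Integrable ((Iic (a n * x)).indicator
      fun p => Real.exp (-(θ * (p / a n)))) Q := by
    intro n x
    refine Integrable.of_bound (C := 1)
      (Measurable.indicator (by fun_prop) measurableSet_Iic).aestronglyMeasurable ?_
    filter_upwards [ae_nonneg Q hQ] with p hp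
    rw [Real.norm_of_nonneg (indicator_nonneg (fun _ _ => Real.exp_nonneg _) _)]
    exact indicator_apply_le' (fun _ => hexp1 n p hp) fun _ => zero_le_one
  have hφ1 : ∀ n x, truncatedLaplace Q θ (a n) x ≤ 1 := by
    intro n x
    calc truncatedLaplace Q θ (a n) x ≤ ∫ _, (1 : ℝ) ∂Q := by
          refine integral_mono_ae (hφint n x) (integrable_const _) ?_
          filter_upwards [ae_nonneg Q hQ] with p hp
          exact indicator_apply_le' (fun _ => hexp1 n p hp) fun _ => zero_le_one
      _ = 1 := by simp
  have hφmono : ∀ n, Monotone fun x => truncatedLaplace Q θ (a n) x := by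
    intro n x x' hxx'
    refine integral_mono (hφint n x) (hφint n x') fun p => ?_
    exact indicator_le_indicator_of_subset
      (Iic_subset_Iic.2 (mul_le_mul_of_nonneg_left hxx' (ha n).le))
      (fun _ => Real.exp_nonneg _) p
  -- Integration over the level `x` replaces the indicator of `peak z ≤ a n * x` by an exponential.
  have hident : ∀ n, ∫ z, Real.exp (-(θ * ((∑ j, z j) / a n) + η * (peak z / a n)))
      ∂(Measure.pi fun _ : Fin n => Q) =
      ∫ x in Ioi 0, η * Real.exp (-(η * x)) * truncatedLaplace Q θ (a n) x ^ n := by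
    intro n
    set G : (Fin n → ℝ) → ℝ → ℝ := fun z x => {w : ℝ × (Fin n → ℝ) | ∀ j, w.2 j ≤ w.1}.indicator
      (fun w => Real.exp (-(θ * ((∑ j, w.2 j) / a n)))) (a n * x, z) *
        (η * Real.exp (-(η * x))) with hG
    have hGm : Measurable (Function.uncurry G) := by
      refine Measurable.mul ?_ (by fun_prop)
      have h1 : Measurable (({w : ℝ × (Fin n → ℝ) | ∀ j, w.2 j ≤ w.1}).indicator
          (fun w => Real.exp (-(θ * ((∑ j, w.2 j) / a n))))) :=
        Measurable.indicator (by fun_prop) (measurableSet_forall_le n)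
      exact h1.comp ((measurable_snd.const_mul (a n)).prodMk measurable_fst)
    have hGint : Integrable (Function.uncurry G)
        ((Measure.pi fun _ : Fin n => Q).prod (volume.restrict (Ioi 0))) := by
      refine Integrable.mono'
        (g := fun w : (Fin n → ℝ) × ℝ => 1 * (η * Real.exp (-(η * w.2))))
        ((integrable_const (1 : ℝ)).mul_prod hwint) hGm.aestronglyMeasurable ?_
      have hae := Measure.quasiMeasurePreserving_fst
        (μ := Measure.pi fun _ : Fin n => Q) (ν := (volume : Measure ℝ).restrict (Ioi 0)) |>.ae
        (ae_pi_nonneg Q hQ n)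
      filter_upwards [hae] with w hw
      have h0 : 0 ≤ {w : ℝ × (Fin n → ℝ) | ∀ j, w.2 j ≤ w.1}.indicator
          (fun w => Real.exp (-(θ * ((∑ j, w.2 j) / a n)))) (a n * w.2, w.1) :=
        indicator_nonneg (fun _ _ => Real.exp_nonneg _) _
      simp only [Function.uncurry, hG]
      rw [Real.norm_of_nonneg (mul_nonneg h0 (by positivity))]
      refine mul_le_mul_of_nonneg_right ?_ (by positivity)
      exact indicator_apply_le' (fun _ => hexp1 n _ (Finset.sum_nonneg fun j _ => hw j))
        fun _ => zero_le_one
    calc ∫ z, Real.exp (-(θ * ((∑ j, z j) / a n) + η * (peak z / a n)))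
          ∂(Measure.pi fun _ : Fin n => Q)
        = ∫ z, (∫ x in Ioi 0, G z x) ∂(Measure.pi fun _ : Fin n => Q) := by
          refine integral_congr_ae ?_
          filter_upwards [ae_pi_nonneg Q hQ n] with z hz
          have hp : 0 ≤ peak z / a n := div_nonneg (peak_nonneg hz) (ha n).le
          have h1 : ∀ x ∈ Ioi (0 : ℝ), G z x = (Ici (peak z / a n)).indicator
              (fun x => Real.exp (-(θ * ((∑ j, z j) / a n))) * (η * Real.exp (-(η * x)))) x := by
            intro x hx
            have hiff : x ∈ Ici (peak z / a n) ↔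
                (a n * x, z) ∈ {w : ℝ × (Fin n → ℝ) | ∀ j, w.2 j ≤ w.1} := by
              rw [mem_Ici, div_le_iff₀ (ha n), mul_comm x]
              exact ⟨fun h j => (le_peak z j).trans h,
                fun h => peak_le (mul_nonneg (ha n).le (le_of_lt hx)) h⟩
            by_cases hmem : x ∈ Ici (peak z / a n)
            · simp only [hG]
              rw [indicator_of_mem hmem, indicator_of_mem (hiff.1 hmem)]
            · simp only [hG]
              rw [indicator_of_notMem hmem, indicator_of_notMem fun h => hmem (hiff.2 h), zero_mul]
          rw [setIntegral_congr_fun measurableSet_Ioi h1, setIntegral_indicator measurableSet_Ici,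
            integral_const_mul, neg_add, Real.exp_add]
          congr 1
          have h2 : (Ioi (0 : ℝ) ∩ Ici (peak z / a n) : Set ℝ) =ᵐ[volume] Ioi (peak z / a n) := by
            rcases hp.eq_or_lt with h | h
            · rw [← h, inter_eq_self_of_subset_left Ioi_subset_Ici_self]
              rfl
            · rw [inter_eq_self_of_subset_right (Ici_subset_Ioi.2 h)]
              exact Ioi_ae_eq_Ici.symm
          rw [setIntegral_congr_set h2, integral_const_mul]
          have h3 := integral_exp_mul_Ioi (neg_lt_zero.2 hη) (peak z / a n)
          simp only [neg_mul] at h3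
          rw [h3]
          field_simp
      _ = ∫ x in Ioi 0, ∫ z, G z x ∂(Measure.pi fun _ : Fin n => Q) :=
          integral_integral_swap hGint
      _ = _ := by
          refine integral_congr_ae (Eventually.of_forall fun x => ?_)
          simp only [hG]
          rw [integral_mul_const, mul_comm]
          congr 1
          rw [← integral_indicator_exp_sum]
          refine integral_congr_ae (Eventually.of_forall fun z => ?_)
          have hiff : z ∈ ((univ : Set (Fin n)).pi fun _ => Iic (a n * x)) ↔
                (a n * x, z) ∈ {w : ℝ × (Fin n → ℝ) | ∀ j, w.2 j ≤ w.1} :=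
            ⟨fun h j => h j (mem_univ j), fun h j _ => h j⟩
          by_cases hz : z ∈ ((univ : Set (Fin n)).pi fun _ => Iic (a n * x))
          · simp only [indicator_of_mem hz, indicator_of_mem (hiff.1 hz)]
          · simp only [indicator_of_notMem hz]
            rw [indicator_of_notMem fun h => hz (hiff.2 h)]
  have hlim : Tendsto (fun n => ∫ x in Ioi 0, η * Real.exp (-(η * x)) *
      truncatedLaplace Q θ (a n) x ^ n) atTop
      (𝓝 (∫ x in Ioi 0, η * Real.exp (-(η * x)) * Real.exp (κ x))) := by
    refine tendsto_integral_of_dominated_convergence _ (fun n => ?_) hwint (fun n => ?_) ?_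
    · exact (Measurable.mul (by fun_prop) ((hφmono n).measurable.pow_const n)).aestronglyMeasurable
    · refine Eventually.of_forall fun x => ?_
      rw [Real.norm_of_nonneg (mul_nonneg (by positivity) (pow_nonneg (hφ0 n x) _))]
      exact mul_le_of_le_one_right (by positivity) (pow_le_one₀ (hφ0 n x) (hφ1 n x))
    · refine (ae_restrict_iff' measurableSet_Ioi).2 (Eventually.of_forall fun x hx => ?_)
      exact (hκ x hx).const_mul _
  have hκm : AEStronglyMeasurable (fun x => η * Real.exp (-(η * x)) * Real.exp (κ x))
      (volume.restrict (Ioi 0)) := by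
    refine aestronglyMeasurable_of_tendsto_ae atTop (f := fun n x => η * Real.exp (-(η * x)) *
      truncatedLaplace Q θ (a n) x ^ n) (fun n => ?_) ?_
    · exact (Measurable.mul (by fun_prop) ((hφmono n).measurable.pow_const n)).aestronglyMeasurable
    · refine (ae_restrict_iff' measurableSet_Ioi).2 (Eventually.of_forall fun x hx => ?_)
      exact (hκ x hx).const_mul _
  have hκint : IntegrableOn (fun x => η * Real.exp (-(η * x)) * Real.exp (κ x)) (Ioi 0) := by
    refine Integrable.mono' hwint hκm ?_
    refine (ae_restrict_iff' measurableSet_Ioi).2 (Eventually.of_forall fun x hx => ?_)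
    rw [Real.norm_of_nonneg (by positivity)]
    refine mul_le_of_le_one_right (by positivity) ?_
    exact le_of_tendsto (hκ x hx) (Eventually.of_forall fun n => pow_le_one₀ (hφ0 n x) (hφ1 n x))
  have hLpos : 0 < ∫ x in Ioi 0, η * Real.exp (-(η * x)) * Real.exp (κ x) := by
    rw [setIntegral_pos_iff_support_of_nonneg_ae (Eventually.of_forall fun x => by positivity)
      hκint]
    have : Function.support (fun x => η * Real.exp (-(η * x)) * Real.exp (κ x)) = univ := by
      ext x
      simp only [Function.mem_support, mem_univ, iff_true]
      positivity
    rw [this, univ_inter]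
    simp
  refine ⟨_, hLpos, ?_⟩
  have hW : Tendsto (fun n => Real.exp (-(θ * (W / a n)))) atTop (𝓝 1) := by
    have h1 : Tendsto (fun n => -(θ * (W / a n))) atTop (𝓝 (-(θ * 0))) :=
      ((hatop.const_div_atTop W).const_mul θ).neg
    rw [mul_zero, neg_zero] at h1
    have := (Real.continuous_exp.tendsto 0).comp h1
    rwa [Real.exp_zero] at this
  have := hW.mul hlim
  rw [one_mul] at this
  refine this.congr fun n => ?_
  rw [← hident, ← integral_const_mul]
  refine integral_congr_ae (Eventually.of_forall fun z => ?_)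
  simp only
  rw [← Real.exp_add]
  congr 1
  ring

/-- The Laplace transform of the total power alone: as the largest power is at most the total, a
small exponent of the former changes little. -/
theorem exists_tendsto_integral_exp_sum (hQ : Q (Iio 0) = 0) (hb : b < 1) (ha : ∀ n, 0 < a n)
    (hatop : Tendsto a atTop atTop)
    (hscale : ∀ t > 0, Tendsto (fun n : ℕ => (n + 1) * tail Q (a n * t)) atTop (𝓝 (t ^ (-α))))
    {C : ℝ} (hdom : ∀ᶠ n : ℕ in atTop, ∀ t > 0,
      (n + 1) * tail Q (a n * t) ≤ 2 * (C * t ^ (-b) + 1))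
    {W : ℝ} (hW : 0 ≤ W) {θ : ℝ} (hθ : 0 < θ) :
    ∃ L, Tendsto (fun n => ∫ z, Real.exp (-(θ * (((∑ j, z j) + W) / a n)))
      ∂(Measure.pi fun _ : Fin n => Q)) atTop (𝓝 L) := by
  refine exists_tendsto_of_approx fun δ hδ => ?_
  set η := δ * θ / 2 with hηdef
  have hη : 0 < η := by positivity
  obtain ⟨L, -, hL⟩ := exists_tendsto_integral_exp hQ hb ha hatop hscale hdom W hθ.le hη
  refine ⟨L, ?_⟩
  have hL' := (tendsto_iff_norm_sub_tendsto_zero.1 hL).eventually_le_const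
    (show (0 : ℝ) < δ / 2 by positivity)
  filter_upwards [hL'] with n hn
  rw [Real.norm_eq_abs] at hn
  have hi1 : Integrable (fun z : Fin n → ℝ => Real.exp (-(θ * (((∑ j, z j) + W) / a n))))
      (Measure.pi fun _ : Fin n => Q) := by
    refine Integrable.of_bound (by fun_prop) 1 ?_
    filter_upwards [ae_pi_nonneg Q hQ n] with z hz
    have hs := Finset.sum_nonneg fun j (_ : j ∈ Finset.univ) => hz j
    rw [Real.norm_of_nonneg (Real.exp_nonneg _), Real.exp_le_one_iff, neg_nonpos]
    have := ha n
    positivity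
  have hi2 : Integrable (fun z : Fin n → ℝ => Real.exp (-(θ * (((∑ j, z j) + W) / a n) +
      η * (peak z / a n)))) (Measure.pi fun _ : Fin n => Q) := by
    have hpm := measurable_peak n
    refine Integrable.of_bound (by fun_prop) 1 ?_
    filter_upwards [ae_pi_nonneg Q hQ n] with z hz
    have hs := Finset.sum_nonneg fun j (_ : j ∈ Finset.univ) => hz j
    have hp := peak_nonneg hz
    rw [Real.norm_of_nonneg (Real.exp_nonneg _), Real.exp_le_one_iff, neg_nonpos]
    have := ha n
    positivity
  have hdiff : |(∫ z, Real.exp (-(θ * (((∑ j, z j) + W) / a n)))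
      ∂(Measure.pi fun _ : Fin n => Q)) - ∫ z, Real.exp (-(θ * (((∑ j, z j) + W) / a n) +
      η * (peak z / a n))) ∂(Measure.pi fun _ : Fin n => Q)| ≤ δ / 2 := by
    rw [← integral_sub hi1 hi2, ← Real.norm_eq_abs]
    refine (norm_integral_le_of_norm_le_const (C := δ / 2) ?_).trans (by simp)
    filter_upwards [ae_pi_nonneg Q hQ n] with z hz
    have hp : 0 ≤ peak z / a n := div_nonneg (peak_nonneg hz) (ha n).le
    set s := ((∑ j, z j) + W) / a n with hs
    have hps : peak z / a n ≤ s := by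
      have := peak_le_sum hz
      have := ha n
      rw [hs]
      gcongr
      linarith
    have hs0 : 0 ≤ s := hp.trans hps
    have h1 : 1 - Real.exp (-(η * (peak z / a n))) ≤ η * s := by
      have := Real.add_one_le_exp (-(η * (peak z / a n)))
      have : η * (peak z / a n) ≤ η * s := by gcongr
      linarith
    have h2 : Real.exp (-(η * (peak z / a n))) ≤ 1 :=
      Real.exp_le_one_iff.2 (neg_nonpos.2 (by positivity))
    have h3 : θ * s * Real.exp (-(θ * s)) ≤ 1 := by
      rw [Real.exp_neg, ← div_eq_mul_inv, div_le_one (Real.exp_pos _)]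
      have := Real.add_one_le_exp (θ * s)
      linarith
    rw [neg_add, Real.exp_add, ← mul_one_sub,
      Real.norm_of_nonneg (mul_nonneg (Real.exp_nonneg _) (sub_nonneg.2 h2))]
    calc Real.exp (-(θ * s)) * (1 - Real.exp (-(η * (peak z / a n))))
        ≤ Real.exp (-(θ * s)) * (η * s) := by gcongr
      _ = δ / 2 * (θ * s * Real.exp (-(θ * s))) := by rw [hηdef]; ring
      _ ≤ δ / 2 * 1 := by gcongr
      _ = δ / 2 := mul_one _
  have h1 := abs_le.1 hn
  have h2 := abs_le.1 hdiff
  rw [abs_le]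
  constructor <;> linarith

end

/-! ### Convergence of expectations from convergence of moments -/

/-- If all moments of random points of the unit square converge, then so do the expectations of
all continuous functions of them, by the Weierstrass theorem. -/
theorem exists_tendsto_integral_of_moments {Ω : ℕ → Type*} [∀ n, MeasurableSpace (Ω n)]
    (μ : ∀ n, Measure (Ω n)) [∀ n, IsProbabilityMeasure (μ n)]
    (X : ∀ n, Ω n → unitInterval × unitInterval) (hX : ∀ n, Measurable (X n))
    (hmom : ∀ i j : ℕ, ∃ L : ℝ, Tendsto
      (fun n => ∫ ω, ((X n ω).1 : ℝ) ^ i * ((X n ω).2 : ℝ) ^ j ∂(μ n)) atTop (𝓝 L))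
    (h : C(unitInterval × unitInterval, ℝ)) :
    ∃ L : ℝ, Tendsto (fun n => ∫ ω, h (X n ω) ∂(μ n)) atTop (𝓝 L) := by
  have hint : ∀ (f : C(unitInterval × unitInterval, ℝ)) n,
      Integrable (fun ω => f (X n ω)) (μ n) := fun f n =>
    Integrable.of_bound (f.continuous.measurable.comp (hX n)).aestronglyMeasurable ‖f‖
      (Eventually.of_forall fun ω => f.norm_coe_le_norm _)
  set u : C(unitInterval × unitInterval, ℝ) := ⟨fun x => (x.1 : ℝ), by fun_prop⟩ with hu
  set v : C(unitInterval × unitInterval, ℝ) := ⟨fun x => (x.2 : ℝ), by fun_prop⟩ with hv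
  set A : Subalgebra ℝ C(unitInterval × unitInterval, ℝ) := Algebra.adjoin ℝ {u, v} with hA
  have hsep : A.SeparatesPoints := by
    intro x y hxy
    by_cases h1 : x.1 = y.1
    · have h2 : x.2 ≠ y.2 := fun h2 => hxy (Prod.ext h1 h2)
      exact ⟨v, ⟨v, Algebra.subset_adjoin (by simp), rfl⟩, fun h => h2 (Subtype.ext h)⟩
    · exact ⟨u, ⟨u, Algebra.subset_adjoin (by simp), rfl⟩, fun h => h1 (Subtype.ext h)⟩
  have hconv : ∀ f ∈ A, ∃ L : ℝ, Tendsto (fun n => ∫ ω, f (X n ω) ∂(μ n)) atTop (𝓝 L) := by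
    intro f hf
    rw [hA, ← Subalgebra.mem_toSubmodule, Algebra.adjoin_eq_span] at hf
    induction hf using Submodule.span_induction with
    | mem f hf =>
      obtain ⟨i, j, rfl⟩ := (Submonoid.mem_closure_pair _ _ _).1 hf
      exact hmom i j
    | zero => exact ⟨0, by simp⟩
    | add f g _ _ hf hg =>
      obtain ⟨L, hL⟩ := hf
      obtain ⟨L', hL'⟩ := hg
      refine ⟨L + L', (hL.add hL').congr fun n => ?_⟩
      rw [← integral_add (hint f n) (hint g n)]
      rfl
    | smul c f _ hf =>
      obtain ⟨L, hL⟩ := hf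
      refine ⟨c * L, (hL.const_mul c).congr fun n => ?_⟩
      rw [← integral_const_mul]
      rfl
  refine exists_tendsto_of_approx fun δ hδ => ?_
  have hmem : h ∈ closure (A : Set C(unitInterval × unitInterval, ℝ)) := by
    have htop := ContinuousMap.subalgebra_topologicalClosure_eq_top_of_separatesPoints A hsep
    have : h ∈ A.topologicalClosure := by rw [htop]; trivial
    exact this
  obtain ⟨f, hf, hdist⟩ := Metric.mem_closure_iff.1 hmem (δ / 2) (by positivity)
  obtain ⟨L, hL⟩ := hconv f hf
  refine ⟨L, ?_⟩
  filter_upwards [(tendsto_iff_norm_sub_tendsto_zero.1 hL).eventually_le_const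
    (show (0 : ℝ) < δ / 2 by positivity)] with n hn
  rw [Real.norm_eq_abs] at hn
  have hdiff : |∫ ω, h (X n ω) ∂(μ n) - ∫ ω, f (X n ω) ∂(μ n)| ≤ δ / 2 := by
    rw [← integral_sub (hint h n) (hint f n), ← Real.norm_eq_abs]
    refine (norm_integral_le_of_norm_le_const (C := δ / 2) ?_).trans (by simp)
    refine Eventually.of_forall fun ω => ?_
    rw [← dist_eq_norm]
    exact (ContinuousMap.dist_apply_le_dist _).trans hdist.le
  have h1 := abs_le.1 hn
  have h2 := abs_le.1 hdiff
  rw [abs_le]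
  constructor <;> linarith

/-! ### Tails of index between `-1` and `0` -/

/-- The function `u ↦ max ε (-c log u) ^ (-α)`, extended continuously to `u = 0`. -/
noncomputable def logPower (α ε c u : ℝ) : ℝ :=
  if u = 0 then 0 else max ε (-(c * Real.log u)) ^ (-α)

theorem continuous_logPower {α ε c : ℝ} (hα : 0 < α) (hε : 0 < ε) (hc : 0 < c) :
    Continuous (logPower α ε c) := by
  have hne : ∀ u : ℝ, max ε (-(c * Real.log u)) ≠ 0 := fun u => (lt_max_of_lt_left hε).ne'
  rw [continuous_iff_continuousAt]
  intro u
  by_cases hu : u = 0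
  · subst hu
    rw [continuousAt_iff_punctured_nhds]
    have h1 : Tendsto (fun u => max ε (-(c * Real.log u))) (𝓝[≠] 0) atTop := by
      refine tendsto_atTop_mono (fun u => le_max_right _ _) ?_
      exact tendsto_neg_atBot_atTop.comp (Real.tendsto_log_nhdsNE_zero.const_mul_atBot hc)
    have h2 := (tendsto_rpow_neg_atTop hα).comp h1
    have h0 : logPower α ε c 0 = 0 := if_pos rfl
    rw [h0]
    refine h2.congr' ?_
    filter_upwards [self_mem_nhdsWithin] with u hu
    exact (if_neg hu).symm
  · have h1 : ContinuousAt (fun u => max ε (-(c * Real.log u)) ^ (-α)) u :=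
      (continuousAt_const.max (continuousAt_const.mul (Real.continuousAt_log hu)).neg).rpow_const
        (Or.inl (hne u))
    refine h1.congr ?_
    filter_upwards [isOpen_ne.mem_nhds hu] with w hw
    exact (if_neg hw).symm

theorem min_rpow_neg {x y α : ℝ} (hx : 0 < x) (hy : 0 < y) (hα : 0 < α) :
    min (x ^ (-α)) (y ^ (-α)) = max x y ^ (-α) := by
  rcases le_total x y with h | h
  · rw [max_eq_right h, min_eq_right (Real.rpow_le_rpow_of_nonpos hx h (by linarith))]
  · rw [max_eq_left h, min_eq_left (Real.rpow_le_rpow_of_nonpos hy h (by linarith))]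

theorem threshold_div {W y : ℝ} {n : ℕ} (z : Fin n → ℝ) {c : ℝ} (hc : 0 < c) :
    threshold W y z / c = max (y * (((∑ j, z j) + W) / c)) (peak z / c) := by
  rw [threshold, ← max_div_div_right hc.le, mul_div_assoc]

section

variable {Q : Measure ℝ} [IsProbabilityMeasure Q] {α b : ℝ} {a : ℕ → ℝ}

/-- The truncated power of the threshold is a continuous function of the two exponentials
`exp (-total)` and `exp (-largest)` in the unit square, whose moments are joint Laplace
transforms. -/
theorem exists_tendsto_integral_threshold (hQ : Q (Iio 0) = 0) (hα : 0 < α) (hb : b < 1)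
    (ha : ∀ n, 0 < a n) (hatop : Tendsto a atTop atTop)
    (hscale : ∀ t > 0, Tendsto (fun n : ℕ => (n + 1) * tail Q (a n * t)) atTop (𝓝 (t ^ (-α))))
    {C : ℝ} (hdom : ∀ᶠ n : ℕ in atTop, ∀ t > 0,
      (n + 1) * tail Q (a n * t) ≤ 2 * (C * t ^ (-b) + 1))
    {W y ε : ℝ} (hW : 0 ≤ W) (hy : 0 < y) (hε : 0 < ε) :
    ∃ L : ℝ, Tendsto (fun n => ∫ z, max ε (threshold W y z / a n) ^ (-α)
      ∂(Measure.pi fun _ : Fin n => Q)) atTop (𝓝 L) := by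
  have hI : ∀ t : ℝ, min 1 (Real.exp t) ∈ unitInterval := fun t =>
    ⟨le_min zero_le_one (Real.exp_nonneg _), min_le_left _ _⟩
  -- The minimum with `1` has no effect for nonnegative powers.
  set X : ∀ n, (Fin n → ℝ) → unitInterval × unitInterval := fun n z =>
    (⟨min 1 (Real.exp (-(((∑ j, z j) + W) / a n))), hI _⟩,
      ⟨min 1 (Real.exp (-(peak z / a n))), hI _⟩) with hX
  have hXm : ∀ n, Measurable (X n) := by
    intro n
    have hpm := measurable_peak n
    exact (Measurable.subtype_mk (by fun_prop)).prodMk (Measurable.subtype_mk (by fun_prop))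
  have hX1 : ∀ n (z : Fin n → ℝ), (∀ j, 0 ≤ z j) →
      ((X n z).1 : ℝ) = Real.exp (-(((∑ j, z j) + W) / a n)) := fun n z hz => by
    have := Finset.sum_nonneg fun j (_ : j ∈ Finset.univ) => hz j
    have := ha n
    exact min_eq_right (Real.exp_le_one_iff.2 (neg_nonpos.2 (by positivity)))
  have hX2 : ∀ n (z : Fin n → ℝ), (∀ j, 0 ≤ z j) →
      ((X n z).2 : ℝ) = Real.exp (-(peak z / a n)) := fun n z hz => by
    have := peak_nonneg hz
    have := ha n
    exact min_eq_right (Real.exp_le_one_iff.2 (neg_nonpos.2 (by positivity)))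
  have hmom : ∀ i j : ℕ, ∃ L : ℝ, Tendsto
      (fun n => ∫ z, ((X n z).1 : ℝ) ^ i * ((X n z).2 : ℝ) ^ j
        ∂(Measure.pi fun _ : Fin n => Q)) atTop (𝓝 L) := by
    intro i j
    have heq : ∀ n, ∫ z, ((X n z).1 : ℝ) ^ i * ((X n z).2 : ℝ) ^ j
        ∂(Measure.pi fun _ : Fin n => Q) = ∫ z, Real.exp (-(i * (((∑ j, z j) + W) / a n) +
          j * (peak z / a n))) ∂(Measure.pi fun _ : Fin n => Q) := by
      intro n
      refine integral_congr_ae ?_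
      filter_upwards [ae_pi_nonneg Q hQ n] with z hz
      rw [hX1 n z hz, hX2 n z hz, ← Real.exp_nat_mul, ← Real.exp_nat_mul, ← Real.exp_add]
      congr 1
      ring
    simp_rw [heq]
    rcases Nat.eq_zero_or_pos j with rfl | hj
    · rcases Nat.eq_zero_or_pos i with rfl | hi
      · exact ⟨1, by simp⟩
      · have hi' : (0 : ℝ) < i := by exact_mod_cast hi
        obtain ⟨L, hL⟩ := exists_tendsto_integral_exp_sum hQ hb ha hatop hscale hdom hW hi'
        exact ⟨L, by simpa using hL⟩
    · have hj' : (0 : ℝ) < j := by exact_mod_cast hj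
      obtain ⟨L, -, hL⟩ := exists_tendsto_integral_exp hQ hb ha hatop hscale hdom W
        (Nat.cast_nonneg i) hj'
      exact ⟨L, hL⟩
  set h : C(unitInterval × unitInterval, ℝ) :=
    ⟨fun x => min (logPower α ε y x.1) (logPower α ε 1 x.2),
      ((continuous_logPower hα hε hy).comp (by fun_prop)).min
        ((continuous_logPower hα hε one_pos).comp (by fun_prop))⟩ with hh
  obtain ⟨L, hL⟩ := exists_tendsto_integral_of_moments
    (fun n => Measure.pi fun _ : Fin n => Q) X hXm hmom h
  refine ⟨L, hL.congr fun n => integral_congr_ae ?_⟩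
  filter_upwards [ae_pi_nonneg Q hQ n] with z hz
  change min (logPower α ε y (X n z).1) (logPower α ε 1 (X n z).2) = _
  rw [hX1 n z hz, hX2 n z hz, logPower, logPower, if_neg (Real.exp_ne_zero _),
    if_neg (Real.exp_ne_zero _), Real.log_exp, Real.log_exp,
    min_rpow_neg (lt_max_of_lt_left hε) (lt_max_of_lt_left hε) hα, threshold_div z (ha n)]
  congr 1
  rw [mul_neg, neg_neg, mul_neg, neg_neg, one_mul, max_max_max_comm, max_self]

theorem integrable_comp_antitone {H : ℝ → ℝ} (hH : Antitone H) (hH0 : ∀ t, 0 ≤ H t)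
    (hH1 : ∀ t, H t ≤ 1) {n : ℕ} {g : (Fin n → ℝ) → ℝ} (hg : Measurable g) :
    Integrable (fun z => H (g z)) (Measure.pi fun _ : Fin n => Q) :=
  Integrable.of_bound (hH.measurable.comp hg).aestronglyMeasurable 1
    (Eventually.of_forall fun z => by
      rw [Real.norm_of_nonneg (hH0 _)]
      exact hH1 _)

theorem integral_tail_peak_sq_le (n : ℕ) :
    ∫ z, tail Q (peak z) ^ 2 ∂(Measure.pi fun _ : Fin n => Q) ≤ 4 / (n + 1) ^ 2 := by
  have hm : Measurable fun z : Fin n → ℝ => tail Q (peak z) ^ 2 :=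
    ((tail_antitone Q).measurable.comp (measurable_peak n)).pow_const 2
  rw [integral_eq_lintegral_of_nonneg_ae (Eventually.of_forall fun z => sq_nonneg _)
    hm.aestronglyMeasurable]
  refine ENNReal.toReal_le_of_le_ofReal (by positivity) ?_
  refine le_trans (le_of_eq (lintegral_congr fun z => ?_)) (lintegral_Ioi_peak_sq_le Q n)
  rw [ENNReal.ofReal_pow (tail_nonneg Q _), ofReal_tail]

/-- Cutting the threshold off from below at level `c` changes the mean of the tail little, because
the threshold is at least the largest power. -/
theorem integral_threshold_sub_le {H : ℝ → ℝ} (hH : Antitone H) (hH0 : ∀ t, 0 ≤ H t)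
    (hH1 : ∀ t, H t ≤ 1) {C : ℝ} (hC : 0 < C) (hHC : ∀ t, H t ≤ C * tail Q t)
    (W y : ℝ) {c : ℝ} (hc : 0 < tail Q c) (n : ℕ) :
    ∫ z, H (threshold W y z) ∂(Measure.pi fun _ : Fin n => Q) -
      ∫ z, H (max c (threshold W y z)) ∂(Measure.pi fun _ : Fin n => Q) ≤
        C / tail Q c * (4 / (n + 1) ^ 2) := by
  have hTm := measurable_threshold W y n
  have h2 : Integrable (fun z => tail Q (peak z) ^ 2) (Measure.pi fun _ : Fin n => Q) :=
    Integrable.of_bound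
      (((tail_antitone Q).measurable.comp (measurable_peak n)).pow_const 2).aestronglyMeasurable 1
      (Eventually.of_forall fun z => by
        rw [Real.norm_of_nonneg (sq_nonneg _)]
        exact pow_le_one₀ (tail_nonneg Q _) (tail_le_one Q _))
  rw [← integral_sub (integrable_comp_antitone hH hH0 hH1 hTm)
    (integrable_comp_antitone hH hH0 hH1 (measurable_const.max hTm))]
  calc ∫ z, (H (threshold W y z) - H (max c (threshold W y z))) ∂(Measure.pi fun _ : Fin n => Q)
      ≤ ∫ z, C / tail Q c * tail Q (peak z) ^ 2 ∂(Measure.pi fun _ : Fin n => Q) := by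
        refine integral_mono ((integrable_comp_antitone hH hH0 hH1 hTm).sub
          (integrable_comp_antitone hH hH0 hH1 (measurable_const.max hTm)))
          (h2.const_mul _) fun z => ?_
        simp only
        rcases le_or_gt c (threshold W y z) with h | h
        · rw [max_eq_right h, sub_self]
          positivity
        · have hpT : peak z ≤ threshold W y z := le_max_right _ _
          have h3 : tail Q c ≤ tail Q (peak z) := tail_antitone Q (hpT.trans h.le)
          rw [div_mul_eq_mul_div, le_div_iff₀ hc]
          calc (H (threshold W y z) - H (max c (threshold W y z))) * tail Q c
              ≤ (C * tail Q (peak z)) * tail Q (peak z) := by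
                refine mul_le_mul ?_ h3 hc.le (mul_nonneg hC.le (tail_nonneg Q _))
                exact (sub_le_self _ (hH0 _)).trans ((hH hpT).trans (hHC _))
            _ = _ := by ring
    _ = C / tail Q c * ∫ z, tail Q (peak z) ^ 2 ∂(Measure.pi fun _ : Fin n => Q) :=
        integral_const_mul _ _
    _ ≤ _ := by
        gcongr
        exact integral_tail_peak_sq_le n

/-- For the tail function and for its left-continuous version alike, the mean at the threshold is
up to `O(ε ^ α)` the mean of a continuous function of the normalized threshold. -/
theorem eventually_abs_sub_le {H : ℝ → ℝ} (hH : Antitone H) (hH0 : ∀ t, 0 ≤ H t)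
    (hH1 : ∀ t, H t ≤ 1) (hpos : ∀ x, 0 < tail Q x) (hα : 0 < α) (ha : ∀ n, 0 < a n)
    (hscale : ∀ t > 0, Tendsto (fun n : ℕ => (n + 1) * tail Q (a n * t)) atTop (𝓝 (t ^ (-α))))
    (hHscale : ∀ t > 0, Tendsto (fun n : ℕ => (n + 1) * H (a n * t)) atTop (𝓝 (t ^ (-α))))
    {C : ℝ} (hC : 0 < C) (hHC : ∀ t, H t ≤ C * tail Q t)
    {W y ε : ℝ} (hε : 0 < ε) {L : ℝ}
    (hL : Tendsto (fun n => ∫ z, max ε (threshold W y z / a n) ^ (-α)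
      ∂(Measure.pi fun _ : Fin n => Q)) atTop (𝓝 L)) {δ : ℝ} (hδ : 0 < δ) :
    ∀ᶠ n : ℕ in atTop,
      L - δ ≤ (n + 1) * ∫ z, H (threshold W y z) ∂(Measure.pi fun _ : Fin n => Q) ∧
      (n + 1) * ∫ z, H (threshold W y z) ∂(Measure.pi fun _ : Fin n => Q) ≤
        L + 4 * C * ε ^ α + δ := by
  have huni := eventually_forall_abs_sub_rpow_le (g := fun (n : ℕ) t => (n + 1) * H (a n * t))
    (fun n s _ t _ hst => mul_le_mul_of_nonneg_left
      (hH (mul_le_mul_of_nonneg_left hst (ha n).le)) (by positivity))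
    (fun n t => mul_nonneg (by positivity) (hH0 _)) hα hHscale hε
    (show (0 : ℝ) < δ / 4 by positivity)
  have hrem : Tendsto (fun n : ℕ => 4 * C / (((n : ℝ) + 1) * tail Q (a n * ε))) atTop
      (𝓝 (4 * C * ε ^ α)) := by
    have hεα : ε ^ (-α) ≠ 0 := (Real.rpow_pos_of_pos hε _).ne'
    have := (tendsto_const_nhds (x := 4 * C)).div (hscale ε hε) hεα
    rwa [Real.rpow_neg hε.le, div_inv_eq_mul] at this
  have hL' := (tendsto_iff_norm_sub_tendsto_zero.1 hL).eventually_le_const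
    (show (0 : ℝ) < δ / 4 by positivity)
  filter_upwards [huni, hrem.eventually_le_const (lt_add_of_pos_right _
    (show (0 : ℝ) < δ / 4 by positivity)), hL'] with n hn1 hn2 hn3
  rw [Real.norm_eq_abs] at hn3
  have hTm := measurable_threshold W y n
  have hi1 := integrable_comp_antitone (Q := Q) hH hH0 hH1 hTm
  have hi2 := integrable_comp_antitone (Q := Q) hH hH0 hH1
    ((measurable_const (a := a n * ε)).max hTm)
  have hi3 : Integrable (fun z => max ε (threshold W y z / a n) ^ (-α))
      (Measure.pi fun _ : Fin n => Q) := by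
    refine Integrable.of_bound (C := ε ^ (-α))
      ((measurable_const.max (hTm.div_const _)).pow_const _).aestronglyMeasurable
      (Eventually.of_forall fun z => ?_)
    rw [Real.norm_of_nonneg (Real.rpow_nonneg (hε.le.trans (le_max_left _ _)) _)]
    exact Real.rpow_le_rpow_of_nonpos hε (le_max_left _ _) (by linarith)
  have hcut : |(n + 1) * ∫ z, H (max (a n * ε) (threshold W y z))
      ∂(Measure.pi fun _ : Fin n => Q) - ∫ z, max ε (threshold W y z / a n) ^ (-α)
      ∂(Measure.pi fun _ : Fin n => Q)| ≤ δ / 4 := by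
    rw [← integral_const_mul, ← integral_sub (hi2.const_mul _) hi3, ← Real.norm_eq_abs]
    refine (norm_integral_le_of_norm_le_const (C := δ / 4) ?_).trans (by simp)
    refine Eventually.of_forall fun z => ?_
    have h1 := hn1 (max ε (threshold W y z / a n)) (le_max_left _ _)
    rw [mul_max_of_nonneg _ _ (ha n).le, mul_div_cancel₀ _ (ha n).ne'] at h1
    rw [Real.norm_eq_abs]
    exact h1
  have hle : ∫ z, H (max (a n * ε) (threshold W y z)) ∂(Measure.pi fun _ : Fin n => Q) ≤
      ∫ z, H (threshold W y z) ∂(Measure.pi fun _ : Fin n => Q) :=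
    integral_mono hi2 hi1 fun z => hH (le_max_right _ _)
  have hup := integral_threshold_sub_le hH hH0 hH1 hC hHC W y (hpos (a n * ε)) n
  have hn0 : (0 : ℝ) < (n : ℝ) + 1 := by positivity
  have hle' := mul_le_mul_of_nonneg_left hle hn0.le
  have hup' := mul_le_mul_of_nonneg_left hup hn0.le
  have hval : ((n : ℝ) + 1) * (C / tail Q (a n * ε) * (4 / (n + 1) ^ 2)) =
      4 * C / (((n : ℝ) + 1) * tail Q (a n * ε)) := by
    have := (hpos (a n * ε)).ne'
    field_simp
  rw [hval, mul_sub] at hup'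
  have h2 := abs_le.1 hcut
  have h3 := abs_le.1 hn3
  constructor <;> linarith

/-- For a tail of index between `-1` and `0`, the coverage converges to a positive limit. -/
theorem exists_tendsto_fixedCoverage (hQ : Q (Iio 0) = 0) (hpos : ∀ x, 0 < tail Q x)
    (hα : 0 < α) (hα1 : α < 1)
    (hreg : ∀ t > 0, Tendsto (fun x => tail Q (t * x) / tail Q x) atTop (𝓝 (t ^ (-α))))
    {W y : ℝ} (hW : 0 < W) (hy : 0 < y) :
    ∃ L > 0, Tendsto (fixedCoverage Q W y) atTop (𝓝 (ENNReal.ofReal L)) := by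
  obtain ⟨b, hαb, hb⟩ := exists_between hα1
  have hb0 : 0 < b := hα.trans hαb
  have hdbl : ∀ᶠ x in atTop, tail Q x ≤ 2 ^ b * tail Q (2 * x) := by
    have h1 : (2 : ℝ) ^ (-b) < 2 ^ (-α) :=
      Real.rpow_lt_rpow_of_exponent_lt one_lt_two (by linarith)
    filter_upwards [(hreg 2 two_pos).eventually_const_lt h1] with x hx
    rw [lt_div_iff₀ (hpos x), Real.rpow_neg zero_le_two, inv_mul_lt_iff₀ (by positivity)] at hx
    exact hx.le
  obtain ⟨C₁, hC₁, x₁, hx₁, hpot⟩ := exists_rpow_mul_le_of_le_two_mul (tail_antitone Q) hpos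
    (tail_le_one Q) hb0.le hdbl
  obtain ⟨C₂, hC₂, hleft₂⟩ := exists_leftTail_le_mul_tail Q hpos hdbl
  set C := max C₂ 1 with hCdef
  have hC : 0 < C := lt_max_of_lt_left hC₂
  have hleft : ∀ t, leftTail Q t ≤ C * tail Q t := fun t => (hleft₂ t).trans
    (mul_le_mul_of_nonneg_right (le_max_left _ _) (tail_nonneg Q t))
  have hright : ∀ t, tail Q t ≤ C * tail Q t := fun t =>
    le_mul_of_one_le_left (tail_nonneg Q t) (le_max_right _ _)
  obtain ⟨a, ha, hatop, hscale⟩ := exists_scale (tail_antitone Q) hpos (tendsto_tail Q) hreg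
  have hlscale : ∀ t > 0, Tendsto (fun n : ℕ => (n + 1) * leftTail Q (a n * t)) atTop
      (𝓝 (t ^ (-α))) := fun t ht =>
    tendsto_scale_of_squeeze (tail_le_leftTail Q)
      (fun x c hx hc => leftTail_le_tail Q (mul_lt_of_lt_one_right hx hc)) ha hscale ht
  have hdom := eventually_scaled_tail_le ha hatop hscale hC₁ hpot
  choose! Λ hΛ using fun (ε : ℝ) (hε : 0 < ε) =>
    exists_tendsto_integral_threshold hQ hα hb ha hatop hscale hdom hW.le hy hε
  have htail := fun (ε δ : ℝ) (hε : 0 < ε) (hδ : 0 < δ) =>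
    eventually_abs_sub_le (tail_antitone Q) (tail_nonneg Q) (tail_le_one Q) hpos hα ha hscale
      hscale hC hright hε (hΛ ε hε) hδ
  have hltail := fun (ε δ : ℝ) (hε : 0 < ε) (hδ : 0 < δ) =>
    eventually_abs_sub_le (leftTail_antitone Q) (leftTail_nonneg Q) (leftTail_le_one Q) hpos hα ha
      hscale hlscale hC hleft hε (hΛ ε hε) hδ
  have hsmall : ∀ δ > 0, ∃ ε > 0, 4 * C * ε ^ α ≤ δ := by
    intro δ hδ
    refine ⟨(δ / (4 * C)) ^ α⁻¹, by positivity, ?_⟩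
    rw [← Real.rpow_mul (by positivity), inv_mul_cancel₀ hα.ne', Real.rpow_one,
      mul_div_cancel₀ _ (by positivity)]
  set u : ℕ → ℝ := fun n => (n + 1) * ∫ z, tail Q (threshold W y z)
    ∂(Measure.pi fun _ : Fin n => Q) with hu
  set v : ℕ → ℝ := fun n => (n + 1) * ∫ z, leftTail Q (threshold W y z)
    ∂(Measure.pi fun _ : Fin n => Q) with hv
  obtain ⟨L, hL⟩ : ∃ L, Tendsto u atTop (𝓝 L) := by
    refine exists_tendsto_of_approx fun δ hδ => ?_
    obtain ⟨ε, hε, hεδ⟩ := hsmall (δ / 2) (by positivity)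
    refine ⟨Λ ε, ?_⟩
    filter_upwards [htail ε (δ / 2) hε (by positivity)] with n hn
    rw [abs_le]
    constructor <;> linarith [hn.1, hn.2]
  have hL' : Tendsto v atTop (𝓝 L) := by
    have hdiff : Tendsto (fun n => v n - u n) atTop (𝓝 0) := by
      rw [Metric.tendsto_nhds]
      intro δ hδ
      obtain ⟨ε, hε, hεδ⟩ := hsmall (δ / 4) (by positivity)
      filter_upwards [htail ε (δ / 4) hε (by positivity), hltail ε (δ / 4) hε (by positivity)]
        with n hn1 hn2
      rw [Real.dist_eq, sub_zero, abs_lt]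
      constructor <;> linarith [hn1.1, hn1.2, hn2.1, hn2.2]
    simpa using hdiff.add hL
  have hLpos : 0 < L := by
    have hge : Λ 1 ≤ L := by
      refine le_of_forall_pos_le_add fun δ hδ => ?_
      have := ge_of_tendsto hL ((htail 1 δ one_pos hδ).mono fun n hn => hn.1)
      linarith
    refine lt_of_lt_of_le ?_ hge
    -- By `r ^ (-α) ≥ exp (-α r)`, a positive limit of a Laplace transform is a lower bound.
    obtain ⟨M, hM, hMlim⟩ := exists_tendsto_integral_exp hQ hb ha hatop hscale hdom W
      (mul_nonneg hα.le hy.le) hα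
    refine lt_of_lt_of_le (mul_pos (Real.exp_pos (-α)) hM)
      (le_of_tendsto_of_tendsto' (hMlim.const_mul _) (hΛ 1 one_pos) fun n => ?_)
    rw [← integral_const_mul]
    have hTm := measurable_threshold W y n
    have hpm := measurable_peak n
    refine integral_mono_ae ?_ ?_ ?_
    · refine Integrable.const_mul (Integrable.of_bound (by fun_prop) 1 ?_) _
      filter_upwards [ae_pi_nonneg Q hQ n] with z hz
      have hs := Finset.sum_nonneg fun j (_ : j ∈ Finset.univ) => hz j
      have hp := peak_nonneg hz
      rw [Real.norm_of_nonneg (Real.exp_nonneg _), Real.exp_le_one_iff, neg_nonpos]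
      have := ha n
      positivity
    · refine Integrable.of_bound (C := 1)
        ((measurable_const.max (hTm.div_const _)).pow_const _).aestronglyMeasurable
        (Eventually.of_forall fun z => ?_)
      rw [Real.norm_of_nonneg (Real.rpow_nonneg (zero_le_one.trans (le_max_left _ _)) _)]
      exact Real.rpow_le_one_of_one_le_of_nonpos (le_max_left _ _) (by linarith)
    · filter_upwards [ae_pi_nonneg Q hQ n] with z hz
      have hs := Finset.sum_nonneg fun j (_ : j ∈ Finset.univ) => hz j
      have hp := peak_nonneg hz
      have han := ha n
      have hs' : 0 ≤ ((∑ j, z j) + W) / a n := by positivity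
      have hp' : 0 ≤ peak z / a n := by positivity
      rw [threshold_div z (ha n), ← Real.exp_add]
      set r := max 1 (max (y * (((∑ j, z j) + W) / a n)) (peak z / a n)) with hr
      have hr0 : 0 < r := lt_max_of_lt_left one_pos
      have hrle : r ≤ 1 + y * (((∑ j, z j) + W) / a n) + peak z / a n := by
        have : 0 ≤ y * (((∑ j, z j) + W) / a n) := by positivity
        refine max_le (by linarith) (max_le (by linarith) (by linarith))
      rw [Real.rpow_def_of_pos hr0]
      refine Real.exp_le_exp.2 ?_
      have hlog : Real.log r ≤ r := (Real.log_le_sub_one_of_pos hr0).trans (by linarith)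
      nlinarith
  refine ⟨L, hLpos, ?_⟩
  have hconv : ∀ {H : ℝ → ℝ} {K : ℝ → Set ℝ}, Antitone H → (∀ t, 0 ≤ H t) → (∀ t, H t ≤ 1) →
      (∀ t, ENNReal.ofReal (H t) = Q (K t)) → ∀ n : ℕ,
      ENNReal.ofReal ((n + 1) * ∫ z, H (threshold W y z) ∂(Measure.pi fun _ : Fin n => Q)) =
        (n + 1) * ∫⁻ z, Q (K (threshold W y z)) ∂(Measure.pi fun _ : Fin n => Q) := by
    intro H K hH hH0 hH1 hHK n
    rw [ENNReal.ofReal_mul (by positivity), ENNReal.ofReal_add (by positivity) zero_le_one,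
      ENNReal.ofReal_natCast, ENNReal.ofReal_one,
      ofReal_integral_eq_lintegral_ofReal
        (integrable_comp_antitone hH hH0 hH1 (measurable_threshold W y n))
        (Eventually.of_forall fun z => hH0 _)]
    simp_rw [hHK]
  rw [← tendsto_add_atTop_iff_nat 1]
  refine tendsto_of_tendsto_of_tendsto_of_le_of_le (ENNReal.tendsto_ofReal hL)
    (ENNReal.tendsto_ofReal hL') (fun n => ?_) fun n => ?_
  · rw [hu]
    simp only
    rw [hconv (tail_antitone Q) (tail_nonneg Q) (tail_le_one Q) (ofReal_tail Q) n]
    exact le_fixedCoverage_succ Q hQ hW y n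
  · rw [hv]
    simp only
    rw [hconv (leftTail_antitone Q) (leftTail_nonneg Q) (leftTail_le_one Q) (ofReal_leftTail Q) n]
    exact fixedCoverage_succ_le Q hQ hW hy n

end

/-! ### The capacity for tails of index between `-1` and `0` -/

theorem eventually_two_rpow_mul_le {Q : Measure ℝ} {α γ : ℝ} (hγ : γ < α)
    (hpos : ∀ x, 0 < tail Q x)
    (hreg : Tendsto (fun x => tail Q (2 * x) / tail Q x) atTop (𝓝 (2 ^ (-α)))) :
    ∀ᶠ x in atTop, 2 ^ γ * tail Q (2 * x) ≤ tail Q x := by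
  have h1 : (2 : ℝ) ^ (-α) < 2 ^ (-γ) :=
    Real.rpow_lt_rpow_of_exponent_lt one_lt_two (by linarith)
  filter_upwards [hreg.eventually_lt_const h1] with x hx
  rw [div_lt_iff₀ (hpos x), Real.rpow_neg zero_le_two, lt_inv_mul_iff₀ (by positivity)] at hx
  exact hx.le

section

variable (Q : Measure ℝ)

theorem fixedCoverage_antitone (W : ℝ) (n : ℕ) : Antitone fun y => fixedCoverage Q W y n :=
  fun _ _ h => measure_mono fun _ hx => h.trans hx

theorem integral_one_div_one_add {y : ℝ} (hy : 0 ≤ y) :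
    ∫ t in (0 : ℝ)..y, 1 / (1 + |t|) = Real.log (1 + y) := by
  have h1 : ∫ t in (0 : ℝ)..y, 1 / (1 + |t|) = ∫ t in (0 : ℝ)..y, 1 / (1 + t) := by
    refine intervalIntegral.integral_congr fun t ht => ?_
    rw [uIcc_of_le hy] at ht
    simp only [abs_of_nonneg ht.1]
  rw [h1, intervalIntegral.integral_comp_add_left (fun t => 1 / t) 1,
    integral_one_div_of_pos (by norm_num) (by positivity)]
  simp

variable [IsProbabilityMeasure Q]

/-- The layer cake formula for the capacity: `log (1 + b)` is the integral of `1 / (1 + y)` over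
`[0, b]`. The absolute value makes the integrand continuous on the whole line. -/
theorem fixedCapacity_eq_lintegral (hQ : Q (Iio 0) = 0) {W : ℝ} (hW : 0 < W) (n : ℕ) :
    fixedCapacity Q W n =
      ∫⁻ y in Ioi 0, fixedCoverage Q W y n * ENNReal.ofReal (1 / (1 + |y|)) := by
  have hcont : Continuous fun t : ℝ => 1 / (1 + |t|) :=
    continuous_const.div (by fun_prop) fun t => by positivity
  have h := lintegral_comp_eq_lintegral_meas_le_mul (Measure.pi fun _ : Fin n => Q)
    (g := fun t => 1 / (1 + |t|)) (ae_best_nonneg Q hQ hW n) (measurable_best W n).aemeasurable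
    (fun t _ => hcont.intervalIntegrable _ _) (Eventually.of_forall fun t => by positivity)
  refine Eq.trans (lintegral_congr_ae ?_) h
  filter_upwards [ae_best_nonneg Q hQ hW n] with x hx
  rw [integral_one_div_one_add hx]

/-- A bound on the coverage which is uniform in the number of nodes and decays in the target:
against `n` interferers the threshold is at least `y` times the largest of them. -/
theorem fixedCoverage_le_rpow (hQ : Q (Iio 0) = 0) {W : ℝ} (hW : 0 < W) {γ C : ℝ} (hC : 0 < C)
    (hpot : ∀ s x, W ≤ s → s ≤ x → x ^ γ * tail Q x ≤ C * (s ^ γ * tail Q s))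
    {y : ℝ} (hy : 2 ≤ y) (n : ℕ) :
    fixedCoverage Q W y n ≤ ENNReal.ofReal (C * (y / 2) ^ (-γ)) := by
  have hy0 : 0 < y := by linarith
  obtain _ | n := n
  · have : {x : Fin 0 → ℝ | y ≤ best W x} = ∅ := by
      ext x
      simp [best, hy0]
    rw [fixedCoverage, this, measure_empty]
    exact zero_le
  refine (fixedCoverage_succ_le Q hQ hW hy0 n).trans ?_
  calc (n + 1) * ∫⁻ z, Q (Ici (threshold W y z)) ∂(Measure.pi fun _ : Fin n => Q)
      ≤ (n + 1) * ∫⁻ z, ENNReal.ofReal (C * (y / 2) ^ (-γ)) * Q (Ioi (peak z))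
          ∂(Measure.pi fun _ : Fin n => Q) := by
        refine mul_le_mul_right (lintegral_mono_ae ?_) _
        filter_upwards [ae_pi_nonneg Q hQ n] with z hz
        rw [← ofReal_leftTail, ← ofReal_tail, ← ENNReal.ofReal_mul (by positivity)]
        refine ENNReal.ofReal_le_ofReal ?_
        set m := max (peak z) W with hm
        have hWm : W ≤ m := le_max_right _ _
        have hm0 : 0 < m := hW.trans_le hWm
        have hmle : m ≤ (∑ j, z j) + W := by
          have h1 := peak_le_sum hz
          have h2 := Finset.sum_nonneg fun j (_ : j ∈ Finset.univ) => hz j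
          exact max_le (by linarith) (by linarith)
        have hlt : y / 2 * m < threshold W y z := by
          refine lt_of_lt_of_le ?_ (le_max_left _ _)
          calc y / 2 * m < y * m := by gcongr; linarith
            _ ≤ _ := by gcongr
        have h3 := hpot m (y / 2 * m) hWm (le_mul_of_one_le_left hm0.le (by linarith))
        have hmγ : 0 < m ^ γ := Real.rpow_pos_of_pos hm0 _
        have hyγ : 0 < (y / 2) ^ γ := Real.rpow_pos_of_pos (by positivity) _
        calc leftTail Q (threshold W y z) ≤ tail Q (y / 2 * m) := leftTail_le_tail Q hlt
          _ ≤ C * (y / 2) ^ (-γ) * tail Q m := by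
              rw [Real.rpow_neg (by positivity), ← div_eq_mul_inv,
                div_mul_eq_mul_div C ((y / 2) ^ γ) (tail Q m), le_div_iff₀ hyγ]
              rw [Real.mul_rpow (by positivity) hm0.le] at h3
              refine le_of_mul_le_mul_left ?_ hmγ
              linarith
          _ ≤ C * (y / 2) ^ (-γ) * tail Q (peak z) := by
              have := tail_antitone Q (le_max_left (peak z) W)
              gcongr
    _ = ENNReal.ofReal (C * (y / 2) ^ (-γ)) *
          ((n + 1) * ∫⁻ z, Q (Ioi (peak z)) ∂(Measure.pi fun _ : Fin n => Q)) := by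
        rw [lintegral_const_mul' _ _ ENNReal.ofReal_ne_top]
        ring
    _ ≤ ENNReal.ofReal (C * (y / 2) ^ (-γ)) * 1 := by
        gcongr
        exact succ_mul_lintegral_Ioi_peak_le_one Q n
    _ = _ := mul_one _

/-- For a tail of index between `-1` and `0`, the capacity converges to a positive finite limit. -/
theorem exists_tendsto_fixedCapacity (hQ : Q (Iio 0) = 0) (hpos : ∀ x, 0 < tail Q x) {α : ℝ}
    (hα : 0 < α) (hα1 : α < 1)
    (hreg : ∀ t > 0, Tendsto (fun x => tail Q (t * x) / tail Q x) atTop (𝓝 (t ^ (-α))))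
    {W : ℝ} (hW : 0 < W) :
    ∃ c, c ≠ 0 ∧ c ≠ ∞ ∧ Tendsto (fixedCapacity Q W) atTop (𝓝 c) ∧
      ∀ n, fixedCapacity Q W n ≠ ∞ := by
  choose! L hLpos hL using fun (y : ℝ) (hy : 0 < y) =>
    exists_tendsto_fixedCoverage hQ hpos hα hα1 hreg hW hy
  obtain ⟨γ, hγ0, hγ⟩ := exists_between hα
  obtain ⟨C, hC, hpot⟩ := exists_rpow_mul_le_of_two_mul_le (tail_antitone Q) hpos (tail_le_one Q)
    hγ0.le (eventually_two_rpow_mul_le hγ hpos (hreg 2 two_pos)) hW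
  -- An integrable bound for the integrand of the layer cake formula, uniform in `n`.
  set g : ℝ → ℝ≥0∞ := fun y => (Ioc 0 2).indicator 1 y +
    (Ioi 2).indicator (fun y => ENNReal.ofReal (C * 2 ^ γ * y ^ (-γ - 1))) y with hg
  have hgfin : ∫⁻ y in Ioi 0, g y ≠ ∞ := by
    have hm1 : Measurable ((Ioc (0 : ℝ) 2).indicator (1 : ℝ → ℝ≥0∞)) :=
      measurable_const.indicator measurableSet_Ioc
    rw [hg, lintegral_add_left hm1]
    refine ENNReal.add_ne_top.2 ⟨?_, ?_⟩
    · refine ne_top_of_le_ne_top ?_ (setLIntegral_le_lintegral _ _)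
      rw [lintegral_indicator_one measurableSet_Ioc]
      simp
    · refine ne_top_of_le_ne_top ?_ (setLIntegral_le_lintegral _ _)
      rw [lintegral_indicator measurableSet_Ioi]
      have hi : IntegrableOn (fun y : ℝ => C * 2 ^ γ * y ^ (-γ - 1)) (Ioi 2) :=
        (integrableOn_Ioi_rpow_of_lt (by linarith) two_pos).const_mul _
      exact hi.lintegral_lt_top.ne
  have hbound : ∀ n, ∀ y ∈ Ioi (0 : ℝ),
      fixedCoverage Q W y n * ENNReal.ofReal (1 / (1 + |y|)) ≤ g y := by
    intro n y hy
    have hy0 : 0 < y := hy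
    rcases le_or_gt y 2 with h | h
    · refine le_trans ?_ (le_add_right (le_of_eq (indicator_of_mem (show y ∈ Ioc 0 2 from
        ⟨hy0, h⟩) _).symm))
      refine mul_le_one' prob_le_one (ENNReal.ofReal_le_one.2 ?_)
      rw [div_le_one (by positivity)]
      linarith [abs_nonneg y]
    · refine le_trans ?_ (le_add_left (le_of_eq (indicator_of_mem (show y ∈ Ioi 2 from h) _).symm))
      refine (mul_le_mul' (fixedCoverage_le_rpow Q hQ hW hC hpot h.le n) le_rfl).trans ?_
      rw [← ENNReal.ofReal_mul (by positivity)]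
      refine ENNReal.ofReal_le_ofReal ?_
      have h1 : 1 / (1 + |y|) ≤ y ^ (-1 : ℝ) := by
        rw [Real.rpow_neg_one, one_div, abs_of_pos hy0]
        exact inv_anti₀ hy0 (by linarith)
      have h2 : (y / 2) ^ (-γ) = 2 ^ γ * y ^ (-γ) := by
        rw [Real.div_rpow hy0.le zero_le_two, Real.rpow_neg zero_le_two, div_inv_eq_mul, mul_comm]
      rw [h2, sub_eq_add_neg, Real.rpow_add hy0]
      calc C * (2 ^ γ * y ^ (-γ)) * (1 / (1 + |y|)) ≤ C * (2 ^ γ * y ^ (-γ)) * y ^ (-1 : ℝ) := by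
            gcongr
        _ = _ := by ring
  have hle : ∀ n, fixedCapacity Q W n ≤ ∫⁻ y in Ioi 0, g y := fun n => by
    rw [fixedCapacity_eq_lintegral Q hQ hW]
    exact setLIntegral_mono' measurableSet_Ioi (hbound n)
  have hlim : Tendsto (fixedCapacity Q W) atTop
      (𝓝 (∫⁻ y in Ioi 0, ENNReal.ofReal (L y) * ENNReal.ofReal (1 / (1 + |y|)))) := by
    rw [show fixedCapacity Q W = fun n => ∫⁻ y in Ioi 0, fixedCoverage Q W y n *
      ENNReal.ofReal (1 / (1 + |y|)) from funext fun n => fixedCapacity_eq_lintegral Q hQ hW n]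
    refine tendsto_lintegral_of_dominated_convergence' g (fun n => ?_) (fun n => ?_) hgfin ?_
    · refine ((fixedCoverage_antitone Q W n).measurable.mul ?_).aemeasurable
      exact (measurable_const.div (by fun_prop)).ennreal_ofReal
    · exact (ae_restrict_iff' measurableSet_Ioi).2 (Eventually.of_forall (hbound n))
    · refine (ae_restrict_iff' measurableSet_Ioi).2 (Eventually.of_forall fun y hy => ?_)
      exact ENNReal.Tendsto.mul_const (hL y hy) (Or.inr ENNReal.ofReal_ne_top)
  refine ⟨_, ?_, ?_, hlim, fun n => ne_top_of_le_ne_top hgfin (hle n)⟩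
  · have h1 := ENNReal.Tendsto.const_mul (a := ENNReal.ofReal (Real.log (1 + 1)))
      (hL 1 one_pos) (Or.inr ENNReal.ofReal_ne_top)
    have h2 := le_of_tendsto_of_tendsto' h1 hlim (log_mul_fixedCoverage_le Q W one_pos)
    refine (lt_of_lt_of_le ?_ h2).ne'
    exact ENNReal.mul_pos (ENNReal.ofReal_pos.2 (Real.log_pos (by norm_num))).ne'
      (ENNReal.ofReal_pos.2 (hLpos 1 one_pos)).ne'
  · exact ne_top_of_le_ne_top hgfin (le_of_tendsto' hlim hle)

theorem measure_Ici_le_fixedCoverage_one (hQ : Q (Iio 0) = 0) {W : ℝ} (hW : 0 < W) (y : ℝ) :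
    Q (Ici (y * W)) ≤ fixedCoverage Q W y 1 := by
  have h := (measurePreserving_eval (fun _ : Fin 1 => Q) 0).measure_preimage
    (measurableSet_Ici (a := y * W)).nullMeasurableSet
  rw [← h]
  refine measure_mono_ae ?_
  filter_upwards [ae_pi_nonneg Q hQ 1] with x hx hmem
  have h' : y * W ≤ x 0 := hmem
  exact (le_best_iff hW hx).2 ⟨0, by simpa using h'⟩

end

/-! ### Back to the Poisson network -/

section Network

variable {d : ℕ} (p : MultiSlope d) (Fm : Measure ℝ)

theorem tail_powerLaw : tail (powerLaw p Fm) = powerTail p Fm :=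
  funext fun t => (powerTail_eq p Fm t).symm

variable [IsProbabilityMeasure Fm]

theorem volume_domain_toNNReal_pos : 0 < (volume (domain p)).toNNReal :=
  ENNReal.toNNReal_pos (Metric.measure_ball_pos _ _ p.radius_pos).ne' measure_ball_lt_top.ne

theorem tendsto_mean : Tendsto (fun lam : ℝ≥0 => lam * (volume (domain p)).toNNReal) atTop atTop :=
  tendsto_id.atTop_mul_const (volume_domain_toNNReal_pos p)

variable {W y : ℝ} {L : ℝ≥0∞}

theorem tendsto_coverage (h : Tendsto (fixedCoverage (powerLaw p Fm) W y) atTop (𝓝 L)) :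
    Tendsto (coverage p Fm W y) atTop (𝓝 L) := by
  refine ((tendsto_lintegral_poissonMeasure h fun _ n => measure_ne_top _ _).comp
    (tendsto_mean p)).congr fun lam => ?_
  exact (coverage_eq p Fm W y lam).symm

theorem tendsto_capacity (h : Tendsto (fixedCapacity (powerLaw p Fm) W) atTop (𝓝 L))
    (hfin : L ≠ ∞ → ∀ n, fixedCapacity (powerLaw p Fm) W n ≠ ∞) :
    Tendsto (capacity p Fm W) atTop (𝓝 L) := by
  refine ((tendsto_lintegral_poissonMeasure h hfin).comp (tendsto_mean p)).congr fun lam => ?_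
  exact (capacity_eq p Fm W lam).symm

theorem tendsto_ratio {f : ℝ≥0 → ℝ≥0∞} (h : Tendsto f atTop (𝓝 L)) (h0 : L ≠ 0) (hL : L ≠ ∞)
    {u : ℝ≥0} (hu : 0 < u) : Tendsto (fun lam => f (u * lam) / f lam) atTop (𝓝 1) := by
  have h1 := ENNReal.Tendsto.div (h.comp (tendsto_id.const_mul_atTop hu)) (Or.inl h0) h
    (Or.inl hL)
  rwa [ENNReal.div_self h0 hL] at h1

/-- With positive probability there is exactly one node, which is received without interference. -/
theorem coverage_pos (hFm : Fm (Iio 0) = 0) (hW : 0 < W)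
    (h : 0 < powerLaw p Fm (Ici (y * W))) {lam : ℝ≥0} (hlam : 0 < lam) :
    0 < coverage p Fm W y lam := by
  have h1 := h.trans_le
    (measure_Ici_le_fixedCoverage_one (powerLaw p Fm) (powerLaw_Iio_zero p Fm hFm) hW y)
  rw [coverage_eq, lintegral_countable']
  refine lt_of_lt_of_le ?_ (ENNReal.le_tsum 1)
  refine ENNReal.mul_pos h1.ne' ?_
  rw [poissonMeasure_singleton]
  refine (ENNReal.ofReal_pos.2 ?_).ne'
  have := mul_pos hlam (volume_domain_toNNReal_pos p)
  positivity

theorem capacity_pos (hd : 1 ≤ d) (hFm : Fm (Iio 0) = 0) (hFm_pos : 0 < Fm (Ioi 0)) (hW : 0 < W)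
    {lam : ℝ≥0} (hlam : 0 < lam) : 0 < capacity p Fm W lam := by
  obtain ⟨δ, hδ, hδQ⟩ := exists_measure_Ioi_pos _ (powerLaw_Ioi_zero p Fm hd hFm_pos)
  have hy : 0 < δ / W := div_pos hδ hW
  have hcov : 0 < coverage p Fm W (δ / W) lam := by
    refine coverage_pos p Fm hFm hW ?_ hlam
    rw [div_mul_cancel₀ _ hW.ne']
    exact (pos_iff_ne_zero.2 hδQ).trans_le (measure_mono Ioi_subset_Ici_self)
  have hle : ENNReal.ofReal (Real.log (1 + δ / W)) * coverage p Fm W (δ / W) lam ≤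
      capacity p Fm W lam := by
    rw [coverage_eq, capacity_eq, ← lintegral_const_mul' _ _ ENNReal.ofReal_ne_top]
    exact lintegral_mono fun n => log_mul_fixedCoverage_le _ W hy n
  refine lt_of_lt_of_le (ENNReal.mul_pos ?_ hcov.ne') hle
  exact (ENNReal.ofReal_pos.2 (Real.log_pos (by linarith))).ne'

/-- Regular variation includes positivity of the tail on `(0, ∞)`, hence on the whole line. -/
theorem powerTail_pos {ρ : ℝ} (h : RegularlyVarying (powerTail p Fm) ρ) (x : ℝ) :
    0 < tail (powerLaw p Fm) x := by
  have h1 : 0 < tail (powerLaw p Fm) (max x 1) := by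
    rw [tail_powerLaw]
    exact h.2.1 _ (lt_max_of_lt_right one_pos)
  exact h1.trans_le (tail_antitone _ (le_max_left _ _))

/-- If the mean received power is finite, then coverage and capacity vanish in the dense limit. -/
theorem tendsto_zero_of_lintegral_ne_top (hd : 1 ≤ d) (hFm : Fm (Iio 0) = 0)
    (hFm_pos : 0 < Fm (Ioi 0)) (hW : 0 < W) (hy : 0 < y)
    (hint : ∫⁻ t, ENNReal.ofReal t ∂(powerLaw p Fm) ≠ ∞) :
    Tendsto (coverage p Fm W y) atTop (𝓝 0) ∧ Tendsto (capacity p Fm W) atTop (𝓝 0) := by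
  have hQ := powerLaw_Iio_zero p Fm hFm
  have hpos := powerLaw_Ioi_zero p Fm hd hFm_pos
  obtain ⟨h1, h2⟩ := tendsto_fixedCapacity_zero (powerLaw p Fm) hQ hpos hint hW
  exact ⟨tendsto_coverage p Fm (tendsto_fixedCoverage_zero _ hQ hpos hint hW hy),
    tendsto_capacity p Fm h1 fun _ => h2⟩

end Network

end UDN

theorem corollary2 (d : ℕ) (hd : 1 ≤ d) (p : MultiSlope d)
    (Fm : Measure ℝ) [IsProbabilityMeasure Fm]
    (hFm_nonneg : Fm (Iio 0) = 0) (hFm_pos : 0 < Fm (Ioi 0))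
    (W : ℝ) (hW : 0 < W) (y : ℝ) (hy : 0 < y) :
    -- slowly varying tail: coverage tends to one, capacity to infinity
    (RegularlyVarying (powerTail p Fm) 0 →
      Tendsto (coverage p Fm W y) atTop (𝓝 1) ∧ Tendsto (capacity p Fm W) atTop (𝓝 ∞)) ∧
    -- index between minus one and zero: saturation
    (∀ α : ℝ, 0 < α → α < 1 → RegularlyVarying (powerTail p Fm) (-α) →
      ∀ u : ℝ≥0, 0 < u →
        Tendsto (fun lam => coverage p Fm W y (u * lam) / coverage p Fm W y lam) atTop (𝓝 1) ∧
        Tendsto (fun lam => capacity p Fm W (u * lam) / capacity p Fm W lam) atTop (𝓝 1)) ∧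
    -- index below minus one: both vanish, and exceed their limit zero at some density
    (∀ α : ℝ, 1 < α → RegularlyVarying (powerTail p Fm) (-α) →
      Tendsto (coverage p Fm W y) atTop (𝓝 0) ∧ Tendsto (capacity p Fm W) atTop (𝓝 0) ∧
      (∃ lamp : ℝ≥0, 0 < lamp ∧ 0 < coverage p Fm W y lamp) ∧
      (∃ lamc : ℝ≥0, 0 < lamc ∧ 0 < capacity p Fm W lamc)) ∧
    -- lighter tails: the same, for coverage targets that are attainable without interference
    (∀ H : ℝ → ℝ, RapidlyVarying H → powerTail p Fm =o[atTop] H →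
      Tendsto (coverage p Fm W y) atTop (𝓝 0) ∧ Tendsto (capacity p Fm W) atTop (𝓝 0) ∧
      (0 < nodeLaw p Fm {z | y * W ≤ power p z} →
        ∃ lamp : ℝ≥0, 0 < lamp ∧ 0 < coverage p Fm W y lamp) ∧
      (∃ lamc : ℝ≥0, 0 < lamc ∧ 0 < capacity p Fm W lamc)) := by
  have hQ := powerLaw_Iio_zero p Fm hFm_nonneg
  refine ⟨fun h => ?_, fun α hα hα1 h u hu => ?_, fun α hα h => ?_, fun H hH hlit => ?_⟩
  · have hpos := powerTail_pos p Fm h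
    have hreg : ∀ t > 0, Tendsto (fun x => tail (powerLaw p Fm) (t * x) / tail (powerLaw p Fm) x)
        atTop (𝓝 1) := by
      intro t ht
      simpa [tail_powerLaw] using h.2.2 t ht
    have hcov := fun (y : ℝ) (hy : 0 < y) => tendsto_fixedCoverage_one _ hQ hpos hreg hW hy
    exact ⟨tendsto_coverage p Fm (hcov y hy),
      tendsto_capacity p Fm (tendsto_fixedCapacity_top _ hcov) fun h => absurd rfl h⟩
  · have hpos := powerTail_pos p Fm h
    have hreg := h.2.2
    rw [← tail_powerLaw] at hreg
    obtain ⟨L, hL, hcov⟩ := exists_tendsto_fixedCoverage hQ hpos hα hα1 hreg hW hy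
    obtain ⟨c, hc0, hc, hcap, hfin⟩ := exists_tendsto_fixedCapacity _ hQ hpos hα hα1 hreg hW
    exact ⟨tendsto_ratio (tendsto_coverage p Fm hcov) (ENNReal.ofReal_pos.2 hL).ne'
        ENNReal.ofReal_ne_top hu,
      tendsto_ratio (tendsto_capacity p Fm hcap fun _ => hfin) hc0 hc hu⟩
  · have hpos := powerTail_pos p Fm h
    have hreg := h.2.2 2 two_pos
    rw [← tail_powerLaw] at hreg
    obtain ⟨γ, hγ1, hγ⟩ := exists_between hα
    obtain ⟨h1, h2⟩ := tendsto_zero_of_lintegral_ne_top p Fm hd hFm_nonneg hFm_pos hW hy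
      (lintegral_ofReal_ne_top _ hγ1 (eventually_two_rpow_mul_le hγ hpos hreg)
        (Eventually.of_forall fun _ => le_rfl) hQ)
    refine ⟨h1, h2, ⟨1, one_pos, coverage_pos p Fm hFm_nonneg hW ?_ one_pos⟩,
      ⟨1, one_pos, capacity_pos p Fm hd hFm_nonneg hFm_pos hW one_pos⟩⟩
    refine lt_of_lt_of_le ?_ (measure_mono Ioi_subset_Ici_self)
    rw [← ofReal_tail]
    exact ENNReal.ofReal_pos.2 (hpos _)
  · have hdbl : ∀ᶠ x in atTop, (2 : ℝ) ^ (2 : ℝ) * H (2 * x) ≤ H x := by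
      have h4 : (0 : ℝ) < 1 / 2 ^ (2 : ℝ) := by positivity
      filter_upwards [(hH.2.2.1 2 one_lt_two).eventually_lt_const h4, eventually_gt_atTop 0]
        with x hx hx0
      rw [div_lt_div_iff₀ (hH.2.1 x hx0) (by positivity)] at hx
      linarith
    have hle : ∀ᶠ x in atTop, tail (powerLaw p Fm) x ≤ H x := by
      filter_upwards [hlit.bound one_pos, eventually_gt_atTop 0] with x hx hx0
      rw [← tail_powerLaw, one_mul, Real.norm_of_nonneg (tail_nonneg _ _),
        Real.norm_of_nonneg (hH.2.1 x hx0).le] at hx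
      exact hx
    obtain ⟨h1, h2⟩ := tendsto_zero_of_lintegral_ne_top p Fm hd hFm_nonneg hFm_pos hW hy
      (lintegral_ofReal_ne_top _ one_lt_two hdbl hle hQ)
    refine ⟨h1, h2, fun hatt => ⟨1, one_pos, coverage_pos p Fm hFm_nonneg hW ?_ one_pos⟩,
      ⟨1, one_pos, capacity_pos p Fm hd hFm_nonneg hFm_pos hW one_pos⟩⟩
    rwa [powerLaw_Ici]
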